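/- Let $n\ge 0$ and let $X=\mathbf C^n$ be affine space, regarded as an algebraic variety (with its Zariski topology), with coordinates $x_1,\dots,x_n$ and $\partial_i=\partial/\partial x_i$. Let $\mathcal D_X=\mathcal O_X\langle\partial_1,\dots,\partial_n\rangle$ be the sheaf of algebraic differential operators on $X$, and let $A_n=\mathbf C\langle x_1,\dots,x_n,\partial_1,\dots,\partial_n\rangle$ be the Weyl algebra, with the relations $x_ix_j=x_jx_i$, $\partial_i\partial_j=\partial_j\partial_i$, $\partial_ix_j=x_j\partial_i+\delta_{ij}$. Let $\mathcal M$ be a holonomic algebraic left $\mathcal D_X$-module; that is, $\mathcal M$ is quasi-coherent over $\mathcal O_X$, and the left $A_n$-module $M:=\Gamma(X,\mathcal M)$ is holonomic (belongs to the Bernstein class): it is finitely generated over $A_n$ and is either zero or of dimension $n$ with respect to the Bernstein filtration of $A_n$. Let $\mathrm{DR}(\mathcal M)$ be the complex of sheaves of $\mathbf C$-vector spaces $$0\longrightarrow \Omega_X^0\otimes_{\mathcal O_X}\mathcal M\stackrel{d}{\longrightarrow}\Omega_X^1\otimes_{\mathcal O_X}\mathcal M\stackrel{d}{\longrightarrow}\cdots\stackrel{d}{\longrightarrow}\Omega_X^n\otimes_{\mathcal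 O_X}\mathcal M\longrightarrow 0,$$ $$d(dx_{k_1}\wedge\cdots\wedge dx_{k_p}\otimes u)=\sum_{j=1}^n dx_j\wedge dx_{k_1}\wedge\cdots\wedge dx_{k_p}\otimes \partial_j u ,$$ where $\Omega_X^p$ is the sheaf of regular algebraic $p$-forms and $\Omega_X^p\otimes_{\mathcal O_X}\mathcal M$ is placed in degree $p-n$. Let $H^i(X,\mathrm{DR}(\mathcal M))=H^i(R\Gamma(X,\mathrm{DR}(\mathcal M)))$ be its hypercohomology. Let $\Phi$ be the automorphism of the $\mathbf C$-algebra $A_n$ with $\Phi(x_i)=-\partial_i$ and $\Phi(\partial_i)=x_i$ for $i=1,\dots,n$, and let $\hat M=\Phi(M)$ be the Fourier transform of $M$: the vector space $M$, on which $\Phi(a)$ acts as $a$ acts on $M$ for all $a\in A_n$ (so $x_i$ acts on $\hat M$ as $\partial_i$ acts on $M$, and $\partial_i$ acts on $\hat M$ as $-x_i$ acts on $M$). Then for every integer $i$ there is an isomorphism of $\mathbf C$-vector spaces $$H^i(X,\mathrm{DR}(\mathcal M))\;\cong\; H^i\bigl((A_n/(x_1A_n+\cdots+x_nA_n))\otimes^L_{A_n}\hat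 M\bigr).$$ -/

import Mathlib

noncomputable section

namespace WeylFourier

open CategoryTheory AlgebraicGeometry TopologicalSpace Opposite

section Localization
variable {k R S : Type} [CommRing k] [CommRing R] [Algebra k R] [CommRing S] [Algebra R S]
  (M : Submonoid R) [IsLocalization M S] (D : Derivation k R R)

/-- The ring homomorphism `r ↦ r + ε D(r)` to the dual numbers, extended to the localization. -/
def locDualHom : S →+* TrivSqZeroExt S S :=
  IsLocalization.lift (M := M) (S := S)
    (g := ({ toFun := fun r => TrivSqZeroExt.inl (algebraMap R S r) +
                TrivSqZeroExt.inr (algebraMap R S (D r))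
             map_one' := by simp
             map_zero' := by simp
             map_add' := fun a b => by ext <;> simp only [map_add, TrivSqZeroExt.fst_add,
                TrivSqZeroExt.snd_add, TrivSqZeroExt.fst_inl, TrivSqZeroExt.snd_inl,
                TrivSqZeroExt.fst_inr, TrivSqZeroExt.snd_inr] <;> ring
             map_mul' := fun a b => by ext <;> simp only [map_add, map_mul, Derivation.leibniz,
                TrivSqZeroExt.fst_add, smul_eq_mul, MulOpposite.smul_eq_mul_unop,
                MulOpposite.unop_op, TrivSqZeroExt.fst_mul, TrivSqZeroExt.snd_mul,
                TrivSqZeroExt.snd_add, TrivSqZeroExt.fst_inl, TrivSqZeroExt.snd_inl,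
                TrivSqZeroExt.fst_inr, TrivSqZeroExt.snd_inr] <;> ring } :
          R →+* TrivSqZeroExt S S))
    (fun y => by
      rw [TrivSqZeroExt.isUnit_iff_isUnit_fst]
      simpa using IsLocalization.map_units S y)

theorem locDualHom_algebraMap (r : R) :
    locDualHom M D (algebraMap R S r) =
      TrivSqZeroExt.inl (algebraMap R S r) + TrivSqZeroExt.inr (algebraMap R S (D r)) :=
  IsLocalization.lift_eq _ r

theorem locDualHom_fst (s : S) : (locDualHom M D s).fst = s := by
  have : (TrivSqZeroExt.fstHom S S S).toRingHom.comp (locDualHom M D) = RingHom.id S := by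
    apply IsLocalization.ringHom_ext M
    ext r
    simp [locDualHom_algebraMap]
  exact congrArg (fun f : S →+* S => f s) this

/-- The unique extension of a derivation to a localization. -/
def locDeriv (s : S) : S := (locDualHom M D s).snd

theorem locDeriv_add (s t : S) : locDeriv M D (s + t) = locDeriv M D s + locDeriv M D t := by
  simp [locDeriv]

theorem locDeriv_mul (s t : S) :
    locDeriv M D (s * t) = s * locDeriv M D t + t * locDeriv M D s := by
  simp [locDeriv, locDualHom_fst, mul_comm]

theorem locDeriv_algebraMap (r : R) :
    locDeriv M D (algebraMap R S r) = algebraMap R S (D r) := by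
  rw [locDeriv, locDualHom_algebraMap, TrivSqZeroExt.snd_add, TrivSqZeroExt.snd_inl,
    TrivSqZeroExt.snd_inr, zero_add]

/-- The quotient rule. -/
theorem locDeriv_quot (s : S) (a : R) (f : R) (h : s * algebraMap R S f = algebraMap R S a) :
    locDeriv M D s * algebraMap R S (f * f) = algebraMap R S (f * D a - a * D f) := by
  have h1 := congrArg (locDeriv M D) h
  rw [locDeriv_mul, locDeriv_algebraMap, locDeriv_algebraMap] at h1
  simp only [map_mul, map_sub]
  rw [← h1, ← h]
  ring

theorem locDeriv_comm (D' : Derivation k R R) (h : ∀ r, D (D' r) = D' (D r)) (s : S) :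
    locDeriv M D (locDeriv M D' s) = locDeriv M D' (locDeriv M D s) := by
  obtain ⟨⟨a, f⟩, hs⟩ := IsLocalization.surj M s
  have h1 := congrArg (fun t => locDeriv M D (locDeriv M D' t)) hs
  have h2 := congrArg (fun t => locDeriv M D' (locDeriv M D t)) hs
  simp only [locDeriv_mul, locDeriv_add, locDeriv_algebraMap] at h1 h2
  rw [h a, ← h2, h f] at h1
  refine (IsLocalization.map_units S f).mul_left_cancel ?_
  linear_combination h1

end Localization

section Sections
open StructureSheaf
variable {k R : Type} [CommRing k] [CommRing R] [Algebra k R] (D : Derivation k R R)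

/-- The extension of a derivation of `R` to the local ring of `Spec R` at a point. -/
def stalkDeriv (x : PrimeSpectrum R) (s : Localizations R x) : Localizations R x :=
  locDeriv x.asIdeal.primeCompl D s

theorem localizedModule_eq_mk_iff (M : Submonoid R) (t : LocalizedModule M R) (b : R) (g : M) :
    t = LocalizedModule.mk b g ↔ t * algebraMap R _ (g : R) = algebraMap R _ b := by
  have h1 : (LocalizedModule.mk b g : LocalizedModule M R) * algebraMap R _ (g : R) =
      algebraMap R _ b := by
    change (LocalizedModule.mk b g : LocalizedModule M R) * LocalizedModule.mk (g : R) 1 =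
      LocalizedModule.mk b 1
    refine Eq.trans LocalizedModule.mk_mul_mk (LocalizedModule.mk_eq.2 ⟨1, ?_⟩)
    simp [Submonoid.smul_def, mul_comm]
  rw [← h1]
  exact (IsUnit.mul_left_inj (IsLocalization.map_units (M := M) (LocalizedModule M R) g)).symm

theorem stalkDeriv_mk (x : PrimeSpectrum R) (s : Localizations R x) (a f : R)
    (hf : f ∉ x.asIdeal) (h : s = LocalizedModule.mk a ⟨f, hf⟩) :
    stalkDeriv D x s = LocalizedModule.mk (f * D a - a * D f)
      ⟨f * f, x.asIdeal.primeCompl.mul_mem hf hf⟩ := by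
  refine (localizedModule_eq_mk_iff x.asIdeal.primeCompl _ _ _).2 ?_
  exact locDeriv_quot _ D _ a f ((localizedModule_eq_mk_iff x.asIdeal.primeCompl _ _ _).1 h)

/-- A derivation of `R` acts on the sections of the structure sheaf of `Spec R`, pointwise
by its extension to the local rings. -/
def secDeriv (U : Opens (PrimeSpectrum.Top R)) (s : (structureSheafInType R R).obj.obj (op U)) :
    (structureSheafInType R R).obj.obj (op U) :=
  ⟨fun x => stalkDeriv D x.1 (s.1 x), fun x => by
    obtain ⟨V, hxV, i, a, f, h⟩ := s.2 x
    exact ⟨V, hxV, i, f * D a - a * D f, f * f, fun y =>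
      ⟨_, stalkDeriv_mk D y.1 _ a f (h y).1 (h y).2⟩⟩⟩

theorem stalkDeriv_add (x : PrimeSpectrum R) (s t : Localizations R x) :
    stalkDeriv D x (s + t) = stalkDeriv D x s + stalkDeriv D x t :=
  locDeriv_add x.asIdeal.primeCompl D s t

theorem stalkDeriv_mul (x : PrimeSpectrum R) (s t : Localizations R x) :
    stalkDeriv D x (s * t) = s * stalkDeriv D x t + t * stalkDeriv D x s :=
  locDeriv_mul x.asIdeal.primeCompl D s t

theorem stalkDeriv_algebraMap (x : PrimeSpectrum R) (r : R) :
    stalkDeriv D x (algebraMap R _ r) = algebraMap R _ (D r) :=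
  locDeriv_algebraMap (S := Localizations R x) x.asIdeal.primeCompl D r

theorem stalkDeriv_comm (D' : Derivation k R R) (h : ∀ r, D (D' r) = D' (D r))
    (x : PrimeSpectrum R) (s : Localizations R x) :
    stalkDeriv D x (stalkDeriv D' x s) = stalkDeriv D' x (stalkDeriv D x s) :=
  locDeriv_comm x.asIdeal.primeCompl D D' h s

variable (U : Opens (PrimeSpectrum.Top R)) (s t : (structureSheafInType R R).obj.obj (op U))

theorem secDeriv_add : secDeriv D U (s + t) = secDeriv D U s + secDeriv D U t :=
  Subtype.ext (funext fun x => stalkDeriv_add D x.1 (s.1 x) (t.1 x))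

theorem secDeriv_mul : secDeriv D U (s * t) = s * secDeriv D U t + t * secDeriv D U s :=
  Subtype.ext (funext fun x => stalkDeriv_mul D x.1 (s.1 x) (t.1 x))

theorem secDeriv_algebraMap (r : R) : secDeriv D U (algebraMap R _ r) = algebraMap R _ (D r) :=
  Subtype.ext (funext fun x => stalkDeriv_algebraMap D x.1 r)

theorem secDeriv_comm (D' : Derivation k R R) (h : ∀ r, D (D' r) = D' (D r)) :
    secDeriv D U (secDeriv D' U s) = secDeriv D' U (secDeriv D U s) :=
  Subtype.ext (funext fun x => stalkDeriv_comm D D' h x.1 (s.1 x))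

theorem secDeriv_res (V : Opens (PrimeSpectrum.Top R)) (i : V ⟶ U) :
    (structureSheafInType R R).obj.map i.op (secDeriv D U s) =
      secDeriv D V ((structureSheafInType R R).obj.map i.op s) := rfl

end Sections

/-- The affine space `X = ℂⁿ`, as a scheme. -/
abbrev X (n : ℕ) : Scheme.{0} := Spec (CommRingCat.of (MvPolynomial (Fin n) ℂ))

variable {n : ℕ}

/-- The regular function on `V` given by a polynomial. -/
def ofPoly (V : (X n).Opens) : MvPolynomial (Fin n) ℂ →+* Γ(X n, V) :=
  ((X n).presheaf.map (homOfLE le_top).op).hom.comp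
    (Scheme.ΓSpecIso (CommRingCat.of (MvPolynomial (Fin n) ℂ))).inv.hom

instance instAlgebraSections (V : (X n).Opens) : Algebra ℂ Γ(X n, V) :=
  ((ofPoly V).comp MvPolynomial.C).toAlgebra

/-- Restriction of regular functions. -/
def res {U V : (X n).Opens} (h : V ≤ U) : Γ(X n, U) →ₐ[ℂ] Γ(X n, V) :=
  { ((X n).presheaf.map (homOfLE h).op).hom with
    commutes' := fun _ => rfl }

theorem res_ofPoly {U V : (X n).Opens} (h : V ≤ U) (p : MvPolynomial (Fin n) ℂ) :
    res h (ofPoly U p) = ofPoly V p := rfl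

theorem res_res {U V W : (X n).Opens} (h : V ≤ U) (h' : W ≤ V) (s : Γ(X n, U)) :
    res h' (res h s) = res (h'.trans h) s := rfl

theorem res_self {U : (X n).Opens} (h : U ≤ U) (s : Γ(X n, U)) : res h s = s := rfl

/-- `∂/∂xᵢ` on regular functions, as a function. -/
def partialFun (i : Fin n) (V : (X n).Opens) (s : Γ(X n, V)) : Γ(X n, V) :=
  secDeriv (MvPolynomial.pderiv (R := ℂ) i) V s

theorem partialFun_mul (i : Fin n) (V : (X n).Opens) (s t : Γ(X n, V)) :
    partialFun i V (s * t) = s * partialFun i V t + t * partialFun i V s :=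
  secDeriv_mul _ V s t

theorem partialFun_ofPoly (i : Fin n) (V : (X n).Opens) (p : MvPolynomial (Fin n) ℂ) :
    partialFun i V (ofPoly V p) = ofPoly V (MvPolynomial.pderiv i p) :=
  secDeriv_algebraMap (MvPolynomial.pderiv (R := ℂ) i) V p

/-- `∂/∂xᵢ` on regular functions. -/
def partialEnd (i : Fin n) (V : (X n).Opens) : Module.End ℂ Γ(X n, V) where
  toFun := partialFun i V
  map_add' s t := secDeriv_add _ V s t
  map_smul' c s := by
    have h : partialFun i V (algebraMap ℂ Γ(X n, V) c) = 0 := by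
      have := partialFun_ofPoly i V (MvPolynomial.C c)
      rw [MvPolynomial.pderiv_C, map_zero] at this
      exact this
    simp only [Algebra.smul_def, RingHom.id_apply]
    rw [partialFun_mul, h, mul_zero, add_zero]

theorem partialEnd_comm (i j : Fin n) (V : (X n).Opens) (s : Γ(X n, V)) :
    partialEnd i V (partialEnd j V s) = partialEnd j V (partialEnd i V s) := by
  refine secDeriv_comm (MvPolynomial.pderiv (R := ℂ) i) V s (MvPolynomial.pderiv j) fun r => ?_
  have h : ⁅(MvPolynomial.pderiv i : Derivation ℂ (MvPolynomial (Fin n) ℂ)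
      (MvPolynomial (Fin n) ℂ)), (MvPolynomial.pderiv j : Derivation ℂ (MvPolynomial (Fin n) ℂ)
      (MvPolynomial (Fin n) ℂ))⁆ = 0 := by
    apply MvPolynomial.derivation_ext
    intro l
    simp [Derivation.commutator_apply, MvPolynomial.pderiv_X, Pi.single_apply, apply_ite]
  have h' := congrArg (fun E : Derivation ℂ (MvPolynomial (Fin n) ℂ)
    (MvPolynomial (Fin n) ℂ) => E r) h
  rw [Derivation.commutator_apply] at h'
  exact sub_eq_zero.1 h'

theorem partialEnd_res (i : Fin n) {U V : (X n).Opens} (h : V ≤ U) (s : Γ(X n, U)) :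
    res h (partialEnd i U s) = partialEnd i V (res h s) := rfl

/-- Families of `ℂ`-linear endomorphisms of `𝒪(V)`, one for every open `V ⊆ U`. -/
abbrev EndFamily (U : (X n).Opens) : Type :=
  (V : {V : (X n).Opens // V ≤ U}) → Module.End ℂ Γ(X n, V.1)

/-- Restriction of families of endomorphisms to a smaller open set. -/
def EndFamily.res {U V : (X n).Opens} (h : V ≤ U) : EndFamily U →ₐ[ℂ] EndFamily V :=
  AlgHom.pi fun W => Pi.evalAlgHom ℂ _ (⟨W.1, W.2.trans h⟩ : {V : (X n).Opens // V ≤ U})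

/-- Multiplication by the regular function `f`. -/
def EndFamily.mul {U : (X n).Opens} (f : Γ(X n, U)) : EndFamily U :=
  fun V => LinearMap.mulLeft ℂ (WeylFourier.res V.2 f)

/-- The vector field `∂/∂xᵢ`. -/
def EndFamily.vectorField (i : Fin n) (U : (X n).Opens) : EndFamily U :=
  fun V => partialEnd i V.1

/-- The algebra of operators generated by the regular functions on `U` and the `∂/∂xᵢ`. -/
def polyDiffOp (U : (X n).Opens) : Subalgebra ℂ (EndFamily U) :=
  Algebra.adjoin ℂ (Set.range EndFamily.mul ∪ Set.range fun i => EndFamily.vectorField i U)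

theorem polyDiffOp_res {U V : (X n).Opens} (h : V ≤ U) {P : EndFamily U} (hP : P ∈ polyDiffOp U) :
    EndFamily.res h P ∈ polyDiffOp V := by
  have h1 : (polyDiffOp U).map (EndFamily.res h) ≤ polyDiffOp V := by
    rw [polyDiffOp, AlgHom.map_adjoin]
    apply Algebra.adjoin_mono
    rintro _ ⟨_, ⟨f, rfl⟩ | ⟨i, rfl⟩, rfl⟩
    · exact Or.inl ⟨WeylFourier.res h f, rfl⟩
    · exact Or.inr ⟨i, rfl⟩
  exact h1 ⟨P, hP, rfl⟩

/-- The sections over `U` of the sheaf `𝒟_X = 𝒪_X⟨∂₁, …, ∂ₙ⟩`: the `ℂ`-linear endomorphisms of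
the sheaf `𝒪_U` that locally belong to the algebra generated by the regular functions and
the `∂/∂xᵢ`. -/
def diffOpSubalgebra (U : (X n).Opens) : Subalgebra ℂ (EndFamily U) where
  carrier := {P | (∀ (V W : {V : (X n).Opens // V ≤ U}) (h : W.1 ≤ V.1) (s : Γ(X n, V.1)),
      res h (P V s) = P W (res h s)) ∧
    ∀ x ∈ U, ∃ (V : (X n).Opens) (h : V ≤ U), x ∈ V ∧ EndFamily.res h P ∈ polyDiffOp V}
  mul_mem' := by
    rintro P Q ⟨hP, hP'⟩ ⟨hQ, hQ'⟩
    refine ⟨fun V W h s => ?_, fun x hx => ?_⟩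
    · simp only [Pi.mul_apply, Module.End.mul_apply]
      rw [hP V W h, hQ V W h]
    · obtain ⟨V, hV, hxV, hPV⟩ := hP' x hx
      obtain ⟨W, hW, hxW, hQW⟩ := hQ' x hx
      refine ⟨V ⊓ W, inf_le_left.trans hV, ⟨hxV, hxW⟩, ?_⟩
      rw [map_mul]
      exact mul_mem (polyDiffOp_res (inf_le_left : V ⊓ W ≤ V) hPV)
        (polyDiffOp_res (inf_le_right : V ⊓ W ≤ W) hQW)
  add_mem' := by
    rintro P Q ⟨hP, hP'⟩ ⟨hQ, hQ'⟩
    refine ⟨fun V W h s => ?_, fun x hx => ?_⟩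
    · simp only [Pi.add_apply, LinearMap.add_apply, map_add]
      rw [hP V W h, hQ V W h]
    · obtain ⟨V, hV, hxV, hPV⟩ := hP' x hx
      obtain ⟨W, hW, hxW, hQW⟩ := hQ' x hx
      refine ⟨V ⊓ W, inf_le_left.trans hV, ⟨hxV, hxW⟩, ?_⟩
      rw [map_add]
      exact add_mem (polyDiffOp_res (inf_le_left : V ⊓ W ≤ V) hPV)
        (polyDiffOp_res (inf_le_right : V ⊓ W ≤ W) hQW)
  algebraMap_mem' c := by
    refine ⟨fun V W h s => ?_, fun x hx => ⟨U, le_rfl, hx, ?_⟩⟩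
    · simp only [Pi.algebraMap_apply, Module.algebraMap_end_apply, map_smul]
    · rw [AlgHom.commutes]
      exact (polyDiffOp U).algebraMap_mem c

theorem polyDiffOp_le (U : (X n).Opens) : polyDiffOp U ≤ diffOpSubalgebra U := by
  intro P hP
  refine ⟨?_, fun x hx => ⟨U, le_rfl, hx, polyDiffOp_res le_rfl hP⟩⟩
  induction hP using Algebra.adjoin_induction with
  | mem P hP =>
    rcases hP with ⟨f, rfl⟩ | ⟨i, rfl⟩
    · intro V W h s
      simp only [EndFamily.mul, LinearMap.mulLeft_apply, map_mul]
      rfl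
    · intro V W h s
      rfl
  | algebraMap c => exact ((diffOpSubalgebra U).algebraMap_mem c).1
  | add P Q _ _ hP hQ =>
    intro V W h s
    simp only [Pi.add_apply, LinearMap.add_apply, map_add]
    rw [hP V W h, hQ V W h]
  | mul P Q _ _ hP hQ =>
    intro V W h s
    simp only [Pi.mul_apply, Module.End.mul_apply]
    rw [hP V W h, hQ V W h]

/-- The ring `𝒟_X(U)` of algebraic differential operators on `U`. -/
def DiffOp (U : (X n).Opens) : Type := diffOpSubalgebra U

instance (U : (X n).Opens) : Ring (DiffOp U) := inferInstanceAs (Ring (diffOpSubalgebra U))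

instance (U : (X n).Opens) : Algebra ℂ (DiffOp U) :=
  inferInstanceAs (Algebra ℂ (diffOpSubalgebra U))

/-- Restriction of differential operators. -/
def diffOpRes {U V : (X n).Opens} (h : V ≤ U) : DiffOp U →ₐ[ℂ] DiffOp V :=
  ((EndFamily.res h).comp (diffOpSubalgebra U).val).codRestrict (diffOpSubalgebra V) (by
    rintro ⟨P, hP, hP'⟩
    refine ⟨fun W W' hW s => hP ⟨W.1, W.2.trans h⟩ ⟨W'.1, W'.2.trans h⟩ hW s, fun x hx => ?_⟩
    obtain ⟨W, hW, hxW, hPW⟩ := hP' x (h hx)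
    exact ⟨V ⊓ W, inf_le_left, ⟨hx, hxW⟩,
      polyDiffOp_res (inf_le_right : V ⊓ W ≤ W) hPW⟩)

/-- The presheaf of rings `U ↦ 𝒟_X(U)`. -/
def diffOpPresheaf (n : ℕ) : TopCat.Presheaf RingCat.{0} (X n) where
  obj U := RingCat.of (DiffOp U.unop)
  map i := RingCat.ofHom (diffOpRes (leOfHom i.unop)).toRingHom
  map_id _ := rfl
  map_comp _ _ := rfl

theorem exists_glue (V : (X n).Opens) {ι : Type} (W : ι → (X n).Opens) (hW : ∀ i, W i ≤ V)
    (hV : V ≤ iSup W) (t : ∀ i, Γ(X n, W i))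
    (ht : ∀ i j, res inf_le_left (t i) = (res inf_le_right (t j) : Γ(X n, W i ⊓ W j))) :
    ∃! s : Γ(X n, V), ∀ i, res (hW i) s = t i :=
  TopCat.Sheaf.existsUnique_gluing' (X n).sheaf W V (fun i => homOfLE (hW i)) hV t ht

theorem diffOp_glue {ι : Type} (U : ι → (X n).Opens) (P : ∀ i, DiffOp (U i))
    (hP : ∀ i j, diffOpRes (inf_le_left : U i ⊓ U j ≤ U i) (P i) =
      diffOpRes (inf_le_right : U i ⊓ U j ≤ U j) (P j)) :
    ∃! Q : DiffOp (iSup U), ∀ i, diffOpRes (le_iSup U i) Q = P i := by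
  have hP' : ∀ (i j : ι) (V : (X n).Opens) (hi : V ≤ U i) (hj : V ≤ U j),
      (P i).1 ⟨V, hi⟩ = (P j).1 ⟨V, hj⟩ := by
    intro i j V hi hj
    exact congrArg (fun Q => Q.1 ⟨V, le_inf hi hj⟩) (hP i j)
  have hcov : ∀ V : (X n).Opens, V ≤ iSup U → V ≤ iSup fun i => V ⊓ U i := by
    intro V hV
    rw [← inf_iSup_eq]
    exact le_inf le_rfl hV
  have hglue : ∀ (V : {V : (X n).Opens // V ≤ iSup U}) (s : Γ(X n, V.1)), ∃! t : Γ(X n, V.1),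
      ∀ i, res inf_le_left t = (P i).1 ⟨V.1 ⊓ U i, inf_le_right⟩ (res inf_le_left s) := by
    intro V s
    refine exists_glue V.1 (fun i => V.1 ⊓ U i) (fun i => inf_le_left) (hcov V.1 V.2) _ ?_
    intro i j
    have h1 := (P i).2.1 ⟨V.1 ⊓ U i, inf_le_right⟩
      ⟨(V.1 ⊓ U i) ⊓ (V.1 ⊓ U j), inf_le_left.trans inf_le_right⟩ inf_le_left (res inf_le_left s)
    have h2 := (P j).2.1 ⟨V.1 ⊓ U j, inf_le_right⟩
      ⟨(V.1 ⊓ U i) ⊓ (V.1 ⊓ U j), inf_le_right.trans inf_le_right⟩ inf_le_right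
      (res inf_le_left s)
    rw [h1, h2, hP' i j _ _ (inf_le_right.trans inf_le_right)]
    rfl
  choose Q hQ hQ' using hglue
  let Q' : EndFamily (iSup U) := fun V =>
    { toFun := Q V
      map_add' := fun s t => (hQ' V (s + t) _ fun i => by
        simp only [map_add]
        rw [hQ V s i, hQ V t i]).symm
      map_smul' := fun c s => (hQ' V (c • s) _ fun i => by
        simp only [map_smul, RingHom.id_apply]
        rw [hQ V s i]).symm }
  have hres : ∀ i, EndFamily.res (le_iSup U i) Q' = (P i).1 := by
    intro i
    funext V
    apply LinearMap.ext
    intro s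
    refine (hQ' ⟨V.1, V.2.trans (le_iSup U i)⟩ s _ fun j => ?_).symm
    rw [(P i).2.1 V ⟨V.1 ⊓ U j, inf_le_left.trans V.2⟩ inf_le_left, hP' i j]
  have hmem : Q' ∈ diffOpSubalgebra (iSup U) := by
    refine ⟨fun V W h s => hQ' W _ _ fun i => ?_, fun x hx => ?_⟩
    · have h1 := congrArg (res (inf_le_inf_right (U i) h : W.1 ⊓ U i ≤ V.1 ⊓ U i)) (hQ V s i)
      have h2 := (P i).2.1 ⟨V.1 ⊓ U i, inf_le_right⟩ ⟨W.1 ⊓ U i, inf_le_right⟩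
        (inf_le_inf_right (U i) h) (res inf_le_left s)
      exact h1.trans h2
    · obtain ⟨i, hi⟩ := Opens.mem_iSup.1 hx
      obtain ⟨V, hV, hxV, hPV⟩ := (P i).2.2 x hi
      rw [← hres i] at hPV
      exact ⟨V, hV.trans (le_iSup U i), hxV, hPV⟩
  refine ⟨⟨Q', hmem⟩, fun i => Subtype.ext (hres i), ?_⟩
  rintro ⟨T, hT⟩ hTP
  apply Subtype.ext
  funext V
  apply LinearMap.ext
  intro s
  refine hQ' V s _ fun i => ?_
  have h1 := congrArg (fun E => E.1 ⟨V.1 ⊓ U i, inf_le_right⟩) (hTP i)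
  rw [hT.1 V ⟨V.1 ⊓ U i, inf_le_left.trans V.2⟩ inf_le_left]
  exact congrArg (fun E : Module.End ℂ _ => E (res inf_le_left s)) h1

theorem diffOpPresheaf_isSheaf (n : ℕ) : (diffOpPresheaf n).IsSheaf := by
  rw [TopCat.Presheaf.isSheaf_iff_isSheaf_comp (forget RingCat)]
  apply TopCat.Presheaf.isSheaf_of_isSheafUniqueGluing_types
  intro ι U P hP
  exact diffOp_glue U P hP

/-- The sheaf of rings `𝒟_X` of algebraic differential operators on `X = ℂⁿ`. -/
def sheafD (n : ℕ) : Sheaf (Opens.grothendieckTopology (X n)) RingCat.{0} :=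
  ⟨diffOpPresheaf n, diffOpPresheaf_isSheaf n⟩

/-- The inclusion of `𝒪_X` into `𝒟_X`, as multiplication operators. -/
def functionToD (n : ℕ) : (X n).ringCatSheaf ⟶ sheafD n where
  hom :=
    { app := fun U => RingCat.ofHom
        { toFun := fun f => ⟨EndFamily.mul f,
            polyDiffOp_le _ (Algebra.subset_adjoin (Or.inl ⟨f, rfl⟩))⟩
          map_one' := by
            apply Subtype.ext; funext V; ext s
            exact (congrArg (· * s) (map_one (res V.2))).trans (one_mul s)
          map_mul' := fun f g => by
            apply Subtype.ext; funext V; ext s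
            exact (congrArg (· * s) (map_mul (res V.2) f g)).trans (mul_assoc _ _ s)
          map_zero' := by
            apply Subtype.ext; funext V; ext s
            exact (congrArg (· * s) (map_zero (res V.2))).trans (zero_mul s)
          map_add' := fun f g => by
            apply Subtype.ext; funext V; ext s
            exact (congrArg (· * s) (map_add (res V.2) f g)).trans (add_mul _ _ s) }
      naturality := fun _ _ _ => rfl }

/-- The category of left `𝒟_X`-modules on `X = ℂⁿ`. -/
abbrev DMod (n : ℕ) := SheafOfModules.{0} (sheafD n)

/-- The `𝒪_X`-module underlying a `𝒟_X`-module. -/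
def DMod.toO (M : DMod n) : (X n).Modules :=
  (SheafOfModules.restrictScalars (functionToD n)).obj M

section Weyl
/-- The defining relations of the Weyl algebra; `inl i` stands for `xᵢ` and `inr i` for `∂ᵢ`. -/
inductive WeylRel (n : ℕ) : FreeAlgebra ℂ (Fin n ⊕ Fin n) → FreeAlgebra ℂ (Fin n ⊕ Fin n) → Prop
  | xx (i j : Fin n) : WeylRel n
      (FreeAlgebra.ι ℂ (Sum.inl i) * FreeAlgebra.ι ℂ (Sum.inl j))
      (FreeAlgebra.ι ℂ (Sum.inl j) * FreeAlgebra.ι ℂ (Sum.inl i))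
  | dd (i j : Fin n) : WeylRel n
      (FreeAlgebra.ι ℂ (Sum.inr i) * FreeAlgebra.ι ℂ (Sum.inr j))
      (FreeAlgebra.ι ℂ (Sum.inr j) * FreeAlgebra.ι ℂ (Sum.inr i))
  | dx (i j : Fin n) : WeylRel n
      (FreeAlgebra.ι ℂ (Sum.inr i) * FreeAlgebra.ι ℂ (Sum.inl j))
      (FreeAlgebra.ι ℂ (Sum.inl j) * FreeAlgebra.ι ℂ (Sum.inr i) + if i = j then 1 else 0)

/-- The Weyl algebra `Aₙ = ℂ⟨x₁, …, xₙ, ∂₁, …, ∂ₙ⟩`. -/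
def Weyl (n : ℕ) : Type := RingQuot (WeylRel n)

instance (n : ℕ) : Ring (Weyl n) := inferInstanceAs (Ring (RingQuot (WeylRel n)))

instance (n : ℕ) : Algebra ℂ (Weyl n) := inferInstanceAs (Algebra ℂ (RingQuot (WeylRel n)))

namespace Weyl
variable {n : ℕ}

/-- The generator `xᵢ`. -/
def x (i : Fin n) : Weyl n := RingQuot.mkAlgHom ℂ (WeylRel n) (FreeAlgebra.ι ℂ (Sum.inl i))

/-- The generator `∂ᵢ`. -/
def d (i : Fin n) : Weyl n := RingQuot.mkAlgHom ℂ (WeylRel n) (FreeAlgebra.ι ℂ (Sum.inr i))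

theorem x_mul_x (i j : Fin n) : x i * x j = x j * x i := by
  simpa only [map_mul] using! RingQuot.mkAlgHom_rel ℂ (WeylRel.xx i j)

theorem d_mul_d (i j : Fin n) : d i * d j = d j * d i := by
  simpa only [map_mul] using! RingQuot.mkAlgHom_rel ℂ (WeylRel.dd i j)

theorem d_mul_x (i j : Fin n) : d i * x j = x j * d i + if i = j then 1 else 0 := by
  have := RingQuot.mkAlgHom_rel ℂ (WeylRel.dx i j)
  rw [map_add, map_mul, map_mul, apply_ite (RingQuot.mkAlgHom ℂ (WeylRel n)), map_one,
    map_zero] at this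
  exact this

/-- The universal property of the Weyl algebra. -/
def lift {B : Type} [Ring B] [Algebra ℂ B] (a b : Fin n → B)
    (haa : ∀ i j, a i * a j = a j * a i) (hbb : ∀ i j, b i * b j = b j * b i)
    (hba : ∀ i j, b i * a j = a j * b i + if i = j then 1 else 0) : Weyl n →ₐ[ℂ] B :=
  RingQuot.liftAlgHom ℂ ⟨FreeAlgebra.lift ℂ (Sum.elim a b), by
    intro p q h
    cases h with
    | xx i j => simpa using haa i j
    | dd i j => simpa using hbb i j
    | dx i j => simpa [apply_ite] using hba i j⟩

section
variable {B : Type} [Ring B] [Algebra ℂ B] (a b : Fin n → B)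
    (haa : ∀ i j, a i * a j = a j * a i) (hbb : ∀ i j, b i * b j = b j * b i)
    (hba : ∀ i j, b i * a j = a j * b i + if i = j then 1 else 0)

theorem lift_x (i : Fin n) : lift a b haa hbb hba (x i) = a i :=
  (RingQuot.liftAlgHom_mkAlgHom_apply ..).trans (by simp)

theorem lift_d (i : Fin n) : lift a b haa hbb hba (d i) = b i :=
  (RingQuot.liftAlgHom_mkAlgHom_apply ..).trans (by simp)
end

theorem algHom_ext {B : Type} [Ring B] [Algebra ℂ B] {f g : Weyl n →ₐ[ℂ] B}
    (hx : ∀ i, f (x i) = g (x i)) (hd : ∀ i, f (d i) = g (d i)) : f = g := by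
  apply RingQuot.ringQuot_ext'
  apply FreeAlgebra.hom_ext
  funext i
  rcases i with i | i
  · exact hx i
  · exact hd i

/-- The endomorphism of `Aₙ` with `xᵢ ↦ -∂ᵢ` and `∂ᵢ ↦ xᵢ`. -/
def fourierHom (n : ℕ) : Weyl n →ₐ[ℂ] Weyl n :=
  lift (fun i => -d i) x (fun i j => by rw [neg_mul_neg, neg_mul_neg, d_mul_d]) x_mul_x
    (fun i j => by rw [mul_neg, neg_mul, d_mul_x]; simp only [eq_comm]; abel)

/-- The endomorphism of `Aₙ` with `xᵢ ↦ ∂ᵢ` and `∂ᵢ ↦ -xᵢ`. -/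
def fourierInvHom (n : ℕ) : Weyl n →ₐ[ℂ] Weyl n :=
  lift d (fun i => -x i) d_mul_d (fun i j => by rw [neg_mul_neg, neg_mul_neg, x_mul_x])
    (fun i j => by rw [mul_neg, neg_mul, d_mul_x]; simp only [eq_comm]; abel)

theorem fourierHom_x (i : Fin n) : fourierHom n (x i) = -d i := lift_x ..

theorem fourierHom_d (i : Fin n) : fourierHom n (d i) = x i := lift_d ..

theorem fourierInvHom_x (i : Fin n) : fourierInvHom n (x i) = d i := lift_x ..

theorem fourierInvHom_d (i : Fin n) : fourierInvHom n (d i) = -x i := lift_d ..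

/-- The automorphism `Φ` of `Aₙ` with `Φ(xᵢ) = -∂ᵢ` and `Φ(∂ᵢ) = xᵢ`. -/
def fourier (n : ℕ) : Weyl n ≃ₐ[ℂ] Weyl n :=
  AlgEquiv.ofAlgHom (fourierHom n) (fourierInvHom n)
    (algHom_ext
      (fun i => by
        rw [AlgHom.comp_apply, fourierInvHom_x, fourierHom_d, AlgHom.id_apply])
      (fun i => by
        rw [AlgHom.comp_apply, fourierInvHom_d, map_neg, fourierHom_x, neg_neg, AlgHom.id_apply]))
    (algHom_ext
      (fun i => by
        rw [AlgHom.comp_apply, fourierHom_x, map_neg, fourierInvHom_d, neg_neg, AlgHom.id_apply])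
      (fun i => by
        rw [AlgHom.comp_apply, fourierHom_d, fourierInvHom_x, AlgHom.id_apply]))

theorem fourier_x (i : Fin n) : fourier n (x i) = -d i := lift_x ..

theorem fourier_d (i : Fin n) : fourier n (d i) = x i := lift_d ..

/-- The Fourier transform `M̂ = Φ(M)` of a left `Aₙ`-module `M`: the same vector space, on which
`Φ(a)` acts as `a` acts on `M`. -/
def fourierTransform (M : ModuleCat.{0} (Weyl n)) : ModuleCat.{0} (Weyl n) :=
  (ModuleCat.restrictScalars ((fourier n).symm : Weyl n →+* Weyl n)).obj M

/-- The Bernstein filtration of `Aₙ`: `bernstein k` is spanned by the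
products of at most `k` of the generators `xᵢ`, `∂ᵢ`. -/
def bernstein (n k : ℕ) : Submodule ℂ (Weyl n) :=
  (1 ⊔ Submodule.span ℂ (Set.range x ∪ Set.range d)) ^ k

/-- A left `Aₙ`-module is holonomic (belongs to the Bernstein class) if it is generated by a
finite set `S` such that the dimension of `bernstein k · S` grows at most
like `k ^ n`, that is, if it is finitely generated and zero or of dimension `n`. -/
def IsHolonomic (M : ModuleCat.{0} (Weyl n)) : Prop :=
  ∃ S : Finset M, Submodule.span (Weyl n) (S : Set M) = ⊤ ∧ ∃ c : ℕ, ∀ k : ℕ,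
    Module.rank ℂ (Submodule.span ℂ
      {u : (ModuleCat.restrictScalars (algebraMap ℂ (Weyl n))).obj M |
        ∃ a ∈ bernstein n k, ∃ m ∈ S, u = a • m}) ≤ (c * (k + 1) ^ n : ℕ)

/-- The right ideal `x₁Aₙ + ⋯ + xₙAₙ`. -/
def rightIdealX (n : ℕ) : Submodule (Weyl n)ᵐᵒᵖ (Weyl n) := Submodule.span _ (Set.range x)

end Weyl
end Weyl

section Tensor
open TensorProduct
variable {k A : Type} [CommRing k] [Ring A] [Algebra k A]
  (N : Type) [AddCommGroup N] [Module k N] [Module Aᵐᵒᵖ N]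

/-- The `k`-module underlying a left `A`-module. -/
abbrev baseModule (M : ModuleCat.{0} A) : ModuleCat.{0} k :=
  (ModuleCat.restrictScalars (algebraMap k A)).obj M

/-- The action of `a ∈ A` on the `k`-module underlying a left `A`-module. -/
def baseAct (M : ModuleCat.{0} A) (a : A) (m : baseModule (k := k) M) : baseModule (k := k) M :=
  (a • (show M from m) : M)

/-- The relations `(x · a) ⊗ m = x ⊗ (a · m)` that define the tensor product over `A`
of a right module `N` and a left module `M`. -/
def tensorRel (M : ModuleCat.{0} A) : Submodule k (N ⊗[k] baseModule (k := k) M) :=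
  Submodule.span k {t | ∃ (x : N) (a : A) (m : baseModule (k := k) M),
    t = (MulOpposite.op a • x) ⊗ₜ[k] m - x ⊗ₜ[k] baseAct M a m}

theorem tensorRel_le_comap {M M' : ModuleCat.{0} A} (f : M ⟶ M') :
    tensorRel (k := k) N M ≤ (tensorRel (k := k) N M').comap
      (((ModuleCat.restrictScalars (algebraMap k A)).map f).hom.lTensor N) := by
  rw [tensorRel, Submodule.span_le]
  rintro _ ⟨x, a, m, rfl⟩
  refine Submodule.subset_span
    ⟨x, a, ((ModuleCat.restrictScalars (algebraMap k A)).map f).hom m, ?_⟩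
  rw [map_sub, LinearMap.lTensor_tmul, LinearMap.lTensor_tmul]
  congr 2
  exact f.hom.map_smul a m

/-- The functor `M ↦ N ⊗_A M`, with values in `k`-modules. -/
def tensorFunctor : ModuleCat.{0} A ⥤ ModuleCat.{0} k where
  obj M := ModuleCat.of k ((N ⊗[k] baseModule (k := k) M) ⧸ tensorRel (k := k) N M)
  map f := ModuleCat.ofHom (Submodule.mapQ _ _
    (((ModuleCat.restrictScalars (algebraMap k A)).map f).hom.lTensor N) (tensorRel_le_comap N f))
  map_id _ :=
    ModuleCat.hom_ext (Submodule.linearMap_qext _ (TensorProduct.ext' fun _ _ => rfl))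
  map_comp _ _ :=
    ModuleCat.hom_ext (Submodule.linearMap_qext _ (TensorProduct.ext' fun _ _ => rfl))

instance : (tensorFunctor (k := k) (A := A) N).Additive where
  map_add {M M' f g} := by
    refine ModuleCat.hom_ext (Submodule.linearMap_qext _ (TensorProduct.ext' fun x m => ?_))
    exact (congrArg (tensorRel (k := k) N M').mkQ
      (TensorProduct.tmul_add (R := k) (N := baseModule (k := k) M') x
        (f.hom (show M from m)) (g.hom (show M from m)))).trans
      (map_add _ _ _)

/-- The vector space `Hⁱ(N ⊗ᴸ_A M)`, computed from a projective resolution of `M`. -/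
def derivedTensor (M : ModuleCat.{0} A) (i : ℤ) : ModuleCat.{0} k :=
  (((tensorFunctor (k := k) N).mapHomologicalComplex (ComplexShape.up ℤ)).obj
    (projectiveResolution M).cochainComplex).homology i

end Tensor


section Koszul
open Limits
variable {C : Type*} [Category* C] [Preadditive C] [HasFiniteBiproducts C] {n : ℕ}

/-- The coefficient of `e_L` in `e_j ∧ e_K`, for `e_K` the wedge product of the basis
vectors `e_k`, `k ∈ K`, in increasing order. -/
def wedgeCoeff (j : Fin n) (K L : Finset (Fin n)) : ℤ :=
  if j ∉ K ∧ insert j K = L then (-1) ^ (K.filter (· < j)).card else 0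

theorem wedgeCoeff_eq_zero {j : Fin n} {K L : Finset (Fin n)} (h : L.card ≠ K.card + 1) :
    wedgeCoeff j K L = 0 := by
  rw [wedgeCoeff, if_neg]
  rintro ⟨hj, rfl⟩
  exact h (Finset.card_insert_of_notMem hj)

/-- The subsets of `{1, …, n}` with `p + n` elements. -/
abbrev WedgeIndex (n : ℕ) (p : ℤ) : Type := {K : Finset (Fin n) // (K.card : ℤ) = p + n}

theorem sum_wedgeCoeff (p q : ℤ) (hq : q = p + 1) (K : WedgeIndex n p) (M : Finset (Fin n))
    (i j : Fin n) :
    ∑ L : WedgeIndex n q, wedgeCoeff i K.1 L.1 * wedgeCoeff j L.1 M =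
      if i ∉ K.1 then wedgeCoeff i K.1 (insert i K.1) * wedgeCoeff j (insert i K.1) M else 0 := by
  by_cases h : i ∈ K.1
  · rw [if_neg (not_not.2 h)]
    exact Finset.sum_eq_zero fun L _ => by rw [wedgeCoeff, if_neg (fun h' => h'.1 h), zero_mul]
  · rw [if_pos h]
    have hL : ((insert i K.1).card : ℤ) = q + n := by
      rw [Finset.card_insert_of_notMem h]
      push_cast
      rw [K.2, hq]
      ring
    refine Finset.sum_eq_single (⟨insert i K.1, hL⟩ : WedgeIndex n q) (fun L _ hne => ?_)
      (fun h => absurd (Finset.mem_univ _) h)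
    rw [wedgeCoeff, if_neg, zero_mul]
    rintro ⟨-, h'⟩
    exact hne (Subtype.ext h'.symm)

theorem wedge_antisymm (K M : Finset (Fin n)) (i j : Fin n) :
    (if i ∉ K then wedgeCoeff i K (insert i K) * wedgeCoeff j (insert i K) M else 0) =
      -(if j ∉ K then wedgeCoeff j K (insert j K) * wedgeCoeff i (insert j K) M else 0) := by
  have hcard : ∀ a b : Fin n, a ∉ K → a ≠ b →
      ((insert a K).filter (· < b)).card = (K.filter (· < b)).card + if a < b then 1 else 0 := by
    intro a b ha hab
    rw [Finset.filter_insert]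
    split_ifs
    · rw [Finset.card_insert_of_notMem (fun h => ha (Finset.mem_filter.1 h).1)]
    · rfl
  simp only [wedgeCoeff, Finset.mem_insert, not_or]
  rcases eq_or_ne i j with rfl | hij
  · simp
  by_cases hi : i ∈ K
  · simp [hi]
  by_cases hj : j ∈ K
  · simp [hj]
  rw [hcard i j hi hij, hcard j i hj hij.symm, Finset.insert_comm j i K]
  by_cases hM : insert i (insert j K) = M
  · rcases lt_or_gt_of_ne hij with h | h <;>
    · simp [hi, hj, hij, hij.symm, hM, h, h.not_gt]
      ring
  · simp [hM]

variable (A : C) (φ : Fin n → (A ⟶ A))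

/-- The differential `e_K ⊗ u ↦ ∑ⱼ e_j ∧ e_K ⊗ φ_j u`. -/
def koszulD (p q : ℤ) : (⨁ fun _ : WedgeIndex n p => A) ⟶ (⨁ fun _ : WedgeIndex n q => A) :=
  biproduct.matrix fun K L => ∑ j, wedgeCoeff j K.1 L.1 • φ j

theorem koszulD_comp (hφ : ∀ i j, φ i ≫ φ j = φ j ≫ φ i) (p q r : ℤ) (hq : q = p + 1) :
    koszulD A φ p q ≫ koszulD A φ q r = 0 := by
  apply biproduct.hom_ext
  intro M
  apply biproduct.hom_ext'
  intro K
  rw [koszulD, koszulD, Category.assoc, biproduct.matrix_π, biproduct.ι_matrix_assoc,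
    biproduct.lift_desc]
  simp only [Preadditive.sum_comp, Preadditive.comp_sum, Preadditive.zsmul_comp,
    Preadditive.comp_zsmul, zero_comp, comp_zero]
  have h1 : ∑ L : WedgeIndex n q, ∑ j, wedgeCoeff j L.1 M.1 • ∑ i,
      wedgeCoeff i K.1 L.1 • (φ i ≫ φ j) =
      ∑ a : Fin n × Fin n, (∑ L : WedgeIndex n q,
        wedgeCoeff a.1 K.1 L.1 * wedgeCoeff a.2 L.1 M.1) • (φ a.1 ≫ φ a.2) := by
    simp only [Finset.sum_smul, Finset.smul_sum, smul_smul, Fintype.sum_prod_type]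
    rw [Finset.sum_comm, Finset.sum_comm (s := Finset.univ (α := Fin n))
      (t := Finset.univ (α := Fin n))]
    refine Finset.sum_congr rfl fun j _ => ?_
    rw [Finset.sum_comm]
    refine Finset.sum_congr rfl fun i _ => Finset.sum_congr rfl fun L _ => ?_
    rw [mul_comm]
  rw [h1]
  have h2 : ∀ i j : Fin n,
      (∑ L : WedgeIndex n q, wedgeCoeff i K.1 L.1 * wedgeCoeff j L.1 M.1) =
      -(∑ L : WedgeIndex n q, wedgeCoeff j K.1 L.1 * wedgeCoeff i L.1 M.1) := by
    intro i j
    rw [sum_wedgeCoeff p q hq, sum_wedgeCoeff p q hq]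
    exact wedge_antisymm K.1 M.1 i j
  refine Finset.sum_involution (fun a _ => a.swap) (fun a _ => ?_) (fun a _ ha => ?_)
    (fun _ _ => Finset.mem_univ _) (fun a _ => a.swap_swap)
  · rw [Prod.fst_swap, Prod.snd_swap, h2 a.2 a.1, hφ a.2 a.1, neg_smul, add_neg_cancel]
  · intro h
    apply ha
    have h3 : a.1 = a.2 := congrArg Prod.snd h
    have h4 := h2 a.1 a.1
    rw [← h3, show (∑ L : WedgeIndex n q, wedgeCoeff a.1 K.1 L.1 * wedgeCoeff a.1 L.1 M.1) = 0
      by linarith, zero_smul]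

/-- The Koszul complex `⋀ ℤⁿ ⊗ A` of commuting endomorphisms `φ₁, …, φₙ` of `A`, with
`⋀ᵏ ℤⁿ ⊗ A` in degree `k - n`, decomposed along the basis `e_K`, `|K| = k`, of `⋀ᵏ ℤⁿ`,
and with the differential `e_K ⊗ u ↦ ∑ⱼ e_j ∧ e_K ⊗ φ_j u`. -/
def koszul (hφ : ∀ i j, φ i ≫ φ j = φ j ≫ φ i) : CochainComplex C ℤ where
  X p := ⨁ fun _ : WedgeIndex n p => A
  d p q := koszulD A φ p q
  shape p q h := by
    apply biproduct.hom_ext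
    intro L
    apply biproduct.hom_ext'
    intro K
    rw [koszulD, biproduct.matrix_π, biproduct.ι_desc, zero_comp, comp_zero]
    refine Finset.sum_eq_zero fun j _ => ?_
    rw [wedgeCoeff_eq_zero, zero_smul]
    intro h'
    apply h
    have h1 := K.2
    have h2 := L.2
    rw [h'] at h2
    push_cast at h2
    rw [ComplexShape.up_Rel]
    linarith
  d_comp_d' p q r h _ := koszulD_comp A φ hφ p q r h.symm

end Koszul

section DModules
open Limits
variable {n : ℕ}

/-- The global operator given by multiplication with a polynomial. -/
def globalMul (p : MvPolynomial (Fin n) ℂ) : DiffOp (⊤ : (X n).Opens) :=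
  ⟨EndFamily.mul (ofPoly ⊤ p), polyDiffOp_le _ (Algebra.subset_adjoin (Or.inl ⟨_, rfl⟩))⟩

/-- The global operator `∂/∂xᵢ`. -/
def globalPartial (i : Fin n) : DiffOp (⊤ : (X n).Opens) :=
  ⟨EndFamily.vectorField i ⊤, polyDiffOp_le _ (Algebra.subset_adjoin (Or.inr ⟨i, rfl⟩))⟩

theorem globalPartial_comm (i j : Fin n) :
    globalPartial i * globalPartial j = globalPartial j * globalPartial i :=
  Subtype.ext (funext fun V => LinearMap.ext fun s => partialEnd_comm i j V.1 s)

theorem diffOp_ext {U : (X n).Opens} {P Q : DiffOp U} (h : ∀ V s, P.1 V s = Q.1 V s) : P = Q :=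
  Subtype.ext (funext fun V => LinearMap.ext (h V))

theorem globalMul_mul (p q : MvPolynomial (Fin n) ℂ) :
    globalMul p * globalMul q = globalMul (p * q) := by
  refine diffOp_ext fun V s => ?_
  change ofPoly V.1 p * (ofPoly V.1 q * s) = ofPoly V.1 (p * q) * s
  rw [map_mul, mul_assoc]

theorem globalPartial_mul_X (i j : Fin n) :
    globalPartial i * globalMul (MvPolynomial.X j) =
      globalMul (MvPolynomial.X j) * globalPartial i + if i = j then 1 else 0 := by
  have h : globalPartial i * globalMul (MvPolynomial.X j) =
      globalMul (MvPolynomial.X j) * globalPartial i +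
        globalMul (MvPolynomial.pderiv i (MvPolynomial.X j)) := by
    refine diffOp_ext fun V s => ?_
    change partialFun i V.1 (ofPoly V.1 (MvPolynomial.X j) * s) =
      ofPoly V.1 (MvPolynomial.X j) * partialFun i V.1 s +
        ofPoly V.1 (MvPolynomial.pderiv i (MvPolynomial.X j)) * s
    rw [partialFun_mul, partialFun_ofPoly, mul_comm s]
  rw [h, MvPolynomial.pderiv_X]
  congr 1
  refine diffOp_ext fun V s => ?_
  by_cases hij : i = j
  · subst hij
    rw [if_pos rfl, Pi.single_eq_same]
    change ofPoly V.1 1 * s = s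
    rw [map_one, one_mul]
  · rw [if_neg hij, Pi.single_eq_of_ne (Ne.symm hij)]
    change ofPoly V.1 0 * s = 0
    rw [map_zero, zero_mul]

/-- The homomorphism from the Weyl algebra to the global sections of `𝒟_X`. -/
def weylToD (n : ℕ) : Weyl n →ₐ[ℂ] DiffOp (⊤ : (X n).Opens) :=
  Weyl.lift (fun i => globalMul (MvPolynomial.X i)) globalPartial
    (fun i j => by
      have h := globalMul_mul (MvPolynomial.X i : MvPolynomial (Fin n) ℂ) (MvPolynomial.X j)
      rw [mul_comm, ← globalMul_mul] at h
      exact h)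
    (fun i j => globalPartial_comm i j) (fun i j => globalPartial_mul_X i j)

/-- The left `Aₙ`-module `M = Γ(X, 𝓜)`. -/
def DMod.globalSections (M : DMod n) : ModuleCat.{0} (Weyl n) :=
  (ModuleCat.restrictScalars (weylToD n).toRingHom).obj
    ((SheafOfModules.evaluation (sheafD n) (op ⊤)).obj M)

/-- A `𝒟_X`-module `𝓜` on `X = ℂⁿ` is holonomic if it is an algebraic `𝒟_X`-module, that is,
quasi-coherent over `𝒪_X`, and the corresponding `Aₙ`-module `Γ(X, 𝓜)` is holonomic. -/
structure DMod.IsHolonomic (M : DMod n) : Prop where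
  quasicoherent : SheafOfModules.IsQuasicoherent (R := (X n).ringCatSheaf) M.toO
  holonomic : Weyl.IsHolonomic M.globalSections

/-- Sheaves of `ℂ`-vector spaces on `X = ℂⁿ`. -/
abbrev Sh (n : ℕ) := Sheaf (Opens.grothendieckTopology (X n)) (ModuleCat.{0} ℂ)

/-- The `k`-linear action of an element of a `k`-algebra on a left module. -/
def baseActHom {k A : Type} [CommRing k] [Ring A] [Algebra k A] (a : A) (M : ModuleCat.{0} A) :
    baseModule (k := k) M ⟶ baseModule (k := k) M :=
  ModuleCat.ofHom (X := baseModule (k := k) M) (Y := baseModule (k := k) M)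
    { toFun := baseAct M a
      map_add' := fun s t => smul_add a (show M from s) (show M from t)
      map_smul' := fun c s => by
        change a • (algebraMap k A c • (show M from s)) = algebraMap k A c • (a • (show M from s))
        rw [smul_smul, smul_smul, Algebra.commutes] }

/-- The action of an element of a `k`-algebra, as an endomorphism of the functor that sends
a left module to its underlying `k`-module. -/
def actNat {k A : Type} [CommRing k] [Ring A] [Algebra k A] (a : A) :
    ModuleCat.restrictScalars.{0} (algebraMap k A) ⟶
      ModuleCat.restrictScalars (algebraMap k A) where
  app M := baseActHom a M
  naturality M M' f := by
    refine ModuleCat.hom_ext (LinearMap.ext fun s => ?_)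
    exact (f.hom.map_smul a (show M from s)).symm

theorem actNat_comm {k A : Type} [CommRing k] [Ring A] [Algebra k A] {a b : A}
    (h : a * b = b * a) : actNat (k := k) a ≫ actNat b = actNat b ≫ actNat a := by
  refine NatTrans.ext (funext fun M => ModuleCat.hom_ext (LinearMap.ext fun s => ?_))
  change b • (a • (show M from s)) = a • (b • (show M from s))
  rw [smul_smul, smul_smul, h]

/-- A `𝒟_X`-module as a sheaf of modules over the ring of global sections of `𝒟_X`. -/
def DMod.toSheafOverGlobal (M : DMod n) :
    Sheaf (Opens.grothendieckTopology (X n)) (ModuleCat.{0} (DiffOp (⊤ : (X n).Opens))) :=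
  (SheafOfModules.forgetToSheafModuleCat (sheafD n) (op ⊤)
    (initialOpOfTerminal isTerminalTop)).obj M

/-- The sheaf of `ℂ`-vector spaces underlying a `𝒟_X`-module. -/
def DMod.toSh (M : DMod n) : Sh n :=
  (sheafCompose _ (ModuleCat.restrictScalars
    (algebraMap ℂ (DiffOp (⊤ : (X n).Opens))))).obj M.toSheafOverGlobal

/-- The action of a global differential operator on a `𝒟_X`-module. -/
def DMod.act (M : DMod n) (P : DiffOp (⊤ : (X n).Opens)) : M.toSh ⟶ M.toSh where
  hom := Functor.whiskerLeft M.toSheafOverGlobal.obj (actNat P)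

theorem DMod.act_comm (M : DMod n) {P Q : DiffOp (⊤ : (X n).Opens)} (h : P * Q = Q * P) :
    M.act P ≫ M.act Q = M.act Q ≫ M.act P :=
  CategoryTheory.Sheaf.hom_ext
    (congrArg (Functor.whiskerLeft M.toSheafOverGlobal.obj) (actNat_comm h))

instance : HasFiniteBiproducts (Sh n) := Abelian.hasFiniteBiproducts

/-- The de Rham complex `DR(𝓜)`, a complex of sheaves of vector spaces, with `Ωᵏ ⊗ 𝓜` in
degree `k - n`. On affine space `Ωᵏ` is free over `𝒪_X` on the `dx_K` for `K ⊆ {1, …, n}` with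
`|K| = k`, so `Ωᵏ ⊗ 𝓜` is the direct sum of the sheaves `dx_K ⊗ 𝓜`;
the differential is `dx_K ⊗ u ↦ ∑ⱼ dx_j ∧ dx_K ⊗ ∂ⱼ u`. -/
def DMod.deRham (M : DMod n) : CochainComplex (Sh n) ℤ :=
  koszul M.toSh (fun i => M.act (globalPartial i))
    (fun i j => M.act_comm (globalPartial_comm i j))

/-- The functor `Γ(X, -)` of global sections. -/
def globalSectionsFunctor (n : ℕ) : Sh n ⥤ ModuleCat.{0} ℂ :=
  sheafToPresheaf _ _ ⋙ (evaluation _ _).obj (op ⊤)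

instance : (globalSectionsFunctor n).Additive where

instance : HasDerivedCategory (Sh n) := HasDerivedCategory.standard _

instance : HasDerivedCategory (ModuleCat.{0} ℂ) := HasDerivedCategory.standard _

/-- The hypercohomology `Hⁱ(X, K) = Hⁱ(RΓ(X, K))` of a bounded below complex of sheaves. -/
def hypercohomology (K : CochainComplex.Plus (Sh n)) (i : ℤ) : ModuleCat.{0} ℂ :=
  (DerivedCategory.Plus.homologyFunctor (ModuleCat.{0} ℂ) i).obj
    ((globalSectionsFunctor n).rightDerivedFunctorPlus.obj
      (DerivedCategory.Plus.Qh.obj ((HomotopyCategory.Plus.quotient (Sh n)).obj K)))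

theorem DMod.deRham_plus (M : DMod n) : CochainComplex.plus (Sh n) M.deRham := by
  refine ⟨-n, ?_⟩
  rw [CochainComplex.isStrictlyGE_iff]
  intro p hp
  have : IsEmpty (WedgeIndex n p) := ⟨fun K => by have := K.2; omega⟩
  refine (IsZero.iff_id_eq_zero _).2 ?_
  apply biproduct.hom_ext
  intro K
  exact this.elim K

/-- `Hⁱ(X, DR(𝓜))`. -/
def DMod.deRhamCohomology (M : DMod n) (i : ℤ) : ModuleCat.{0} ℂ :=
  hypercohomology ⟨M.deRham, M.deRham_plus⟩ i

/-- `Hⁱ((Aₙ / (x₁Aₙ + ⋯ + xₙAₙ)) ⊗ᴸ M)`: the restriction to the origin of a left module. -/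
def restrictionToOrigin (M : ModuleCat.{0} (Weyl n)) (i : ℤ) : ModuleCat.{0} ℂ :=
  derivedTensor (Weyl n ⧸ Weyl.rightIdealX n) M i

end DModules
end WeylFourier

end

/-! Both sides are the cohomology of one Koszul complex, that of `x₁, …, xₙ` on the Fourier
transform.

On affine space the terms of the de Rham complex are finite direct sums of copies of `𝓜`. A
quasi-coherent sheaf on an affine noetherian scheme has no higher cohomology
(`DMod.isAcyclicSheaf`), so hypercohomology is the cohomology of the complex of global sections
(`IsAdaptedClass.nonempty_iso_homology`). That complex is the Koszul complex of the `∂ⱼ` on `M`, and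
since `∂ⱼ` on `M` is `xⱼ` on the Fourier transform, it is the Koszul complex of the `xⱼ` there
(`globalSectionsDeRhamIso`).

For the right-hand side, the Koszul complex of the `xⱼ` is an exact functor `T` of the `Aₙ`-module,
concentrated in degrees at most `0`. Its cohomology in degree `0` is `M / (x₁M + ⋯ + xₙM)`, which is
`(Aₙ / (x₁Aₙ + ⋯ + xₙAₙ)) ⊗ M` (`xKoszulHomologyZero`), and on projective modules it has no
cohomology in negative degrees (`xKoszul_exactAt`). Dimension shifting then identifies the
cohomology of `T` with the left derived functors of the tensor product
(`nonempty_iso_homology_mapHomologicalComplex`).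

The exactness on `Aₙ` itself comes from a contraction. With the homotopy built from the brackets
`[∂ⱼ, -]`, the operator `dh + hd` multiplies `x^α ∂^β e_L` by `|α| + n - |L|`, which is nonzero
outside the top exterior degree.

The vanishing theorem for sheaves is proved in the classical way: over a noetherian ring the sheaf
of an injective module is flasque, flasque sheaves are acyclic, and an arbitrary module is embedded
in an injective one. -/

noncomputable section
namespace WeylFourier
open CategoryTheory

/-! ### The Koszul differential and its homotopy on the whole exterior algebra. -/

section KoszulContraction

variable {n : ℕ} {k V : Type} [Field k] [AddCommGroup V] [Module k V]

/-- The sign `(-1) ^ #{l ∈ K | l < j}`. -/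
def wedgeSign (j : Fin n) (K : Finset (Fin n)) : ℤ := (-1) ^ (K.filter (· < j)).card

theorem wedgeSign_mul_self (j : Fin n) (K : Finset (Fin n)) :
    wedgeSign j K * wedgeSign j K = 1 := by
  rw [wedgeSign, ← mul_pow]; simp

theorem wedgeSign_erase_self (j : Fin n) (K : Finset (Fin n)) :
    wedgeSign j (K.erase j) = wedgeSign j K := by
  rw [wedgeSign, wedgeSign]
  congr 2
  ext l
  simp only [Finset.mem_filter, Finset.mem_erase]
  exact ⟨fun h => ⟨h.1.2, h.2⟩, fun h => ⟨⟨h.2.ne, h.1⟩, h.2⟩⟩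

theorem wedgeSign_insert {i j : Fin n} {K : Finset (Fin n)} (hi : i ∉ K) :
    wedgeSign j (insert i K) = (if i < j then -1 else 1) * wedgeSign j K := by
  rw [wedgeSign, wedgeSign, Finset.filter_insert]
  split_ifs with h
  · rw [Finset.card_insert_of_notMem (fun h' => hi (Finset.mem_filter.1 h').1), pow_succ]
    ring
  · ring

theorem wedgeSign_insert_self {j : Fin n} {K : Finset (Fin n)} (hj : j ∉ K) :
    wedgeSign j (insert j K) = wedgeSign j K := by
  rw [wedgeSign_insert hj]; simp

theorem wedgeSign_erase {i j : Fin n} {K : Finset (Fin n)} (hi : i ∈ K) :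
    wedgeSign j (K.erase i) = (if i < j then -1 else 1) * wedgeSign j K := by
  have h := wedgeSign_insert (j := j) (Finset.notMem_erase i K)
  rw [Finset.insert_erase hi] at h
  rw [h, ← mul_assoc]
  split_ifs <;> simp

/-- For fixed `j` and target `L` the only possible source is `L.erase j`, and `j` does not count in
its own sign, so the sign can be read off `L`. This links the matrix form of the differential to
`extMul`. -/
theorem wedgeCoeff_eq (j : Fin n) (K L : Finset (Fin n)) :
    wedgeCoeff j K L = if j ∈ L ∧ K = L.erase j then wedgeSign j L else 0 := by
  rw [wedgeCoeff]
  by_cases h : j ∉ K ∧ insert j K = L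
  · obtain ⟨h1, rfl⟩ := h
    rw [if_pos ⟨h1, rfl⟩, if_pos ⟨Finset.mem_insert_self _ _, (Finset.erase_insert h1).symm⟩,
      wedgeSign_insert_self h1, wedgeSign]
  · rw [if_neg h, if_neg]
    rintro ⟨h1, rfl⟩
    exact h ⟨Finset.notMem_erase _ _, Finset.insert_erase h1⟩

variable (k V)

/-- Exterior multiplication by `e_j` on `⋀ kⁿ ⊗ V`, seen as functions on the subsets of
`{1, …, n}`. -/
def extMul (j : Fin n) : Module.End k (Finset (Fin n) → V) where
  toFun u L := if j ∈ L then wedgeSign j L • u (L.erase j) else 0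
  map_add' u v := by
    funext L; simp only [Pi.add_apply]; split_ifs <;> simp
  map_smul' c u := by
    funext L; simp only [Pi.smul_apply, RingHom.id_apply]
    split_ifs <;> first | exact smul_comm _ _ _ | exact (smul_zero c).symm

/-- Contraction with the `j`-th dual basis vector on `⋀ kⁿ ⊗ V`. -/
def extContract (j : Fin n) : Module.End k (Finset (Fin n) → V) where
  toFun u L := if j ∈ L then 0 else wedgeSign j L • u (insert j L)
  map_add' u v := by
    funext L; simp only [Pi.add_apply]; split_ifs <;> simp
  map_smul' c u := by
    funext L; simp only [Pi.smul_apply, RingHom.id_apply]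
    split_ifs <;> first | exact smul_comm _ _ _ | exact (smul_zero c).symm

theorem extMul_anticomm (i j : Fin n) :
    extMul k V i * extMul k V j = -(extMul k V j * extMul k V i) := by
  refine LinearMap.ext fun u => funext fun L => ?_
  simp only [Module.End.mul_apply, LinearMap.neg_apply, Pi.neg_apply, extMul, LinearMap.coe_mk,
    AddHom.coe_mk, Finset.mem_erase]
  rcases eq_or_ne i j with rfl | hij
  · simp
  by_cases hi : i ∈ L <;> by_cases hj : j ∈ L <;> simp [hi, hj, hij, hij.symm]
  rw [wedgeSign_erase hi, wedgeSign_erase hj, Finset.erase_right_comm, smul_smul, smul_smul,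
    ← neg_smul]
  congr 1
  rcases lt_or_gt_of_ne hij with h | h <;> simp [h, h.not_gt, mul_comm]

/-- The Clifford relation. For `i ≠ j`, exchanging the two operations changes exactly one of the two
signs, so the terms cancel. For `i = j`, on each component one product is the identity and the other
is zero. -/
theorem extMul_extContract (i j : Fin n) :
    extMul k V j * extContract k V i + extContract k V i * extMul k V j =
      if i = j then 1 else 0 := by
  refine LinearMap.ext fun u => funext fun L => ?_
  simp only [Module.End.mul_apply, LinearMap.add_apply, Pi.add_apply, extMul, extContract,
    LinearMap.coe_mk, AddHom.coe_mk, Finset.mem_erase, Finset.mem_insert]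
  rcases eq_or_ne i j with rfl | hij
  · by_cases hi : i ∈ L
    · simp [hi, wedgeSign_erase_self, smul_smul, wedgeSign_mul_self]
    · simp [hi, wedgeSign_insert_self hi, smul_smul, wedgeSign_mul_self]
  · by_cases hi : i ∈ L <;> by_cases hj : j ∈ L <;> simp [hi, hj, hij, hij.symm]
    rw [wedgeSign_erase hj, wedgeSign_insert hi, Finset.erase_insert_of_ne hij, smul_smul,
      smul_smul, ← add_smul]
    have : ∀ a : ℤ, a = 0 → a • u (insert i (L.erase j)) = 0 := by rintro _ rfl; simp
    apply this
    rcases lt_or_gt_of_ne hij with h | h <;> simp [h, h.not_gt, mul_comm]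

/-- Wedging with `e_j` and then contracting is the projection onto the components `L` that do not
contain `j`, and there are `n - |L|` such `j`. -/
theorem sum_extContract_extMul (u : Finset (Fin n) → V) (L : Finset (Fin n)) :
    (∑ j, extContract k V j * extMul k V j) u L = ((n - L.card : ℕ) : k) • u L := by
  simp only [LinearMap.sum_apply, Finset.sum_apply]
  have : ∀ j, (extContract k V j * extMul k V j) u L = if j ∈ Lᶜ then u L else 0 := by
    intro j
    simp only [Module.End.mul_apply, extMul, extContract, LinearMap.coe_mk, AddHom.coe_mk,
      Finset.mem_compl]
    by_cases hj : j ∈ L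
    · simp [hj]
    · simp [hj, wedgeSign_insert_self hj, smul_smul, wedgeSign_mul_self]
  simp only [this]
  rw [Finset.sum_ite_mem, Finset.univ_inter, Finset.sum_const, Finset.card_compl, Fintype.card_fin,
    Nat.cast_smul_eq_nsmul]

variable {k V}

/-- An endomorphism of `V`, acting on `⋀ kⁿ ⊗ V`. -/
def extAct : Module.End k V →ₐ[k] Module.End k (Finset (Fin n) → V) where
  toFun f := f.compLeft _
  map_one' := rfl
  map_mul' _ _ := rfl
  map_zero' := rfl
  map_add' _ _ := rfl
  commutes' _ := rfl

theorem extAct_apply (f : Module.End k V) (u : Finset (Fin n) → V) (L : Finset (Fin n)) :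
    extAct f u L = f (u L) := rfl

theorem extMul_extAct (j : Fin n) (f : Module.End k V) :
    extMul k V j * extAct f = extAct f * extMul k V j := by
  refine LinearMap.ext fun u => funext fun L => ?_
  simp only [Module.End.mul_apply, extAct_apply, extMul, LinearMap.coe_mk, AddHom.coe_mk]
  split_ifs <;> simp

theorem extContract_extAct (j : Fin n) (f : Module.End k V) :
    extContract k V j * extAct f = extAct f * extContract k V j := by
  refine LinearMap.ext fun u => funext fun L => ?_
  simp only [Module.End.mul_apply, extAct_apply, extContract, LinearMap.coe_mk, AddHom.coe_mk]
  split_ifs <;> simp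

variable (φ D : Fin n → Module.End k V)

/-- The Koszul differential on the whole of `⋀ kⁿ ⊗ V`. -/
def totalKoszulD : Module.End k (Finset (Fin n) → V) := ∑ j, extMul k V j * extAct (φ j)

/-- The Koszul homotopy on the whole of `⋀ kⁿ ⊗ V`. -/
def totalKoszulH : Module.End k (Finset (Fin n) → V) := ∑ j, extContract k V j * extAct (D j)

/-- Exchanging the two summation indices shows that the square is its own negative, because the
wedge factors anticommute and the `φⱼ` commute. Characteristic zero allows division by `2`. -/
theorem totalKoszulD_mul_self [CharZero k] (hφ : ∀ i j, φ i * φ j = φ j * φ i) :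
    totalKoszulD φ * totalKoszulD φ = 0 := by
  have key : totalKoszulD φ * totalKoszulD φ = -(totalKoszulD φ * totalKoszulD φ) := by
    have h : totalKoszulD φ * totalKoszulD φ =
        ∑ i, ∑ j, extMul k V i * extMul k V j * extAct (φ i * φ j) := by
      rw [totalKoszulD, Finset.sum_mul_sum]
      refine Finset.sum_congr rfl fun i _ => Finset.sum_congr rfl fun j _ => ?_
      rw [mul_assoc, ← mul_assoc (extAct _), ← extMul_extAct, map_mul]
      noncomm_ring
    rw [h]
    nth_rw 1 [Finset.sum_comm]
    rw [← Finset.sum_neg_distrib]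
    refine Finset.sum_congr rfl fun i _ => ?_
    rw [← Finset.sum_neg_distrib]
    refine Finset.sum_congr rfl fun j _ => ?_
    rw [extMul_anticomm, hφ]
    exact LinearMap.ext fun _ => rfl
  refine LinearMap.ext fun u => ?_
  have h1 := congrArg (fun f => f u) key
  have h2 : (2 : k) • (totalKoszulD φ * totalKoszulD φ) u = 0 := by
    rw [two_smul]
    nth_rw 1 [h1]
    simp
  exact (smul_eq_zero.1 h2).resolve_left two_ne_zero

/-- A Cartan formula. After moving `Dᵢ` past `φⱼ`, the Clifford relation leaves only the diagonal
terms `φⱼ Dⱼ`, and the commutators `[Dⱼ, φⱼ] = 1` contribute the degree-counting operator. -/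
theorem totalKoszul_homotopy (hD : ∀ i j, D i * φ j = φ j * D i + if i = j then 1 else 0) :
    totalKoszulD φ * totalKoszulH D + totalKoszulH D * totalKoszulD φ =
      extAct (∑ j, φ j * D j) + ∑ j, extContract k V j * extMul k V j := by
  have h1 : totalKoszulD φ * totalKoszulH D =
      ∑ j, ∑ i, extMul k V j * extContract k V i * extAct (φ j * D i) := by
    rw [totalKoszulD, totalKoszulH, Finset.sum_mul_sum]
    refine Finset.sum_congr rfl fun j _ => Finset.sum_congr rfl fun i _ => ?_
    rw [mul_assoc, ← mul_assoc (extAct _), ← extContract_extAct, map_mul]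
    noncomm_ring
  have h2 : totalKoszulH D * totalKoszulD φ =
      ∑ j, ∑ i, (extContract k V i * extMul k V j * extAct (φ j * D i) +
        if i = j then extContract k V i * extMul k V j else 0) := by
    rw [totalKoszulD, totalKoszulH, Finset.sum_mul_sum, Finset.sum_comm]
    refine Finset.sum_congr rfl fun j _ => Finset.sum_congr rfl fun i _ => ?_
    have : extContract k V i * extAct (D i) * (extMul k V j * extAct (φ j)) =
        extContract k V i * extMul k V j * extAct (D i * φ j) := by
      rw [mul_assoc, ← mul_assoc (extAct _), ← extMul_extAct, map_mul]
      noncomm_ring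
    rw [this, hD, map_add, mul_add]
    split_ifs <;> simp
  rw [h1, h2, ← Finset.sum_add_distrib, map_sum, ← Finset.sum_add_distrib]
  refine Finset.sum_congr rfl fun j _ => ?_
  rw [← Finset.sum_add_distrib]
  have : ∀ i, extMul k V j * extContract k V i * extAct (φ j * D i) +
      (extContract k V i * extMul k V j * extAct (φ j * D i) +
        if i = j then extContract k V i * extMul k V j else 0) =
      if i = j then extAct (φ j * D j) + extContract k V j * extMul k V j else 0 := by
    intro i
    rw [← add_assoc, ← add_mul, extMul_extContract]
    split_ifs with h
    · subst h; simp
    · simp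
  simp only [this, Finset.sum_ite_eq', Finset.mem_univ, if_true]

/-- If the `φⱼ` are part of a representation of the Weyl algebra for which the Euler operator is
diagonalizable with eigenvalues in `ℕ`, then the Koszul complex is exact but in the top degree. -/
theorem exists_totalKoszulD_eq [CharZero k] (hφ : ∀ i j, φ i * φ j = φ j * φ i)
    (hD : ∀ i j, D i * φ j = φ j * D i + if i = j then 1 else 0)
    (hE : Submodule.span k {v : V | ∃ a : ℕ, (∑ j, φ j * D j) v = (a : k) • v} = ⊤)
    (z : Finset (Fin n) → V) (hz : totalKoszulD φ z = 0) (hz' : z Finset.univ = 0) :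
    ∃ y, totalKoszulD φ y = z := by
  set d := totalKoszulD φ with hd
  set h := totalKoszulH D
  set T := d * h + h * d with hT
  have hdd : d * d = 0 := totalKoszulD_mul_self φ hφ
  have hTd : Commute T d := by
    change T * d = d * T
    rw [hT, add_mul, mul_add, mul_assoc h, hdd, ← mul_assoc d d, hdd]
    simp [mul_assoc]
  -- `T` need not be invertible. `N` consists of the vectors killed by a polynomial in `T` with
  -- nonzero constant term, which is enough to invert `T` on each of them separately.
  let N : Submodule k (Finset (Fin n) → V) :=
    { carrier := {u | ∃ p : Polynomial k, p.eval 0 ≠ 0 ∧ Polynomial.aeval T p u = 0}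
      add_mem' := by
        rintro u v ⟨p, hp, hpu⟩ ⟨q, hq, hqv⟩
        refine ⟨p * q, by simp [hp, hq], ?_⟩
        rw [map_add]
        nth_rw 1 [mul_comm]
        rw [map_mul, map_mul, Module.End.mul_apply, Module.End.mul_apply, hpu, hqv]
        simp
      zero_mem' := ⟨1, by simp⟩
      smul_mem' := by
        rintro c u ⟨p, hp, hpu⟩
        exact ⟨p, hp, by rw [map_smul, hpu, smul_zero]⟩ }
  have hsingle : ∀ (L : Finset (Fin n)), L ≠ Finset.univ → ∀ v : V, Pi.single L v ∈ N := by
    intro L hL v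
    have : v ∈ Submodule.span k {v : V | ∃ a : ℕ, (∑ j, φ j * D j) v = (a : k) • v} := by
      rw [hE]; trivial
    have hle : Submodule.span k {v : V | ∃ a : ℕ, (∑ j, φ j * D j) v = (a : k) • v} ≤
        N.comap (LinearMap.single k (fun _ => V) L) := by
      rw [Submodule.span_le]
      rintro w ⟨a, ha⟩
      -- The eigenvalue of `T` is `a + (n - |L|)`; excluding the full set makes it positive even for
      -- `a = 0`.
      have hc : 0 < n - L.card := by
        have := Finset.card_lt_univ_of_notMem (s := L) (x := (by
          by_contra! h'
          exact hL (Finset.eq_univ_of_forall h') : ∃ x, x ∉ L).choose)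
          (Exists.choose_spec (_ : ∃ x, x ∉ L))
        rw [Fintype.card_fin] at this
        omega
      refine ⟨Polynomial.X - Polynomial.C ((a + (n - L.card) : ℕ) : k), ?_, ?_⟩
      · simp only [Polynomial.eval_sub, Polynomial.eval_X, Polynomial.eval_C, zero_sub, ne_eq,
          neg_eq_zero, Nat.cast_eq_zero]
        omega
      · rw [map_sub, Polynomial.aeval_X, Polynomial.aeval_C, LinearMap.sub_apply, sub_eq_zero, hT,
          totalKoszul_homotopy φ D hD]
        funext K
        rw [LinearMap.add_apply, Pi.add_apply, sum_extContract_extMul, extAct_apply,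
          Module.algebraMap_end_apply]
        rw [LinearMap.coe_single, Pi.smul_apply]
        by_cases hK : K = L
        · subst hK
          rw [Pi.single_eq_same, ha, ← add_smul, Nat.cast_add]
        · rw [Pi.single_eq_of_ne hK]
          simp
    exact hle this
  have hzN : z ∈ N := by
    rw [show z = ∑ L, Pi.single L (z L) from (Finset.univ_sum_single z).symm]
    refine Submodule.sum_mem _ fun L _ => ?_
    by_cases hL : L = Finset.univ
    · rw [hL, hz', Pi.single_zero]; exact N.zero_mem
    · exact hsingle L hL _
  obtain ⟨p, hp, hpz⟩ := hzN
  -- Writing `p = X q + p(0)`, the equation `p(T) z = 0` says that `z` is a multiple of `T q(T) z`.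
  -- As `q(T) z` is a cocycle, this equals `d h q(T) z` up to a scalar, so `z` is a boundary.
  obtain ⟨q, hq⟩ : Polynomial.X ∣ p - Polynomial.C (p.eval 0) := by
    rw [Polynomial.X_dvd_iff]
    simp [Polynomial.coeff_zero_eq_eval_zero]
  have hcy : d ((Polynomial.aeval T q) z) = 0 := by
    have : Commute (Polynomial.aeval T q) d := by
      rw [Polynomial.aeval_eq_sum_range]
      exact Commute.sum_left _ _ _ fun i _ => (hTd.pow_left i).smul_left _
    rw [← Module.End.mul_apply, ← this.eq, Module.End.mul_apply, hz, map_zero]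
  have hp' : p = Polynomial.X * q + Polynomial.C (p.eval 0) := by rw [← hq]; ring
  refine ⟨-(p.eval 0)⁻¹ • h ((Polynomial.aeval T q) z), ?_⟩
  have h3 : T ((Polynomial.aeval T q) z) + p.eval 0 • z = 0 := by
    rw [hp'] at hpz
    simpa [Polynomial.eval_add] using hpz
  have h4 : T ((Polynomial.aeval T q) z) = d (h ((Polynomial.aeval T q) z)) := by
    rw [hT, LinearMap.add_apply, Module.End.mul_apply, Module.End.mul_apply, hcy, map_zero,
      add_zero]
  rw [map_smul, ← h4, eq_neg_of_add_eq_zero_left h3, smul_neg, neg_smul, neg_neg, smul_smul,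
    inv_mul_cancel₀ hp, one_smul]

end KoszulContraction
end WeylFourier
end

noncomputable section
namespace WeylFourier
open CategoryTheory

/-! ### The Koszul complex degree by degree. -/

section GradedKoszul
variable {n : ℕ} {k V : Type} [Field k] [AddCommGroup V] [Module k V]

variable (k n V) in
/-- Extension by zero of a homogeneous element of `⋀ kⁿ ⊗ V`. -/
def wedgeExtend (p : ℤ) : (WedgeIndex n p → V) →ₗ[k] (Finset (Fin n) → V) where
  toFun u L := if h : (L.card : ℤ) = p + n then u ⟨L, h⟩ else 0
  map_add' u v := by
    funext L; simp only [Pi.add_apply]; split_ifs <;> simp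
  map_smul' c u := by
    funext L; simp only [Pi.smul_apply, RingHom.id_apply]; split_ifs <;> simp

variable (k n V) in
/-- The homogeneous components of an element of `⋀ kⁿ ⊗ V`. -/
def wedgeRestrict (p : ℤ) : (Finset (Fin n) → V) →ₗ[k] (WedgeIndex n p → V) :=
  LinearMap.funLeft k V Subtype.val

theorem wedgeExtend_of_eq {p : ℤ} (u : WedgeIndex n p → V) (L : WedgeIndex n p) :
    wedgeExtend n k V p u L.1 = u L := dif_pos L.2

theorem wedgeExtend_of_ne {p : ℤ} (u : WedgeIndex n p → V) {L : Finset (Fin n)}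
    (h : (L.card : ℤ) ≠ p + n) : wedgeExtend n k V p u L = 0 := dif_neg h

variable (φ : Fin n → Module.End k V)

theorem totalKoszulD_apply (w : Finset (Fin n) → V) (L : Finset (Fin n)) :
    totalKoszulD φ w L =
      ∑ j, if j ∈ L then wedgeSign j L • φ j (w (L.erase j)) else 0 := by
  simp only [totalKoszulD, LinearMap.sum_apply, Finset.sum_apply]
  rfl

/-- The differential raises the number of elements by one, so the component at `L` only sees sets
with one element less. This transfers statements between a single degree and the whole exterior
algebra. -/
theorem totalKoszulD_apply_congr {w w' : Finset (Fin n) → V} {L : Finset (Fin n)}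
    (h : ∀ K : Finset (Fin n), K.card + 1 = L.card → w K = w' K) :
    totalKoszulD φ w L = totalKoszulD φ w' L := by
  rw [totalKoszulD_apply, totalKoszulD_apply]
  refine Finset.sum_congr rfl fun j _ => ?_
  split_ifs with hj
  · rw [h _ (Finset.card_erase_add_one hj)]
  · rfl

theorem totalKoszulD_wedgeExtend_of_ne {p : ℤ} (u : WedgeIndex n p → V) {L : Finset (Fin n)}
    (h : (L.card : ℤ) ≠ p + 1 + n) : totalKoszulD φ (wedgeExtend n k V p u) L = 0 := by
  have : totalKoszulD φ (wedgeExtend n k V p u) L = totalKoszulD φ 0 L :=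
    totalKoszulD_apply_congr φ fun K hK => wedgeExtend_of_ne u (by omega)
  rw [this, map_zero, Pi.zero_apply]

/-- The Koszul differential. -/
def gradedKoszulD (p q : ℤ) : (WedgeIndex n p → V) →ₗ[k] (WedgeIndex n q → V) :=
  wedgeRestrict n k V q ∘ₗ totalKoszulD φ ∘ₗ wedgeExtend n k V p

theorem gradedKoszulD_apply (p q : ℤ) (u : WedgeIndex n p → V) (L : WedgeIndex n q) :
    gradedKoszulD φ p q u L = totalKoszulD φ (wedgeExtend n k V p u) L.1 := rfl

/-- Gives the differential the same matrix entries as `koszulD`, so that it can be compared with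
Koszul complexes made of biproducts. -/
theorem gradedKoszulD_eq_sum (p q : ℤ) (u : WedgeIndex n p → V) (L : WedgeIndex n q) :
    gradedKoszulD φ p q u L = ∑ K, ∑ j, wedgeCoeff j K.1 L.1 • φ j (u K) := by
  rw [gradedKoszulD_apply, totalKoszulD_apply, Finset.sum_comm]
  refine Finset.sum_congr rfl fun j _ => ?_
  simp only [wedgeCoeff_eq]
  by_cases hj : j ∈ L.1
  · rw [if_pos hj]
    by_cases h : ((L.1.erase j).card : ℤ) = p + n
    · rw [Finset.sum_eq_single (⟨L.1.erase j, h⟩ : WedgeIndex n p)]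
      · rw [if_pos ⟨hj, rfl⟩]
        congr 2
        exact wedgeExtend_of_eq u ⟨L.1.erase j, h⟩
      · intro K _ hK
        rw [if_neg (fun h' => hK (Subtype.ext h'.2)), zero_smul]
      · exact fun h' => absurd (Finset.mem_univ _) h'
    · rw [wedgeExtend_of_ne u h, map_zero, smul_zero, Finset.sum_eq_zero]
      intro K _
      rw [if_neg, zero_smul]
      rintro ⟨_, h'⟩
      exact h (h' ▸ K.2)
  · simp [hj]

variable {φ} in
theorem gradedKoszulD_compLeft {V' : Type} [AddCommGroup V'] [Module k V']
    {φ' : Fin n → Module.End k V'} (g : V →ₗ[k] V') (h : ∀ j m, g (φ j m) = φ' j (g m))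
    (p q : ℤ) (u : WedgeIndex n p → V) :
    gradedKoszulD φ' p q (g.compLeft _ u) = g.compLeft _ (gradedKoszulD φ p q u) := by
  funext L
  rw [LinearMap.compLeft_apply, Function.comp_apply, gradedKoszulD_eq_sum, gradedKoszulD_eq_sum]
  simp only [map_sum, map_zsmul, h, LinearMap.compLeft_apply, Function.comp_apply]

theorem totalKoszulD_wedgeExtend (p : ℤ) (u : WedgeIndex n p → V) :
    totalKoszulD φ (wedgeExtend n k V p u) =
      wedgeExtend n k V (p + 1) (gradedKoszulD φ p (p + 1) u) := by
  funext L
  by_cases h : (L.card : ℤ) = p + 1 + n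
  · exact (wedgeExtend_of_eq (gradedKoszulD φ p (p + 1) u) ⟨L, h⟩).symm
  · rw [totalKoszulD_wedgeExtend_of_ne φ u h, wedgeExtend_of_ne _ h]

/-- The Koszul complex of commuting endomorphisms of a vector space, with `⋀ᵖ kⁿ ⊗ V` realized as
a space of functions. -/
def funKoszul [CharZero k] (hφ : ∀ i j, φ i * φ j = φ j * φ i) :
    CochainComplex (ModuleCat.{0} k) ℤ where
  X p := ModuleCat.of k (WedgeIndex n p → V)
  d p q := ModuleCat.ofHom (gradedKoszulD φ p q)
  shape p q h := by
    refine ModuleCat.hom_ext (LinearMap.ext fun u => funext fun L => ?_)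
    refine totalKoszulD_wedgeExtend_of_ne φ u fun h' => h ?_
    have := L.2
    rw [ComplexShape.up_Rel]
    omega
  d_comp_d' p q r hq _ := by
    obtain rfl : p + 1 = q := hq
    refine ModuleCat.hom_ext (LinearMap.ext fun u => funext fun L => ?_)
    change totalKoszulD φ (wedgeExtend n k V (p + 1) (gradedKoszulD φ p (p + 1) u)) L.1 = 0
    rw [← totalKoszulD_wedgeExtend, ← Module.End.mul_apply, totalKoszulD_mul_self φ hφ]
    rfl

/-- Since `p + 1 < 0` lies below the top degree, the extension of `z` by zero vanishes on the full
set and is a boundary in the whole exterior algebra. The degree `p` part of a primitive is again a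
primitive. -/
theorem exists_gradedKoszulD_eq [CharZero k] (D : Fin n → Module.End k V)
    (hφ : ∀ i j, φ i * φ j = φ j * φ i)
    (hD : ∀ i j, D i * φ j = φ j * D i + if i = j then 1 else 0)
    (hE : Submodule.span k {v : V | ∃ a : ℕ, (∑ j, φ j * D j) v = (a : k) • v} = ⊤)
    {p : ℤ} (hp : p + 1 < 0) (z : WedgeIndex n (p + 1) → V)
    (hz : gradedKoszulD φ (p + 1) (p + 1 + 1) z = 0) :
    ∃ y, gradedKoszulD φ p (p + 1) y = z := by
  obtain ⟨y, hy⟩ := exists_totalKoszulD_eq φ D hφ hD hE (wedgeExtend n k V (p + 1) z)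
    (by rw [totalKoszulD_wedgeExtend, hz, map_zero])
    (wedgeExtend_of_ne z (by rw [Finset.card_univ, Fintype.card_fin]; omega))
  refine ⟨wedgeRestrict n k V p y, funext fun L => ?_⟩
  rw [← wedgeExtend_of_eq (k := k) z L, ← hy, gradedKoszulD_apply]
  refine totalKoszulD_apply_congr φ fun K hK => ?_
  have : (K.card : ℤ) = p + n := by have := L.2; omega
  exact wedgeExtend_of_eq (wedgeRestrict n k V p y) ⟨K, this⟩

end GradedKoszul

/-! ### Monomials of the Weyl algebra and the Euler operator. -/

namespace Weyl
variable {n : ℕ}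

theorem adjoin_generators : Algebra.adjoin ℂ (Set.range x ∪ Set.range d : Set (Weyl n)) = ⊤ := by
  have h1 : (Algebra.adjoin ℂ (Set.range (FreeAlgebra.ι ℂ (X := Fin n ⊕ Fin n)))).map
      (RingQuot.mkAlgHom ℂ (WeylRel n)) ≤
      Algebra.adjoin ℂ (Set.range x ∪ Set.range d : Set (Weyl n)) := by
    rw [AlgHom.map_adjoin]
    apply Algebra.adjoin_mono
    rintro _ ⟨_, ⟨i | i, rfl⟩, rfl⟩
    · exact Or.inl ⟨i, rfl⟩
    · exact Or.inr ⟨i, rfl⟩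
  rw [eq_top_iff]
  intro a _
  obtain ⟨b, rfl⟩ := RingQuot.mkAlgHom_surjective ℂ (WeylRel n) a
  refine h1 ⟨b, ?_, rfl⟩
  rw [FreeAlgebra.adjoin_range_ι]
  trivial

/-- A submodule that is stable under left multiplication by the `xᵢ` and the `∂ᵢ` is a left
ideal. -/
theorem mul_mem_of_generators (S : Submodule ℂ (Weyl n)) (hx : ∀ i, ∀ s ∈ S, x i * s ∈ S)
    (hd : ∀ i, ∀ s ∈ S, d i * s ∈ S) (a s : Weyl n) (hs : s ∈ S) : a * s ∈ S := by
  have ha : a ∈ Algebra.adjoin ℂ (Set.range x ∪ Set.range d : Set (Weyl n)) := by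
    rw [adjoin_generators]; trivial
  induction ha using Algebra.adjoin_induction generalizing s with
  | mem a ha =>
    rcases ha with ⟨i, rfl⟩ | ⟨i, rfl⟩
    · exact hx i s hs
    · exact hd i s hs
  | algebraMap c => rw [← Algebra.smul_def]; exact S.smul_mem c hs
  | add a b _ _ iha ihb => rw [add_mul]; exact S.add_mem (iha s hs) (ihb s hs)
  | mul a b _ _ iha ihb => rw [mul_assoc]; exact iha _ (ihb s hs)

/-- The derivation `[∂ⱼ, -]` of the Weyl algebra. -/
def adD (j : Fin n) : Module.End ℂ (Weyl n) :=
  LinearMap.mulLeft ℂ (d j) - LinearMap.mulRight ℂ (d j)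

theorem adD_apply (j : Fin n) (a : Weyl n) : adD j a = d j * a - a * d j := rfl

theorem adD_x_mul (i j : Fin n) (a : Weyl n) :
    adD i (x j * a) = x j * adD i a + if i = j then a else 0 := by
  rw [adD_apply, adD_apply, ← mul_assoc, d_mul_x, add_mul, ite_mul, one_mul, zero_mul, mul_sub,
    mul_assoc, mul_assoc]
  abel

theorem adD_mul_d (i j : Fin n) (a : Weyl n) : adD i (a * d j) = adD i a * d j := by
  rw [adD_apply, adD_apply, sub_mul, mul_assoc, mul_assoc, mul_assoc, d_mul_d i j]

/-- The monomials `x^α ∂^β` with `|α| = a`. -/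
inductive IsMonomial : ℕ → Weyl n → Prop
  | one : IsMonomial 0 1
  | x_mul {a : ℕ} {v : Weyl n} (i : Fin n) (h : IsMonomial a v) : IsMonomial (a + 1) (x i * v)
  | mul_d {a : ℕ} {v : Weyl n} (i : Fin n) (h : IsMonomial a v) : IsMonomial a (v * d i)

/-- The span contains `1` and is a left ideal. Stability under left `xᵢ` and right `∂ᵢ` is built in,
and left `∂ᵢ` differs from right `∂ᵢ` by the bracket `adD i`, which preserves the span by induction
on monomials. Linear independence of the monomials is not needed. -/
theorem span_isMonomial : Submodule.span ℂ {v : Weyl n | ∃ a, IsMonomial a v} = ⊤ := by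
  set S := Submodule.span ℂ {v : Weyl n | ∃ a, IsMonomial a v} with hS
  have hx : ∀ i, ∀ s ∈ S, x i * s ∈ S := by
    intro i s hs
    have : S ≤ S.comap (LinearMap.mulLeft ℂ (x i)) := by
      nth_rw 1 [hS]
      rw [Submodule.span_le]
      rintro v ⟨a, hv⟩
      exact Submodule.subset_span ⟨_, hv.x_mul i⟩
    exact this hs
  have had : ∀ i, ∀ s ∈ S, adD i s ∈ S := by
    intro i s hs
    have : S ≤ S.comap (adD i) := by
      nth_rw 1 [hS]
      rw [Submodule.span_le]
      rintro v ⟨a, hv⟩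
      change adD i v ∈ S
      induction hv with
      | one => rw [adD_apply, mul_one, one_mul, sub_self]; exact S.zero_mem
      | x_mul j h ih =>
        rw [adD_x_mul]
        refine S.add_mem (hx j _ ih) ?_
        split_ifs
        · exact Submodule.subset_span ⟨_, h⟩
        · exact S.zero_mem
      | mul_d j h ih =>
        rw [adD_mul_d]
        have : S ≤ S.comap (LinearMap.mulRight ℂ (d j)) := by
          nth_rw 1 [hS]
          rw [Submodule.span_le]
          rintro v ⟨a, hv⟩
          exact Submodule.subset_span ⟨_, hv.mul_d j⟩
        exact this ih
    exact this hs
  have hd : ∀ i, ∀ s ∈ S, d i * s ∈ S := by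
    intro i s hs
    have h1 : d i * s = adD i s + s * d i := by rw [adD_apply]; abel
    rw [h1]
    refine S.add_mem (had i s hs) ?_
    have : S ≤ S.comap (LinearMap.mulRight ℂ (d i)) := by
      nth_rw 1 [hS]
      rw [Submodule.span_le]
      rintro v ⟨a, hv⟩
      exact Submodule.subset_span ⟨_, hv.mul_d i⟩
    exact this hs
  rw [eq_top_iff]
  intro a _
  rw [← mul_one a]
  exact mul_mem_of_generators S hx hd a 1 (Submodule.subset_span ⟨0, .one⟩)

/-- The operator counts the letters `xᵢ`: each left factor `xᵢ` adds one to the eigenvalue, and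
right factors `∂ᵢ` pass through because the brackets `[∂ⱼ, ∂ᵢ]` vanish. -/
theorem IsMonomial.euler {a : ℕ} {v : Weyl n} (h : IsMonomial a v) :
    ∑ j, x j * adD j v = (a : ℂ) • v := by
  induction h with
  | one => simp [adD_apply]
  | @x_mul a v i h ih =>
    have : ∀ j, x j * adD j (x i * v) = x i * (x j * adD j v) + if j = i then x j * v else 0 := by
      intro j
      rw [adD_x_mul, mul_add, ← mul_assoc, x_mul_x, mul_assoc]
      split_ifs <;> simp
    simp only [this, Finset.sum_add_distrib, ← Finset.mul_sum, ih]
    simp [add_smul]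
  | mul_d i h ih =>
    simp only [adD_mul_d, ← mul_assoc, ← Finset.sum_mul, ih]
    simp

end Weyl

/-! ### The Koszul complex of the `xᵢ` as a functor, and its exactness on projective modules. -/

section
variable {n : ℕ}

/-- The actions of the `xᵢ` on the vector space underlying a left `Aₙ`-module. -/
def xEnd (M : ModuleCat.{0} (Weyl n)) (i : Fin n) :
    Module.End ℂ (baseModule (k := ℂ) M) :=
  (baseActHom (Weyl.x i) M).hom

theorem xEnd_comm (M : ModuleCat.{0} (Weyl n)) (i j : Fin n) :
    xEnd M i * xEnd M j = xEnd M j * xEnd M i := by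
  refine LinearMap.ext fun m => ?_
  change Weyl.x i • Weyl.x j • (show M from m) = Weyl.x j • Weyl.x i • (show M from m)
  rw [smul_smul, smul_smul, Weyl.x_mul_x]

/-- The Koszul complex of the `xᵢ` on a left `Aₙ`-module. -/
def xKoszul : ModuleCat.{0} (Weyl n) ⥤ CochainComplex (ModuleCat.{0} ℂ) ℤ where
  obj M := funKoszul (xEnd M) (xEnd_comm M)
  map {M M'} f :=
    { f := fun p => ModuleCat.ofHom
        ((((ModuleCat.restrictScalars (algebraMap ℂ (Weyl n))).map f).hom).compLeft
          (WedgeIndex n p))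
      comm' := fun p q _ => by
        refine ModuleCat.hom_ext (LinearMap.ext fun u => funext fun L => ?_)
        exact congrFun (gradedKoszulD_compLeft (φ := xEnd M) (φ' := xEnd M')
          ((ModuleCat.restrictScalars (algebraMap ℂ (Weyl n))).map f).hom
          (fun j m => f.hom.map_smul (Weyl.x j) m) p q u) L }
  map_id _ := rfl
  map_comp _ _ := rfl

instance : (xKoszul (n := n)).Additive where
  map_add := rfl

/-- The Koszul complex of the `xᵢ` on a free `Aₙ`-module is a resolution. -/
theorem xKoszul_exact_free (ι : Type) (p : ℤ) (hp : p + 1 < 0)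
    (z : WedgeIndex n (p + 1) → baseModule (k := ℂ) (ModuleCat.of (Weyl n) (ι →₀ Weyl n)))
    (hz : gradedKoszulD (xEnd _) (p + 1) (p + 1 + 1) z = 0) :
    ∃ y, gradedKoszulD (xEnd (ModuleCat.of (Weyl n) (ι →₀ Weyl n))) p (p + 1) y = z := by
  let F := ModuleCat.of (Weyl n) (ι →₀ Weyl n)
  let e : (ι →₀ Weyl n) ≃ₗ[ℂ] baseModule (k := ℂ) F :=
    { Equiv.refl _ with
      map_add' := fun _ _ => rfl
      map_smul' := fun c v => (algebraMap_smul (Weyl n) c v).symm }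
  -- Brackets with `∂ⱼ` satisfy the same relation with left multiplication by `xⱼ` as `∂ⱼ` does.
  -- Unlike left multiplication by `∂ⱼ`, they make the Euler operator diagonalizable.
  let D' : Fin n → Module.End ℂ (ι →₀ Weyl n) := fun j => Finsupp.mapRange.linearMap (Weyl.adD j)
  let φ' : Fin n → Module.End ℂ (ι →₀ Weyl n) := fun j =>
    Finsupp.mapRange.linearMap (LinearMap.mulLeft ℂ (Weyl.x j))
  have hφ : ∀ j v, xEnd F j (e v) = e (φ' j v) := fun _ _ => rfl
  let D : Fin n → Module.End ℂ (baseModule (k := ℂ) F) := fun j => e.conj (D' j)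
  have hD : ∀ j v, D j (e v) = e (D' j v) := fun j v => by
    simp only [D, LinearEquiv.conj_apply_apply, LinearEquiv.symm_apply_apply]
  have hcomm : ∀ i j v, D' i (φ' j v) = φ' j (D' i v) + if i = j then v else 0 := by
    intro i j v
    refine Finsupp.ext fun l => ?_
    refine (Weyl.adD_x_mul i j (v l)).trans ?_
    split_ifs <;> rfl
  have heuler : ∀ (l : ι) {v : Weyl n} {a : ℕ}, Weyl.IsMonomial a v →
      ∑ j, φ' j (D' j (Finsupp.single l v)) = (a : ℂ) • Finsupp.single l v := by
    intro l v a ha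
    have : ∀ j, φ' j (D' j (Finsupp.single l v)) =
        Finsupp.single l (Weyl.x j * Weyl.adD j v) := fun j => by
      simp only [φ', D', Finsupp.mapRange.linearMap_apply, Finsupp.mapRange_single,
        LinearMap.mulLeft_apply]
    simp only [this]
    rw [← Finsupp.single_finsetSum, ha.euler, Finsupp.smul_single]
  refine exists_gradedKoszulD_eq _ D (xEnd_comm F) (fun i j => LinearMap.ext fun v => ?_) ?_ hp z hz
  · obtain ⟨v, rfl⟩ := e.surjective v
    rw [Module.End.mul_apply, hφ, hD, hcomm, map_add, LinearMap.add_apply, Module.End.mul_apply, hD,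
      hφ]
    split_ifs <;> simp
  · rw [eq_top_iff]
    intro v hv
    clear hv
    obtain ⟨v, rfl⟩ := e.surjective v
    induction v using Finsupp.induction_linear with
    | zero => rw [map_zero]; exact Submodule.zero_mem _
    | add u v hu hv => rw [map_add]; exact Submodule.add_mem _ hu hv
    | single l v =>
      have hv : v ∈ Submodule.span ℂ {v : Weyl n | ∃ a, Weyl.IsMonomial a v} := by
        rw [Weyl.span_isMonomial]; trivial
      induction hv using Submodule.span_induction with
      | mem v hv =>
        obtain ⟨a, ha⟩ := hv
        refine Submodule.subset_span ⟨a, ?_⟩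
        rw [LinearMap.sum_apply, ← map_smul, ← heuler l ha, map_sum]
        refine Finset.sum_congr rfl fun j _ => ?_
        rw [Module.End.mul_apply, hD, hφ]
      | zero => rw [Finsupp.single_zero, map_zero]; exact Submodule.zero_mem _
      | add u v _ _ hu hv => rw [Finsupp.single_add, map_add]; exact Submodule.add_mem _ hu hv
      | smul c v _ hv =>
        rw [← Finsupp.smul_single, map_smul]
        exact Submodule.smul_mem _ c hv

/-- The Koszul complex of the `xᵢ` on a projective `Aₙ`-module is a resolution. -/
theorem xKoszul_exactAt (P : ModuleCat.{0} (Weyl n)) [Projective P] (p : ℤ) (hp : p < 0) :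
    (xKoszul.obj P).ExactAt p := by
  have hfree : ∀ ι : Type, (xKoszul.obj (ModuleCat.of (Weyl n) (ι →₀ Weyl n))).ExactAt p := by
    intro ι
    obtain ⟨q, rfl⟩ : ∃ q, p = q + 1 := ⟨p - 1, by ring⟩
    rw [HomologicalComplex.exactAt_iff' _ q (q + 1) (q + 1 + 1) (by simp) (by simp),
      ShortComplex.moduleCat_exact_iff]
    intro z hz
    exact xKoszul_exact_free ι q hp z hz
  have hP : Module.Projective (Weyl n) P := IsProjective.iff_projective P |>.2 inferInstance
  -- A projective module is a retract of a free one, so the identity of its Koszul cohomology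
  -- factors through zero.
  obtain ⟨s, hs⟩ := Module.projective_def'.1 hP
  have := hfree P
  rw [HomologicalComplex.exactAt_iff_isZero_homology] at this ⊢
  let i : P ⟶ ModuleCat.of (Weyl n) (P →₀ Weyl n) := ModuleCat.ofHom s
  let r : ModuleCat.of (Weyl n) (P →₀ Weyl n) ⟶ P :=
    ModuleCat.ofHom (Finsupp.linearCombination (Weyl n) id)
  have hir : i ≫ r = 𝟙 P := ModuleCat.hom_ext hs
  rw [Limits.IsZero.iff_id_eq_zero] at this ⊢
  have h1 : HomologicalComplex.homologyMap (xKoszul.map (i ≫ r)) p = 𝟙 _ := by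
    rw [hir, CategoryTheory.Functor.map_id, HomologicalComplex.homologyMap_id]
  rw [← h1, Functor.map_comp, HomologicalComplex.homologyMap_comp,
    ← Category.comp_id (HomologicalComplex.homologyMap (xKoszul.map i) p), this, Limits.comp_zero,
    Limits.zero_comp]

end
end WeylFourier
end

noncomputable section
namespace WeylFourier
open CategoryTheory Limits

/-! ### Top cohomology of the Koszul complex as a tensor product, and exactness in the module. -/

section
variable {n : ℕ}
open TensorProduct

/-- The right module `Aₙ / (x₁Aₙ + ⋯ + xₙAₙ)`. -/
abbrev originModule (n : ℕ) : Type := Weyl n ⧸ Weyl.rightIdealX n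

/-- The full set `{1, …, n}`, as the index of the top exterior power. -/
def topWedge (n : ℕ) : WedgeIndex n 0 := ⟨Finset.univ, by simp⟩

theorem eq_topWedge (L : WedgeIndex n 0) : L = topWedge n :=
  Subtype.ext (Finset.eq_univ_of_card _ (by have := L.2; rw [Fintype.card_fin]; omega))

/-- The subspace `x₁M + ⋯ + xₙM`. -/
def xRange (M : ModuleCat.{0} (Weyl n)) : Submodule ℂ (baseModule (k := ℂ) M) :=
  ⨆ j, LinearMap.range (xEnd M j)

/-- The action of `a ∈ Aₙ` on `M`, followed by the projection to `M / (x₁M + ⋯ + xₙM)`. -/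
def actMod (M : ModuleCat.{0} (Weyl n)) :
    Weyl n →+ (baseModule (k := ℂ) M →ₗ[ℂ] baseModule (k := ℂ) M ⧸ xRange M) where
  toFun a := (xRange M).mkQ ∘ₗ (baseActHom a M).hom
  map_zero' := LinearMap.ext fun m => by
    change (xRange M).mkQ ((0 : Weyl n) • (show M from m)) = 0
    rw [zero_smul]
    exact map_zero _
  map_add' a b := LinearMap.ext fun m => by
    change (xRange M).mkQ ((a + b) • (show M from m)) = _
    rw [add_smul]
    exact map_add _ _ _

theorem actMod_apply (M : ModuleCat.{0} (Weyl n)) (a : Weyl n) (m : baseModule (k := ℂ) M) :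
    actMod M a m = (xRange M).mkQ (baseAct M a m) := rfl

/-- A right factor can be absorbed in the vector, `(a b) m = a (b m)`, so only the generators `xᵢ`
of the right ideal have to be checked. -/
theorem actMod_eq_zero (M : ModuleCat.{0} (Weyl n)) (a : Weyl n) (ha : a ∈ Weyl.rightIdealX n) :
    actMod M a = 0 := by
  induction ha using Submodule.span_induction with
  | mem a ha =>
    obtain ⟨i, rfl⟩ := ha
    refine LinearMap.ext fun m => ?_
    exact (Submodule.Quotient.mk_eq_zero _).2 (Submodule.mem_iSup_of_mem i ⟨m, rfl⟩)
  | zero => exact map_zero _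
  | add a b _ _ ha hb => rw [map_add, ha, hb, add_zero]
  | smul b a _ ha =>
    refine LinearMap.ext fun m => ?_
    refine Eq.trans ?_ (congrArg (fun f => f (baseAct M b.unop m)) ha)
    rw [actMod_apply, actMod_apply]
    exact congrArg (xRange M).mkQ (mul_smul a b.unop (show M from m))

/-- The map `(Aₙ / (x₁Aₙ + ⋯ + xₙAₙ)) ⊗ M → M / (x₁M + ⋯ + xₙM)` that sends `[a] ⊗ m`
to `[a m]`. -/
def originTensorMap (M : ModuleCat.{0} (Weyl n)) :
    originModule n ⊗[ℂ] baseModule (k := ℂ) M →ₗ[ℂ] baseModule (k := ℂ) M ⧸ xRange M :=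
  TensorProduct.lift
    { QuotientAddGroup.lift (Weyl.rightIdealX n).toAddSubgroup (actMod M)
        (fun a ha => actMod_eq_zero M a ha) with
      map_smul' := by
        intro c a
        obtain ⟨a, rfl⟩ := Submodule.Quotient.mk_surjective _ a
        refine LinearMap.ext fun m => ?_
        change actMod M (c • a) m = c • actMod M a m
        rw [actMod_apply, actMod_apply, ← map_smul]
        refine congrArg (xRange M).mkQ ?_
        change (c • a) • (show M from m) = algebraMap ℂ (Weyl n) c • a • (show M from m)
        rw [smul_smul, Algebra.smul_def] }

theorem originTensorMap_mk_tmul (M : ModuleCat.{0} (Weyl n)) (a : Weyl n)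
    (m : baseModule (k := ℂ) M) :
    originTensorMap M ((Submodule.Quotient.mk a : originModule n) ⊗ₜ m) =
      (xRange M).mkQ (baseAct M a m) := rfl

theorem tensorRel_le_ker (M : ModuleCat.{0} (Weyl n)) :
    tensorRel (k := ℂ) (originModule n) M ≤ LinearMap.ker (originTensorMap M) := by
  rw [tensorRel, Submodule.span_le]
  rintro _ ⟨y, a, m, rfl⟩
  obtain ⟨b, rfl⟩ := Submodule.Quotient.mk_surjective _ y
  change originTensorMap M _ = 0
  rw [map_sub, sub_eq_zero, originTensorMap_mk_tmul]
  exact congrArg (xRange M).mkQ (mul_smul b a (show M from m))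

/-- The map `M → (Aₙ / (x₁Aₙ + ⋯ + xₙAₙ)) ⊗_{Aₙ} M` that sends `m` to `[1] ⊗ m`. -/
def toOriginTensor (M : ModuleCat.{0} (Weyl n)) :
    baseModule (k := ℂ) M →ₗ[ℂ] (tensorFunctor (k := ℂ) (originModule n)).obj M :=
  (tensorRel (k := ℂ) (originModule n) M).mkQ ∘ₗ
    TensorProduct.mk ℂ (originModule n) (baseModule (k := ℂ) M) (Submodule.Quotient.mk 1)

theorem mkQ_tmul_eq (M : ModuleCat.{0} (Weyl n)) (a : Weyl n) (m : baseModule (k := ℂ) M) :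
    (tensorRel (k := ℂ) (originModule n) M).mkQ ((Submodule.Quotient.mk a : originModule n) ⊗ₜ m) =
      toOriginTensor M (baseAct M a m) := by
  have h : (Submodule.Quotient.mk a : originModule n) =
      MulOpposite.op a • (Submodule.Quotient.mk 1 : originModule n) :=
    congrArg Submodule.Quotient.mk (one_mul a).symm
  refine (Submodule.Quotient.eq _).2 (Submodule.subset_span ⟨Submodule.Quotient.mk 1, a, m, ?_⟩)
  rw [h]
  rfl

theorem toOriginTensor_surjective (M : ModuleCat.{0} (Weyl n)) :
    Function.Surjective (toOriginTensor M) := by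
  rw [← LinearMap.range_eq_top, eq_top_iff]
  intro t ht
  clear ht
  obtain ⟨t, rfl⟩ := Submodule.Quotient.mk_surjective _ t
  induction t using TensorProduct.induction_on with
  | zero => exact Submodule.zero_mem _
  | tmul y m =>
    obtain ⟨b, rfl⟩ := Submodule.Quotient.mk_surjective _ y
    exact ⟨_, (mkQ_tmul_eq M b m).symm⟩
  | add s t hs ht => exact Submodule.add_mem _ hs ht

/-- The tensor relations show directly that `xⱼ M` is killed. For the converse one needs a map out
of the tensor product that detects `[1] ⊗ m`, and this is `originTensorMap`. -/
theorem ker_toOriginTensor (M : ModuleCat.{0} (Weyl n)) :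
    LinearMap.ker (toOriginTensor M) = xRange M := by
  apply le_antisymm
  · intro m hm
    have h1 : (Submodule.Quotient.mk 1 : originModule n) ⊗ₜ[ℂ] m ∈
        tensorRel (k := ℂ) (originModule n) M :=
      (Submodule.Quotient.mk_eq_zero _).1 hm
    have h2 := tensorRel_le_ker M h1
    rw [LinearMap.mem_ker, originTensorMap_mk_tmul] at h2
    have h3 := (Submodule.Quotient.mk_eq_zero _).1 h2
    have h4 : baseAct M (1 : Weyl n) m = m := one_smul (Weyl n) (show M from m)
    rwa [h4] at h3
  · refine iSup_le fun j => ?_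
    rintro _ ⟨m, rfl⟩
    change toOriginTensor M (baseAct M (Weyl.x j) m) = 0
    have h : (Submodule.Quotient.mk (Weyl.x j) : originModule n) = 0 :=
      (Submodule.Quotient.mk_eq_zero _).2 (Submodule.subset_span (Set.mem_range_self j))
    rw [← mkQ_tmul_eq, h, TensorProduct.zero_tmul, map_zero]
    rfl

/-- The projection from the top degree of the Koszul complex of the `xᵢ` on `M`
to `(Aₙ / (x₁Aₙ + ⋯ + xₙAₙ)) ⊗_{Aₙ} M`. -/
def xKoszulπ (M : ModuleCat.{0} (Weyl n)) :
    (xKoszul.obj M).X 0 ⟶ (tensorFunctor (k := ℂ) (originModule n)).obj M :=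
  ModuleCat.ofHom (toOriginTensor M ∘ₗ LinearMap.proj (topWedge n))

/-- The sets with `n - 1` elements are the complements of single indices `j`, and the last
differential has component `± xⱼ` on the complement of `j`. Putting `wedgeSign j Finset.univ` into
the preimage cancels the sign. -/
theorem range_gradedKoszulD_top (M : ModuleCat.{0} (Weyl n)) :
    (LinearMap.range (gradedKoszulD (xEnd M) (-1) 0)).map (LinearMap.proj (topWedge n)) =
      xRange M := by
  apply le_antisymm
  · rintro _ ⟨_, ⟨u, rfl⟩, rfl⟩
    rw [LinearMap.proj_apply, gradedKoszulD_eq_sum]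
    refine Submodule.sum_mem _ fun K _ => Submodule.sum_mem _ fun j _ => ?_
    exact zsmul_mem (Submodule.mem_iSup_of_mem (p := fun j => LinearMap.range (xEnd M j)) j
      (LinearMap.mem_range_self _ _)) _
  · refine iSup_le fun j => ?_
    rintro _ ⟨m, rfl⟩
    have hj : j ∈ (Finset.univ : Finset (Fin n)) := Finset.mem_univ j
    let K : WedgeIndex n (-1) := ⟨Finset.univ.erase j, by
      have := Finset.card_erase_add_one hj
      rw [Finset.card_univ, Fintype.card_fin] at this
      omega⟩
    refine ⟨_, ⟨Pi.single K (wedgeSign j Finset.univ • m), rfl⟩, ?_⟩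
    rw [LinearMap.proj_apply, gradedKoszulD_eq_sum, Finset.sum_eq_single K, Finset.sum_eq_single j,
      Pi.single_eq_same, map_zsmul, smul_smul, wedgeCoeff_eq, if_pos ⟨hj, rfl⟩]
    · change (wedgeSign j Finset.univ * wedgeSign j Finset.univ) • _ = _
      rw [wedgeSign_mul_self, one_smul]
    · intro i _ hi
      rw [wedgeCoeff_eq, if_neg, zero_smul]
      rintro ⟨_, h⟩
      have h1 : j ∉ Finset.univ.erase i := h ▸ Finset.notMem_erase j _
      exact h1 (Finset.mem_erase.2 ⟨hi.symm, hj⟩)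
    · simp
    · intro L _ hL
      simp [Pi.single_eq_of_ne hL]
    · simp

theorem xKoszul_d_π (M : ModuleCat.{0} (Weyl n)) : (xKoszul.obj M).d (-1) 0 ≫ xKoszulπ M = 0 := by
  refine ModuleCat.hom_ext (LinearMap.ext fun u => ?_)
  change gradedKoszulD (xEnd M) (-1) 0 u (topWedge n) ∈ LinearMap.ker (toOriginTensor M)
  rw [ker_toOriginTensor, ← range_gradedKoszulD_top]
  exact ⟨_, ⟨u, rfl⟩, rfl⟩

theorem xKoszul_π_exact (M : ModuleCat.{0} (Weyl n)) :
    (ShortComplex.mk _ _ (xKoszul_d_π M)).Exact := by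
  rw [ShortComplex.moduleCat_exact_iff]
  intro v hv
  have h1 : (v : WedgeIndex n 0 → _) (topWedge n) ∈ LinearMap.ker (toOriginTensor M) := hv
  rw [ker_toOriginTensor, ← range_gradedKoszulD_top] at h1
  obtain ⟨_, ⟨u, rfl⟩, hu⟩ := h1
  exact ⟨u, funext fun L => by rw [eq_topWedge L]; exact hu⟩

instance (M : ModuleCat.{0} (Weyl n)) : Epi (xKoszulπ M) := by
  rw [ModuleCat.epi_iff_surjective]
  intro t
  obtain ⟨m, rfl⟩ := toOriginTensor_surjective M t
  exact ⟨fun _ => m, rfl⟩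

theorem xKoszulπ_naturality {M M' : ModuleCat.{0} (Weyl n)} (f : M ⟶ M') :
    (xKoszul.map f).f 0 ≫ xKoszulπ M' =
      xKoszulπ M ≫ (tensorFunctor (k := ℂ) (originModule n)).map f := rfl

theorem isZero_xKoszul_X (M : ModuleCat.{0} (Weyl n)) {p : ℤ} (hp : 0 < p) :
    IsZero ((xKoszul.obj M).X p) := by
  have : IsEmpty (WedgeIndex n p) := ⟨fun L => by
    have := L.2
    have := Finset.card_le_univ L.1
    rw [Fintype.card_fin] at this
    omega⟩
  have : Subsingleton ((xKoszul.obj M).X p) :=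
    inferInstanceAs (Subsingleton (WedgeIndex n p → baseModule (k := ℂ) M))
  exact ModuleCat.isZero_of_subsingleton _

/-- The zeroth opcycles of the Koszul complex of the `xᵢ`. -/
def xKoszulOpcyclesIso (M : ModuleCat.{0} (Weyl n)) :
    (xKoszul.obj M).opcycles 0 ≅ (tensorFunctor (k := ℂ) (originModule n)).obj M :=
  ((xKoszul.obj M).opcyclesIsCokernel (-1) 0 (by simp)).coconePointUniqueUpToIso
    (xKoszul_π_exact M).gIsCokernel

theorem pOpcycles_xKoszulOpcyclesIso_hom (M : ModuleCat.{0} (Weyl n)) :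
    (xKoszul.obj M).pOpcycles 0 ≫ (xKoszulOpcyclesIso M).hom = xKoszulπ M :=
  IsColimit.comp_coconePointUniqueUpToIso_hom ((xKoszul.obj M).opcyclesIsCokernel (-1) 0 (by simp))
    (xKoszul_π_exact M).gIsCokernel WalkingParallelPair.one

theorem pOpcycles_xKoszulOpcyclesIso_hom_assoc (M : ModuleCat.{0} (Weyl n)) {Z : ModuleCat.{0} ℂ}
    (h : (tensorFunctor (k := ℂ) (originModule n)).obj M ⟶ Z) :
    (xKoszul.obj M).pOpcycles 0 ≫ (xKoszulOpcyclesIso M).hom ≫ h = xKoszulπ M ≫ h := by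
  rw [← Category.assoc, pOpcycles_xKoszulOpcyclesIso_hom]

theorem xKoszulOpcyclesIso_naturality {M M' : ModuleCat.{0} (Weyl n)} (f : M ⟶ M') :
    HomologicalComplex.opcyclesMap (xKoszul.map f) 0 ≫ (xKoszulOpcyclesIso M').hom =
      (xKoszulOpcyclesIso M).hom ≫ (tensorFunctor (k := ℂ) (originModule n)).map f := by
  rw [← cancel_epi ((xKoszul.obj M).pOpcycles 0), HomologicalComplex.p_opcyclesMap_assoc,
    pOpcycles_xKoszulOpcyclesIso_hom, pOpcycles_xKoszulOpcyclesIso_hom_assoc,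
    xKoszulπ_naturality]

/-- The cohomology in degree zero of the Koszul complex of the `xᵢ`. -/
def xKoszulHomologyZero (n : ℕ) :
    xKoszul (n := n) ⋙ HomologicalComplex.homologyFunctor _ _ 0 ≅
      tensorFunctor (k := ℂ) (originModule n) :=
  NatIso.ofComponents
    (fun M => (show (xKoszul.obj M).homology 0 ≅ _ from
      (xKoszul.obj M).isoHomologyι 0 1 (by simp)
        ((isZero_xKoszul_X M one_pos).eq_of_tgt _ _) ≪≫ xKoszulOpcyclesIso M))
    (fun {M M'} f => by
      change HomologicalComplex.homologyMap (xKoszul.map f) 0 ≫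
        (xKoszul.obj M').homologyι 0 ≫ (xKoszulOpcyclesIso M').hom =
        ((xKoszul.obj M).homologyι 0 ≫ (xKoszulOpcyclesIso M).hom) ≫ _
      rw [HomologicalComplex.homologyι_naturality_assoc, Category.assoc,
        xKoszulOpcyclesIso_naturality])

/-- In each degree the functor is a finite power of the underlying vector space, so exactness is
checked component by component. -/
theorem xKoszul_shortExact {S : ShortComplex (ModuleCat.{0} (Weyl n))} (hS : S.ShortExact) :
    (S.map (xKoszul (n := n))).ShortExact := by
  refine HomologicalComplex.shortExact_of_degreewise_shortExact _ fun p => ?_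
  refine
    { exact := ?_
      mono_f := ?_
      epi_g := ?_ }
  · rw [ShortComplex.moduleCat_exact_iff]
    intro (v : WedgeIndex n p → S.X₂) hv
    have h : ∀ L, ∃ w, S.f w = v L := fun L =>
      (ShortComplex.moduleCat_exact_iff _).1 hS.exact (v L) (congrFun hv L)
    choose w hw using h
    exact ⟨w, funext hw⟩
  · rw [ModuleCat.mono_iff_injective]
    intro (u : WedgeIndex n p → S.X₁) (v : WedgeIndex n p → S.X₁) h
    have := hS.mono_f
    exact funext fun L => (ModuleCat.mono_iff_injective S.f).1 inferInstance (congrFun h L)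
  · rw [ModuleCat.epi_iff_surjective]
    intro (v : WedgeIndex n p → S.X₃)
    have := hS.epi_g
    choose w hw using (ModuleCat.epi_iff_surjective S.g).1 inferInstance
    exact ⟨fun L => w (v L), funext fun L => hw (v L)⟩

end
end WeylFourier
end

noncomputable section
namespace WeylFourier
open CategoryTheory Limits

/-! ### Dimension shifting for an exact functor with values in complexes. -/

section DimensionShift
variable {C D : Type*} [Category* C] [Category* D] [Abelian C] [Abelian D]

/-- For a complex that is exact in degree `p`, the short exact sequence
`0 → coker d^{p-1} → K^{p+1} → coker dᵖ → 0`. -/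
theorem opcycles_shortExact (K : CochainComplex C ℤ) (p : ℤ) (h : K.ExactAt p) :
    (ShortComplex.mk (K.fromOpcycles p (p + 1)) (K.pOpcycles (p + 1))
      (by simp [← cancel_epi (K.pOpcycles p)])).ShortExact := by
  have hi : K.homologyι p = 0 :=
    (K.exactAt_iff_isZero_homology p |>.1 h).eq_of_src _ _
  have hm : Mono (K.fromOpcycles p (p + 1)) := by
    refine Preadditive.mono_of_cancel_zero _ fun {Z} g hg => ?_
    obtain ⟨l, hl⟩ := KernelFork.IsLimit.lift' (K.homologyIsKernel p (p + 1) (by simp)) g hg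
    change l ≫ K.homologyι p = g at hl
    exact hl.symm.trans ((congrArg (l ≫ ·) hi).trans comp_zero)
  refine { exact := ?_, mono_f := hm, epi_g := inferInstance }
  have h1 : (ShortComplex.mk (K.d p (p + 1)) (K.pOpcycles (p + 1)) (by simp)).Exact :=
    ShortComplex.exact_of_g_is_cokernel _ (K.opcyclesIsCokernel p (p + 1) (by simp))
  rw [ShortComplex.exact_iff_exact_up_to_refinements] at h1 ⊢
  intro A x hx
  obtain ⟨A', π, hπ, y, hy⟩ := h1 x hx
  exact ⟨A', π, hπ, y ≫ K.pOpcycles p, by simpa using hy⟩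

theorem exists_iso_of_isColimit_cokernelCofork {W Y B B' Z : D} {a : W ⟶ Y} {π : Y ⟶ B}
    {π' : Y ⟶ B'} (w : a ≫ π = 0) (w' : a ≫ π' = 0) (h : IsColimit (CokernelCofork.ofπ π w))
    (h' : IsColimit (CokernelCofork.ofπ π' w')) (f : B ⟶ Z) (f' : B' ⟶ Z)
    (hf : π ≫ f = π' ≫ f') : ∃ e : B ≅ B', f = e.hom ≫ f' := by
  have he : π ≫ (h.coconePointUniqueUpToIso h').hom = π' :=
    IsColimit.comp_coconePointUniqueUpToIso_hom h h' WalkingParallelPair.one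
  refine ⟨h.coconePointUniqueUpToIso h', Cofork.IsColimit.hom_ext h ?_⟩
  exact hf.trans ((congrArg (· ≫ f') he.symm).trans (Category.assoc _ _ _))

theorem nonempty_iso_of_isLimit_kernelFork {A H B B' Z : D} {δ : A ⟶ B} {f : B ⟶ Z} {ι : H ⟶ B'}
    {f' : B' ⟶ Z} (w : δ ≫ f = 0) (w' : ι ≫ f' = 0) (h : IsLimit (KernelFork.ofι δ w))
    (h' : IsLimit (KernelFork.ofι ι w')) (e : B ≅ B') (hf : f = e.hom ≫ f') :
    Nonempty (A ≅ H) := by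
  subst hf
  exact ⟨h.conePointUniqueUpToIso (limit.isLimit _) ≪≫ kernelIsIsoComp e.hom f' ≪≫
    (limit.isLimit _).conePointUniqueUpToIso h'⟩

variable (T : C ⥤ CochainComplex D ℤ) [T.Additive]
  (hT : ∀ S : ShortComplex C, S.ShortExact → (S.map T).ShortExact)
  (hproj : ∀ (P : C) [Projective P] (p : ℤ), p < 0 → (T.obj P).ExactAt p)
  (hpos : ∀ (M : C) (p : ℤ), 0 < p → IsZero ((T.obj M).X p))

-- The complexes live in degrees at most `0`, so `H¹` vanishes and the long exact sequence ends with
-- a surjection on `H⁰`.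
include hT hpos in
theorem preservesFiniteColimits_homology_zero :
    PreservesFiniteColimits (T ⋙ HomologicalComplex.homologyFunctor D _ 0) := by
  rw [Functor.preservesFiniteColimits_iff_forall_exact_map_and_epi]
  intro S hS
  have hTS := hT S hS
  refine ⟨hTS.homology_exact₂ 0, ?_⟩
  have h1 : IsZero ((T.obj S.X₁).homology 1) :=
    HomologicalComplex.exactAt_iff_isZero_homology _ _ |>.1
      (ShortComplex.exact_of_isZero_X₂ _ (hpos _ _ one_pos))
  have h2 := hTS.homology_exact₃ 0 1 (by simp)
  exact (ShortComplex.exact_iff_epi _ (h1.eq_of_tgt _ _)).1 h2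

-- Iterates the connecting isomorphisms of the sequences `0 → coker → P → coker → 0`: the middle
-- term has no cohomology in negative degrees, so going one step down the resolution raises the
-- degree by one. The process stops at degree `-1`, because `H⁰` of the middle term need not vanish.
include hT hproj in
theorem nonempty_iso_homology_opcycles (P : CochainComplex C ℤ) [∀ p, Projective (P.X p)]
    (hP : ∀ p < 0, P.ExactAt p) (j : ℕ) (b c : ℤ) (hb : b ≤ 0) (hc : c = b - j) :
    Nonempty ((T.obj (P.opcycles b)).homology (-1 - j) ≅ (T.obj (P.opcycles c)).homology (-1)) := by
  induction j generalizing b with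
  | zero =>
    obtain rfl : c = b := by simpa using hc
    exact ⟨eqToIso (by simp)⟩
  | succ j ih =>
    obtain ⟨a, rfl⟩ : ∃ a, b = a + 1 := ⟨b - 1, by ring⟩
    obtain ⟨e⟩ := ih a (by omega) (by rw [hc]; push_cast; ring)
    have hS := hT _ (opcycles_shortExact P a (hP a (by omega)))
    refine ⟨hS.δIso (-1 - (j + 1 : ℕ)) (-1 - j) (by simp; ring) ?_ ?_ ≪≫ e⟩
    · exact HomologicalComplex.exactAt_iff_isZero_homology _ _ |>.1 (hproj (P.X (a + 1)) _ (by omega))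
    · exact HomologicalComplex.exactAt_iff_isZero_homology _ _ |>.1 (hproj (P.X (a + 1)) _ (by omega))

/-- A right exact functor commutes with the cokernels of the differentials. Compatibility with the
map to the next term is recorded because its kernel is the cohomology of the complex. -/
theorem exists_iso_opcycles_map (G : C ⥤ D) [G.Additive] [PreservesFiniteColimits G]
    (P : CochainComplex C ℤ) (p : ℤ) :
    ∃ e : G.obj (P.opcycles p) ≅ ((G.mapHomologicalComplex _).obj P).opcycles p,
      G.map (P.fromOpcycles p (p + 1)) =
        e.hom ≫ ((G.mapHomologicalComplex _).obj P).fromOpcycles p (p + 1) := by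
  have w : G.map (P.d (p - 1) p) ≫ G.map (P.pOpcycles p) = 0 := by
    rw [← G.map_comp, HomologicalComplex.d_pOpcycles, G.map_zero]
  refine exists_iso_of_isColimit_cokernelCofork w _
    (CokernelCofork.mapIsColimit _ (P.opcyclesIsCokernel (p - 1) p (by simp)) G)
    (((G.mapHomologicalComplex _).obj P).opcyclesIsCokernel (p - 1) p (by simp)) _ _ ?_
  have h := ((G.mapHomologicalComplex _).obj P).p_fromOpcycles p (p + 1)
  refine Eq.trans ?_ h.symm
  refine (G.map_comp _ _).symm.trans ?_
  rw [HomologicalComplex.p_fromOpcycles]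
  rfl

include hT hproj hpos in
/-- Dimension shifting: the cohomology of the exact functor `T` with values in complexes is
computed as the left derived functor of `H⁰ ∘ T`. -/
theorem nonempty_iso_homology_mapHomologicalComplex (P : CochainComplex C ℤ)
    [∀ p, Projective (P.X p)] (hP : ∀ p < 0, P.ExactAt p) (hP' : ∀ p, 0 < p → IsZero (P.X p))
    (p : ℤ) :
    Nonempty ((T.obj (P.opcycles 0)).homology p ≅
      (((T ⋙ HomologicalComplex.homologyFunctor D _ 0).mapHomologicalComplex _).obj
        P).homology p) := by
  have := preservesFiniteColimits_homology_zero T hT hpos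
  set G := T ⋙ HomologicalComplex.homologyFunctor D _ 0 with hG
  set Q := (G.mapHomologicalComplex (.up ℤ)).obj P
  have hQ : ∀ p, 0 < p → IsZero (Q.X p) := fun p hp => G.map_isZero (hP' p hp)
  rcases lt_trichotomy p 0 with hp | rfl | hp
  · obtain ⟨j, rfl⟩ : ∃ j : ℕ, p = -1 - j := ⟨(-1 - p).toNat, by omega⟩
    set p : ℤ := -1 - j
    obtain ⟨e1⟩ := nonempty_iso_homology_opcycles T hT hproj P hP j 0 (p + 1) le_rfl
      (by simp only [p]; ring)
    obtain ⟨e, he⟩ := exists_iso_opcycles_map G P p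
    have hS := hT _ (opcycles_shortExact P p (hP p hp))
    -- One step remains after the shift to degree `-1`. Since `H⁻¹` of the projective term vanishes,
    -- the group sought is the kernel of `G(coker) → G(P^{p+1})`, and right exactness of `G`
    -- identifies that kernel with the cohomology of `G(P)` in degree `p`.
    have hz := HomologicalComplex.exactAt_iff_isZero_homology _ _ |>.1
      (hproj (P.X (p + 1)) (-1) (by omega))
    have hm : Mono (hS.δ (-1) 0 (by simp)) := hS.mono_δ (-1) 0 (by simp) hz
    have hk := (hS.homology_exact₁ (-1) 0 (by simp))
    have : Mono (ShortComplex.mk _ _ (hS.δ_comp (-1) 0 (by simp))).f := hm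
    obtain ⟨e2⟩ := nonempty_iso_of_isLimit_kernelFork _ _ hk.fIsKernel
      (Q.homologyIsKernel p (p + 1) (by simp)) e he
    exact ⟨e1 ≪≫ e2⟩
  · obtain ⟨e, he⟩ := exists_iso_opcycles_map G P 0
    exact ⟨e ≪≫ (Q.isoHomologyι 0 1 (by simp) ((hQ 1 one_pos).eq_of_tgt _ _)).symm⟩
  · refine ⟨IsZero.iso ?_ ?_⟩
    · exact HomologicalComplex.exactAt_iff_isZero_homology _ _ |>.1
        (ShortComplex.exact_of_isZero_X₂ _ (hpos _ _ hp))
    · exact HomologicalComplex.exactAt_iff_isZero_homology _ _ |>.1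
        (ShortComplex.exact_of_isZero_X₂ _ (hQ _ hp))

end DimensionShift

section
variable {n : ℕ}

/-- The opcycles in degree zero of a projective resolution. -/
def resolutionOpcyclesIso {C : Type*} [Category* C] [Abelian C] {M : C}
    (R : ProjectiveResolution M) : R.cochainComplex.opcycles 0 ≅ M :=
  (R.cochainComplex.isoHomologyι 0 1 (by simp)
    ((CochainComplex.isZero_of_isStrictlyLE R.cochainComplex 0 1 (by simp)).eq_of_tgt _ _)).symm ≪≫
  asIso (HomologicalComplex.homologyMap R.π' 0) ≪≫ HomologicalComplex.singleObjHomologySelfIso _ 0 M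

/-- The restriction to the origin of an `Aₙ`-module is computed by the Koszul complex. -/
theorem nonempty_iso_restrictionToOrigin (M : ModuleCat.{0} (Weyl n)) (i : ℤ) :
    Nonempty ((xKoszul.obj M).homology i ≅ restrictionToOrigin M i) := by
  let R := projectiveResolution M
  obtain ⟨e⟩ := nonempty_iso_homology_mapHomologicalComplex (xKoszul (n := n))
    (fun S hS => xKoszul_shortExact hS) (fun P _ p hp => xKoszul_exactAt P p hp)
    (fun M p hp => isZero_xKoszul_X M hp) R.cochainComplex
    (fun p hp => R.cochainComplex.exactAt_of_isGE 0 p hp)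
    (fun p hp => CochainComplex.isZero_of_isStrictlyLE R.cochainComplex 0 p hp) i
  refine ⟨(HomologicalComplex.homologyFunctor _ _ i).mapIso
    (xKoszul.mapIso (resolutionOpcyclesIso R).symm) ≪≫ e ≪≫
    (HomologicalComplex.homologyFunctor _ _ i).mapIso
      ((NatIso.mapHomologicalComplex (xKoszulHomologyZero n) _).app R.cochainComplex)⟩

end
end WeylFourier
end

noncomputable section
namespace WeylFourier
open CategoryTheory Limits Opposite

/-! ### Koszul complexes under additive functors, and global sections of the de Rham complex. -/

section
variable {n : ℕ} {k : Type} [Field k]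

/-- The Koszul complexes of two families of endomorphisms that correspond to each other under
a linear isomorphism are isomorphic. -/
def funKoszulCongr [CharZero k] {V V' : Type} [AddCommGroup V] [Module k V] [AddCommGroup V'] [Module k V']
    {φ : Fin n → Module.End k V} {φ' : Fin n → Module.End k V'}
    (hφ : ∀ i j, φ i * φ j = φ j * φ i) (hφ' : ∀ i j, φ' i * φ' j = φ' j * φ' i)
    (e : V ≃ₗ[k] V') (he : ∀ j v, e (φ j v) = φ' j (e v)) :
    funKoszul φ hφ ≅ funKoszul φ' hφ' :=
  HomologicalComplex.Hom.isoOfComponents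
    (fun p => (LinearEquiv.toModuleIso (LinearEquiv.piCongrRight fun _ : WedgeIndex n p => e)))
    (fun p q _ => ModuleCat.hom_ext (LinearMap.ext fun u =>
      gradedKoszulD_compLeft e.toLinearMap he p q u))

theorem map_hom_comm {C : Type*} [Category* C] (F : C ⥤ ModuleCat.{0} k) (A : C)
    (φ : Fin n → (A ⟶ A)) (hφ : ∀ i j, φ i ≫ φ j = φ j ≫ φ i) (i j : Fin n) :
    (F.map (φ i)).hom * (F.map (φ j)).hom = (F.map (φ j)).hom * (F.map (φ i)).hom := by
  have := congrArg (fun f => (F.map f).hom) (hφ j i)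
  simpa using! this

variable {C : Type*} [Category* C] [Preadditive C] [HasFiniteBiproducts C]
  (F : C ⥤ ModuleCat.{0} k) [F.Additive] (A : C) (φ : Fin n → (A ⟶ A))
  (hφ : ∀ i j, φ i ≫ φ j = φ j ≫ φ i)

/-- The components of the isomorphism `koszulMapIso`. -/
def koszulMapXIso (p : ℤ) :
    F.obj (⨁ fun _ : WedgeIndex n p => A) ≅ ModuleCat.of k (WedgeIndex n p → F.obj A) :=
  F.mapBiproduct _ ≪≫ ModuleCat.biproductIsoPi _

theorem koszulMapXIso_hom_apply (p : ℤ) (u : F.obj (⨁ fun _ : WedgeIndex n p => A))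
    (K : WedgeIndex n p) :
    ((koszulMapXIso F A p).hom u : WedgeIndex n p → F.obj A) K =
      F.map (biproduct.π (fun _ : WedgeIndex n p => A) K) u := by
  have h : (koszulMapXIso F A p).hom ≫ ModuleCat.ofHom (LinearMap.proj K) =
      F.map (biproduct.π (fun _ : WedgeIndex n p => A) K) := by
    rw [koszulMapXIso, Iso.trans_hom, Category.assoc, ← ModuleCat.biproductIsoPi_inv_comp_π]
    erw [Iso.hom_inv_id_assoc]
    rw [Functor.mapBiproduct_hom, biproduct.lift_π]
  exact congrArg (fun f => f.hom u) h

theorem koszulMapXIso_hom_comm (p q : ℤ) (u : F.obj (⨁ fun _ : WedgeIndex n p => A)) :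
    gradedKoszulD (fun j => (F.map (φ j)).hom) p q ((koszulMapXIso F A p).hom u) =
      (koszulMapXIso F A q).hom (F.map (koszulD A φ p q) u) := by
  funext L
  have h : koszulD A φ p q ≫ biproduct.π (fun _ : WedgeIndex n q => A) L =
      ∑ K, biproduct.π (fun _ : WedgeIndex n p => A) K ≫
        ∑ j, wedgeCoeff j K.1 L.1 • φ j := by
    apply biproduct.hom_ext'
    intro K
    rw [koszulD, biproduct.matrix_π, biproduct.ι_desc, Preadditive.comp_sum]
    rw [Finset.sum_eq_single K]
    · rw [biproduct.ι_π_self_assoc]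
    · intro K' _ hK
      rw [biproduct.ι_π_ne_assoc _ hK.symm, zero_comp]
    · exact fun h => absurd (Finset.mem_univ _) h
  rw [koszulMapXIso_hom_apply, gradedKoszulD_eq_sum, ← ConcreteCategory.comp_apply, ← F.map_comp,
    h, F.map_sum]
  refine Eq.trans ?_ (congrArg (fun f => f u) (ModuleCat.hom_sum _ _)).symm
  rw [LinearMap.sum_apply]
  refine Finset.sum_congr rfl fun K _ => ?_
  rw [F.map_comp, F.map_sum, ModuleCat.hom_comp, LinearMap.comp_apply, ModuleCat.hom_sum,
    LinearMap.sum_apply]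
  refine Finset.sum_congr rfl fun j _ => ?_
  rw [F.map_zsmul, koszulMapXIso_hom_apply]
  rfl

/-- An additive functor with values in vector spaces commutes with the formation of Koszul
complexes. -/
def koszulMapIso [CharZero k] :
    (F.mapHomologicalComplex _).obj (koszul A φ hφ) ≅
      funKoszul (fun j => (F.map (φ j)).hom) (map_hom_comm F A φ hφ) :=
  HomologicalComplex.Hom.isoOfComponents (fun p => koszulMapXIso F A p)
    (fun p q _ => ModuleCat.hom_ext (LinearMap.ext fun u => koszulMapXIso_hom_comm F A φ p q u))

end

section
variable {n : ℕ}

/-- The global sections of a `𝒟_X`-module and its Fourier transform have the same underlying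
vector space. -/
def globalSectionsEquiv (M : DMod n) :
    (globalSectionsFunctor n).obj M.toSh ≃ₗ[ℂ]
      baseModule (k := ℂ) (Weyl.fourierTransform M.globalSections) :=
  { Equiv.refl _ with
    map_add' := fun _ _ => rfl
    map_smul' := fun c v => by
      have h : algebraMap ℂ (DiffOp (⊤ : (X n).Opens)) c =
          weylToD n ((Weyl.fourier n).symm (algebraMap ℂ (Weyl n) c)) := by
        rw [AlgEquiv.commutes, AlgHom.commutes]
      exact congrArg (fun P : (sheafD n).obj.obj (op ⊤) =>
        (P • (show M.val.obj (op ⊤) from v) : M.val.obj (op ⊤))) h }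

/-- `Φ` sends `∂ⱼ` to `xⱼ`, so the element acting on `M` as `xⱼ` does on the Fourier transform is
`∂ⱼ`. This turns the de Rham differential into the Koszul differential. -/
theorem globalSectionsEquiv_act (M : DMod n) (j : Fin n)
    (v : (globalSectionsFunctor n).obj M.toSh) :
    globalSectionsEquiv M (((globalSectionsFunctor n).map (M.act (globalPartial j))).hom v) =
      xEnd (Weyl.fourierTransform M.globalSections) j (globalSectionsEquiv M v) := by
  have h : globalPartial j = weylToD n ((Weyl.fourier n).symm (Weyl.x j)) := by
    have h1 : (Weyl.fourier n).symm (Weyl.x j) = Weyl.d j := by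
      rw [AlgEquiv.symm_apply_eq, Weyl.fourier_d]
    rw [h1]
    exact (Weyl.lift_d _ _ _ _ _ j).symm
  exact congrArg (fun P : (sheafD n).obj.obj (op ⊤) =>
    (P • (show M.val.obj (op ⊤) from v) : M.val.obj (op ⊤))) h

/-- The global sections of the de Rham complex form the Koszul complex of the `xᵢ` on the
Fourier transform. -/
def globalSectionsDeRhamIso (M : DMod n) :
    ((globalSectionsFunctor n).mapHomologicalComplex _).obj M.deRham ≅
      xKoszul.obj (Weyl.fourierTransform M.globalSections) :=
  koszulMapIso (globalSectionsFunctor n) M.toSh _ _ ≪≫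
    funKoszulCongr _ (xEnd_comm _) (globalSectionsEquiv M) (globalSectionsEquiv_act M)

end
end WeylFourier
end

noncomputable section
namespace WeylFourier
open CategoryTheory Limits Opposite

/-! ### Computing a right derived functor with an adapted class. -/

section
universe v u v' u'
variable {C : Type u} [Category.{v} C] [Abelian C] {D : Type u'} [Category.{v'} D] [Abelian D]

/-- A class of objects that is adapted to a left exact functor `F`: it contains the injective
objects, is stable under direct sums and cokernels, and `F` is exact on it. -/
structure IsAdaptedClass (F : C ⥤ D) (P : ObjectProperty C) : Prop where
  of_iso {Y Z : C} (e : Y ≅ Z) (h : P Y) : P Z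
  of_injective (Y : C) (h : Injective Y) : P Y
  biprod {Y Z : C} (hY : P Y) (hZ : P Z) : P (Y ⊞ Z)
  cokernel {S : ShortComplex C} (hS : S.ShortExact) (h₁ : P S.X₁) (h₂ : P S.X₂) : P S.X₃
  epi {S : ShortComplex C} (hS : S.ShortExact) (h₁ : P S.X₁) : Epi (F.map S.g)

/-- Cuts an exact complex into short exact sequences, to which the axioms of an adapted class apply.
-/
theorem shortExact_cycles {K : CochainComplex C ℤ} (p : ℤ)
    (hK : K.ExactAt (p + 1)) :
    (ShortComplex.mk (K.iCycles p) (K.toCycles p (p + 1)) (by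
      rw [← cancel_mono (K.iCycles (p + 1)), Category.assoc, K.toCycles_i, K.iCycles_d,
        zero_comp])).ShortExact where
  exact := by
    refine ShortComplex.exact_of_f_is_kernel _ (KernelFork.IsLimit.ofι' _ _ fun k hk =>
      ⟨K.liftCycles k (p + 1) (by simp) ?_, K.liftCycles_i ..⟩)
    have := congrArg (· ≫ K.iCycles (p + 1)) hk
    simpa using this
  mono_f := by dsimp; infer_instance
  epi_g := by
    exact Preadditive.epi_of_isZero_cokernel' _ (K.homologyIsCokernel p (p + 1) (by simp))
      ((HomologicalComplex.exactAt_iff_isZero_homology _ _).1 hK)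

variable (F : C ⥤ D) [F.Additive] [PreservesFiniteLimits F] {P : ObjectProperty C}

/-- A left exact functor preserves the acyclicity of a bounded below complex with terms in an
adapted class. -/
theorem IsAdaptedClass.acyclic_map (h : IsAdaptedClass F P) (K : CochainComplex C ℤ) (n : ℤ)
    [K.IsStrictlyGE n] (hK : K.Acyclic) (hP : ∀ p, P (K.X p)) :
    ((F.mapHomologicalComplex (ComplexShape.up ℤ)).obj K).Acyclic := by
  -- Below `n` the cycles embed in a zero object, so they are zero, hence injective and in the
  -- class. This starts the induction on the degree.
  have hlow : ∀ p, p < n → P (K.cycles p) := fun p hp =>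
    h.of_injective _ ((K.isZero_of_isStrictlyGE n p).of_mono (K.iCycles p)).injective
  have hcyc : ∀ p, P (K.cycles p) := by
    intro p
    rcases lt_or_ge p n with hp | hp
    · exact hlow p hp
    · refine Int.leInduction (m := n - 1) (motive := fun p _ => P (K.cycles p))
        (hlow _ (by lia)) (fun q _ hq => ?_) p (by lia)
      exact h.cokernel (shortExact_cycles q (hK _)) hq (hP q)
  intro p
  obtain ⟨q, rfl⟩ : ∃ q, p = q + 1 := ⟨p - 1, by lia⟩
  rw [HomologicalComplex.exactAt_iff' _ q (q + 1) (q + 1 + 1) (by simp) (by simp)]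
  have hepi : Epi (F.map (K.toCycles q (q + 1))) :=
    h.epi (shortExact_cycles q (hK _)) (hcyc q)
  -- By left exactness `F` of the cycles is still the kernel of the next differential. Replacing the
  -- cycles by `F(K^q)`, which maps epimorphically onto them, does not affect exactness.
  let T : ShortComplex C := ShortComplex.mk (K.iCycles (q + 1)) (K.d (q + 1) (q + 1 + 1))
    (K.iCycles_d ..)
  have hT : (T.map F).Exact :=
    (ShortComplex.exact_of_f_is_kernel T
      (K.cyclesIsKernel (q + 1) (q + 1 + 1) (by simp))).map_of_mono_of_preservesKernel F
        (by dsimp [T]; infer_instance) inferInstance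
  let φ : ((F.mapHomologicalComplex (ComplexShape.up ℤ)).obj K).sc' q (q + 1) (q + 1 + 1) ⟶
      T.map F :=
    { τ₁ := F.map (K.toCycles q (q + 1))
      τ₂ := 𝟙 _
      τ₃ := 𝟙 _
      comm₁₂ := by
        refine Eq.trans ?_ (Category.comp_id (F.map (K.d q (q + 1)))).symm
        exact (F.map_comp _ _).symm.trans (congrArg F.map (K.toCycles_i q (q + 1)))
      comm₂₃ := by
        exact (Category.id_comp (F.map (K.d (q + 1) (q + 1 + 1)))).trans
          (Category.comp_id (F.map (K.d (q + 1) (q + 1 + 1)))).symm }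
  have : Epi φ.τ₁ := hepi
  have : IsIso φ.τ₂ := inferInstanceAs (IsIso (𝟙 _))
  have : Mono φ.τ₃ := inferInstanceAs (Mono (𝟙 _))
  exact (ShortComplex.exact_iff_of_epi_of_isIso_of_mono φ).2 hT

/-- Reduces the preservation of quasi-isomorphisms to that of acyclicity, since additive functors
commute with mapping cones. -/
theorem quasiIso_iff_acyclic_mappingCone {K L : CochainComplex C ℤ} (f : K ⟶ L) :
    QuasiIso f ↔ (CochainComplex.mappingCone f).Acyclic := by
  rw [← HomotopyCategory.quotient_obj_mem_subcategoryAcyclic_iff_acyclic]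
  have h := (HomotopyCategory.subcategoryAcyclic C).trW_iff_of_distinguished _
    (HomotopyCategory.mappingCone_triangleh_distinguished f)
  rw [← HomotopyCategory.quasiIso_eq_trW_subcategoryAcyclic] at h
  refine Iff.trans ?_ h
  exact (HomotopyCategory.quotient_map_mem_quasiIso_iff f).symm

/-- A left exact functor preserves quasi-isomorphisms between bounded below complexes with terms
in an adapted class. -/
theorem IsAdaptedClass.quasiIso_map (h : IsAdaptedClass F P) {K L : CochainComplex C ℤ}
    (f : K ⟶ L) (n : ℤ) [K.IsStrictlyGE n] [L.IsStrictlyGE n] (hf : QuasiIso f)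
    (hK : ∀ p, P (K.X p)) (hL : ∀ p, P (L.X p)) :
    QuasiIso ((F.mapHomologicalComplex (ComplexShape.up ℤ)).map f) := by
  rw [quasiIso_iff_acyclic_mappingCone] at hf ⊢
  have : (CochainComplex.mappingCone f).IsStrictlyGE (n - 1) :=
    CochainComplex.isStrictlyGE_mappingCone f n n (n - 1)
  have h1 := h.acyclic_map F (CochainComplex.mappingCone f) (n - 1) hf fun p =>
    h.of_iso (HomologicalComplex.homotopyCofiber.XIsoBiprod f p (p + 1) (by simp)).symm
      (h.biprod (hK _) (hL _))
  have e := CochainComplex.mappingCone.mapHomologicalComplexIso f F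
  intro p
  exact (h1 p).of_iso e

/-- The derived functor can be computed with resolutions by objects of an adapted class. -/
theorem IsAdaptedClass.nonempty_iso_homology [EnoughInjectives C] [HasDerivedCategory C]
    [HasDerivedCategory D] (h : IsAdaptedClass F P) (K : CochainComplex.Plus C)
    (hK : ∀ p, P (K.obj.X p)) (i : ℤ) :
    Nonempty ((DerivedCategory.Plus.homologyFunctor D i).obj
      (F.rightDerivedFunctorPlus.obj
        (DerivedCategory.Plus.Qh.obj ((HomotopyCategory.Plus.quotient C).obj K))) ≅
      ((F.mapHomologicalComplex (ComplexShape.up ℤ)).obj K.obj).homology i) := by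
  obtain ⟨n, hn⟩ := K.property
  obtain ⟨L, hL, f, hf⟩ := CochainComplex.Plus.exists_quasiIso_injective K n
  let I := (InjectiveObject.ι C).mapCochainComplexPlus.obj L
  have hI : I.obj.IsStrictlyGE n := by
    exact (CochainComplex.isStrictlyGE_mapHomologicalComplex_obj_iff L.obj
      (InjectiveObject.ι C) n).2 hL
  have hIinj : ∀ p, Injective (I.obj.X p) := fun p => (L.obj.X p).property
  -- The injective resolution `I` computes the derived functor. As `K` and `I` both have terms in
  -- the class, `F` keeps `K → I` a quasi-isomorphism, so `F(K)` has the same cohomology as `F(I)`.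
  have hF : QuasiIso ((F.mapHomologicalComplex (ComplexShape.up ℤ)).map f.hom) :=
    h.quasiIso_map F f.hom n hf hK fun p => h.of_injective _ (hIinj p)
  have hQ : IsIso (DerivedCategory.Plus.Qh.map ((HomotopyCategory.Plus.quotient C).map f)) := by
    refine Localization.inverts DerivedCategory.Plus.Qh (HomotopyCategory.Plus.quasiIso C) _ ?_
    exact (HomotopyCategory.quotient_map_mem_quasiIso_iff f.hom).2 hf
  let e1 := F.rightDerivedFunctorPlus.mapIso (asIso
    (DerivedCategory.Plus.Qh.map ((HomotopyCategory.Plus.quotient C).map f)))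
  have hu : IsIso (F.rightDerivedFunctorPlusUnit.app ((HomotopyCategory.Plus.quotient C).obj I)) :=
    by dsimp only [I]; infer_instance
  let e2 := asIso (F.rightDerivedFunctorPlusUnit.app ((HomotopyCategory.Plus.quotient C).obj I))
  let e3 := (DerivedCategory.Plus.homologyFunctor D i).mapIso (e1 ≪≫ e2.symm)
  let e4 := (DerivedCategory.homologyFunctorFactorsh D i).app
    ((HomotopyCategory.quotient D (ComplexShape.up ℤ)).obj
      ((F.mapHomologicalComplex (ComplexShape.up ℤ)).obj I.obj))
  let e5 := (HomotopyCategory.homologyFunctorFactors D (ComplexShape.up ℤ) i).app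
      ((F.mapHomologicalComplex (ComplexShape.up ℤ)).obj I.obj)
  exact ⟨e3 ≪≫ e4 ≪≫ e5 ≪≫ (asIso (HomologicalComplex.homologyMap
    ((F.mapHomologicalComplex (ComplexShape.up ℤ)).map f.hom) i)).symm⟩

end
end WeylFourier
end

noncomputable section
namespace WeylFourier
open CategoryTheory Limits Opposite TopologicalSpace

/-! ### Exactness and acyclicity of sheaves of abelian groups. -/

section
variable {X : TopCat.{0}}

/-- Sheaves of abelian groups on a topological space. -/
abbrev AbSheaf (X : TopCat.{0}) := Sheaf (Opens.grothendieckTopology X) AddCommGrpCat.{0}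

/-- A complex of sheaves of abelian groups `0 → F → G → H → 0` is exact if it is locally exact on
sections. -/
theorem shortExact_of_locally {S : ShortComplex (AbSheaf X)}
    (hf : ∀ U : Opens X, Function.Injective (S.f.hom.app (op U)))
    (hex : ∀ (U : Opens X) (s : S.X₂.obj.obj (op U)), S.g.hom.app (op U) s = 0 → ∀ x ∈ U,
      ∃ (V : Opens X) (h : V ≤ U), x ∈ V ∧ ∃ t : S.X₁.obj.obj (op V),
        S.f.hom.app (op V) t = S.X₂.obj.map (homOfLE h).op s)
    (hg : ∀ (U : Opens X) (s : S.X₃.obj.obj (op U)), ∀ x ∈ U,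
      ∃ (V : Opens X) (h : V ≤ U), x ∈ V ∧ ∃ t : S.X₂.obj.obj (op V),
        S.g.hom.app (op V) t = S.X₃.obj.map (homOfLE h).op s) :
    S.ShortExact where
  exact := by
    refine (TopCat.Sheaf.exact_iff_stalkFunctor_map_exact (C := AddCommGrpCat.{0}) S).2 fun x => ?_
    rw [ShortComplex.ab_exact_iff]
    intro z hz
    obtain ⟨U, hxU, s, rfl⟩ := TopCat.Presheaf.exists_germ_eq (x := x) S.X₂.obj z
    have hz1 : (TopCat.Presheaf.stalkFunctor AddCommGrpCat x).map S.g.hom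
      (TopCat.Presheaf.germ S.X₂.obj U x hxU s) = 0 := hz
    rw [TopCat.Presheaf.stalkFunctor_map_germ_apply] at hz1
    have hz2 : TopCat.Presheaf.germ S.X₃.obj U x hxU (S.g.hom.app (op U) s) =
      TopCat.Presheaf.germ S.X₃.obj U x hxU 0 := hz1.trans (map_zero _).symm
    obtain ⟨W, hxW, i1, i2, hW⟩ := TopCat.Presheaf.germ_eq S.X₃.obj x hxU hxU _ _ hz2
    have h0 : S.g.hom.app (op W) (S.X₂.obj.map i1.op s) = 0 := by
      rw [NatTrans.naturality_apply S.g.hom i1.op s, hW, map_zero]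
    obtain ⟨V, hV, hxV, t, ht⟩ := hex W _ h0 x hxW
    refine ⟨TopCat.Presheaf.germ S.X₁.obj V x hxV t, ?_⟩
    have h1 : (TopCat.Presheaf.stalkFunctor AddCommGrpCat x).map S.f.hom
      (TopCat.Presheaf.germ S.X₁.obj V x hxV t) = TopCat.Presheaf.germ S.X₂.obj U x hxU s := by
      rw [TopCat.Presheaf.stalkFunctor_map_germ_apply, ht,
        TopCat.Presheaf.germ_res_apply, TopCat.Presheaf.germ_res_apply]
    exact h1
  mono_f := by
    have : ∀ U, Mono (S.f.hom.app U) := fun U =>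
      (AddCommGrpCat.mono_iff_injective _).2 (hf U.unop)
    have h : Mono ((sheafToPresheaf _ _).map S.f) := NatTrans.mono_of_mono_app S.f.hom
    exact (sheafToPresheaf _ _).mono_of_mono_map h
  epi_g := by
    rw [← CategoryTheory.Sheaf.isLocallySurjective_iff_epi' AddCommGrpCat.{0} S.g]
    refine (TopCat.Presheaf.isLocallySurjective_iff S.g.hom).2 fun U s x hx => ?_
    obtain ⟨V, hV, hxV, t, ht⟩ := hg U s x hx
    exact ⟨V, hV, ⟨t, ht⟩, hxV⟩

/-- A sheaf of abelian groups is acyclic if its higher cohomology vanishes. -/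
def IsAcyclicSheaf (F : AbSheaf X) : Prop :=
  ∀ q : ℕ, Subsingleton (CategoryTheory.Sheaf.H F (q + 1))

/-- The obstruction to lifting a global section lies in `H¹` of the kernel, which vanishes. -/
theorem IsAcyclicSheaf.surjective {S : ShortComplex (AbSheaf X)}
    (hS : S.ShortExact) (h : IsAcyclicSheaf S.X₁) :
    Function.Surjective (S.g.hom.app (op (⊤ : Opens X))) := by
  intro s
  let y := (CategoryTheory.Sheaf.H.equiv₀ S.X₃ isTerminalTop).symm s
  obtain ⟨z, hz⟩ := Abelian.Ext.covariant_sequence_exact₃ _ hS y (zero_add 1)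
    ((h 0).elim _ _)
  refine ⟨CategoryTheory.Sheaf.H.equiv₀ S.X₂ isTerminalTop z, ?_⟩
  have h1 := CategoryTheory.Sheaf.H.equiv₀_naturality isTerminalTop S.g z
  refine h1.trans ?_
  exact (congrArg (CategoryTheory.Sheaf.H.equiv₀ S.X₃ isTerminalTop) hz).trans
    (AddEquiv.apply_symm_apply _ s)

theorem IsAcyclicSheaf.cokernel {S : ShortComplex (AbSheaf X)}
    (hS : S.ShortExact) (h₁ : IsAcyclicSheaf S.X₁) (h₂ : IsAcyclicSheaf S.X₂) :
    IsAcyclicSheaf S.X₃ := by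
  intro q
  refine subsingleton_of_forall_eq 0 fun y => ?_
  obtain ⟨z, hz⟩ := Abelian.Ext.covariant_sequence_exact₃ _ hS y (n₁ := q + 1 + 1) rfl
    ((h₁ (q + 1)).elim _ _)
  rw [← hz, (h₂ q).elim z 0, Abelian.Ext.zero_comp]

theorem IsAcyclicSheaf.of_iso {F G : AbSheaf X} (e : F ≅ G)
    (h : IsAcyclicSheaf F) : IsAcyclicSheaf G := by
  intro q
  have := h q
  refine subsingleton_of_forall_eq 0 fun y => ?_
  rw [← CategoryTheory.Sheaf.H.map_id_apply y, ← e.inv_hom_id,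
    CategoryTheory.Sheaf.H.map_comp_apply, Subsingleton.elim
    (CategoryTheory.Sheaf.H.map e.inv (q + 1) y) 0, map_zero]

theorem IsAcyclicSheaf.middle {S : ShortComplex (AbSheaf X)}
    (hS : S.ShortExact) (h₁ : IsAcyclicSheaf S.X₁) (h₃ : IsAcyclicSheaf S.X₃) :
    IsAcyclicSheaf S.X₂ := by
  intro q
  refine subsingleton_of_forall_eq 0 fun y => ?_
  obtain ⟨z, hz⟩ := Abelian.Ext.covariant_sequence_exact₂ _ hS y ((h₃ q).elim _ _)
  rw [← hz, (h₁ q).elim z 0, Abelian.Ext.zero_comp]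

/-- Acyclicity by dimension shifting. -/
theorem isAcyclicSheaf_of_resolutions {P : AbSheaf X → Prop}
    (h : ∀ F, P F → ∃ S : ShortComplex (AbSheaf X), S.ShortExact ∧
      S.X₁ = F ∧ IsAcyclicSheaf S.X₂ ∧ P S.X₃ ∧
      Function.Surjective (S.g.hom.app (op (⊤ : Opens X)))) (F) (hF : P F) :
    IsAcyclicSheaf F := by
  intro q
  induction q generalizing F with
  | zero =>
    obtain ⟨S, hS, rfl, h₂, -, hsurj⟩ := h F hF
    refine subsingleton_of_forall_eq 0 fun y => ?_
    obtain ⟨z, hz⟩ := Abelian.Ext.covariant_sequence_exact₁ _ hS y ((h₂ 0).elim _ _) (zero_add 1)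
    -- The class is the boundary of a global section of the quotient. This section lifts to the
    -- middle term, and the boundary of a section that lifts is zero.
    obtain ⟨t, ht⟩ := hsurj (CategoryTheory.Sheaf.H.equiv₀ S.X₃ isTerminalTop z)
    have h1 := CategoryTheory.Sheaf.H.equiv₀_symm_naturality isTerminalTop S.g t
    rw [ht] at h1
    have h2 : z = ((CategoryTheory.Sheaf.H.equiv₀ S.X₂ isTerminalTop).symm t).comp
      (Abelian.Ext.mk₀ S.g) (add_zero 0) :=
      (AddEquiv.symm_apply_apply _ z).symm.trans h1.symm
    rw [← hz, h2, Abelian.Ext.comp_assoc_of_second_deg_zero, hS.comp_extClass,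
      Abelian.Ext.comp_zero]
  | succ q ih =>
    obtain ⟨S, hS, rfl, h₂, h₃, -⟩ := h F hF
    refine subsingleton_of_forall_eq 0 fun y => ?_
    obtain ⟨z, hz⟩ := Abelian.Ext.covariant_sequence_exact₁ _ hS y ((h₂ (q + 1)).elim _ _) rfl
    rw [← hz, (ih _ h₃).elim z 0, Abelian.Ext.zero_comp]

end
end WeylFourier
end

noncomputable section
namespace WeylFourier
open CategoryTheory Limits Opposite TopologicalSpace

/-! ### Injective and flasque sheaves, and the adapted class for global sections. -/

section
universe w
variable {X : TopCat.{0}}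

/-- A left adjoint of a forgetful functor to types preserves injections. -/
theorem mono_map_of_injective {A : Type 1} [Category.{0} A] [HasZeroObject A]
    {R : A ⥤ Type} {Fr : Type ⥤ A} (adj : Fr ⊣ R) {S T : Type} (f : S ⟶ T)
    (hf : Function.Injective f) : Mono (Fr.map f) := by
  -- An injection out of a nonempty set splits. The empty set has no retraction, but its image is a
  -- zero object, out of which every map is a monomorphism.
  rcases isEmpty_or_nonempty S with hS | hS
  · have hi : IsInitial S := (Types.initial_iff_empty S).2 hS |>.some
    have := adj.leftAdjoint_preservesColimits
    have h0 : IsZero (Fr.obj S) :=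
      (isZero_zero A).of_iso ((IsInitial.isInitialObj Fr S hi).uniqueUpToIso
        (HasZeroObject.zeroIsInitial))
    exact ⟨fun g h _ => h0.eq_of_tgt g h⟩
  · have : IsSplitMono f := ⟨⟨⟨↾(Function.invFun f), by
      ext s
      exact Function.leftInverse_invFun hf s⟩⟩⟩
    infer_instance

/-- The restriction maps of an injective sheaf are surjective. -/
theorem surjective_map_of_injective {A : Type 1} [Category.{0} A] {FA : A → A → Type}
    {CA : A → Type} [∀ Y Z, FunLike (FA Y Z) (CA Y) (CA Z)] [ConcreteCategory.{0} A FA] [HasZeroObject A]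
    [HasSheafify (Opens.grothendieckTopology X) A]
    {Fr : Type ⥤ A} (adj : Fr ⊣ forget A)
    (I : Sheaf (Opens.grothendieckTopology X) A) [Injective I] {U V : Opens X} (i : V ⟶ U) :
    Function.Surjective (I.obj.map i.op) := by
  -- By this adjunction and Yoneda, a section over `V` is a morphism from the free sheaf on the
  -- presheaf represented by `V`. The inclusion `V ⟶ U` induces a monomorphism of free sheaves, so
  -- injectivity extends the section to `U`.
  let a := (adj.whiskerRight (Opens X)ᵒᵖ).comp
    (sheafificationAdjunction (Opens.grothendieckTopology X) A)
  have hm : Mono (((Functor.whiskeringRight (Opens X)ᵒᵖ _ _).obj Fr ⋙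
      presheafToSheaf (Opens.grothendieckTopology X) A).map (yoneda.map i)) := by
    have h1 : Mono (((Functor.whiskeringRight (Opens X)ᵒᵖ _ _).obj Fr).map (yoneda.map i)) := by
      have : ∀ W, Mono ((((Functor.whiskeringRight (Opens X)ᵒᵖ _ _).obj Fr).map
          (yoneda.map i)).app W) := by
        intro W
        exact mono_map_of_injective adj _ fun f g _ => @Subsingleton.elim (W.unop ⟶ V) _ f g
      exact NatTrans.mono_of_mono_app _
    exact (presheafToSheaf (Opens.grothendieckTopology X) A).map_mono _
  intro s
  let s' : yoneda.obj V ⟶ (sheafToPresheaf (Opens.grothendieckTopology X) A ⋙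
    (Functor.whiskeringRight (Opens X)ᵒᵖ _ _).obj (forget A)).obj I :=
    yonedaEquiv.symm s
  let g := Injective.factorThru ((a.homEquiv _ _).symm s')
    (((Functor.whiskeringRight (Opens X)ᵒᵖ _ _).obj Fr ⋙
      presheafToSheaf (Opens.grothendieckTopology X) A).map (yoneda.map i))
  have hg : yoneda.map i ≫ a.homEquiv _ _ g = s' := by
    have h1 := a.homEquiv_naturality_left (yoneda.map i) g
    refine h1.symm.trans ?_
    rw [Injective.comp_factorThru, Equiv.apply_symm_apply]
  refine ⟨yonedaEquiv (a.homEquiv _ _ g), ?_⟩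
  have h2 := congrArg yonedaEquiv hg
  rw [Equiv.apply_symm_apply] at h2
  refine Eq.trans ?_ h2
  exact yonedaEquiv_naturality (a.homEquiv _ _ g) i
 
theorem isFlasque_of_injective (I : AbSheaf X) [Injective I] {U V : Opens X} (i : V ⟶ U) :
    Function.Surjective (I.obj.map i.op) :=
  surjective_map_of_injective AddCommGrpCat.adj I i

/-- Flasque sheaves are acyclic. -/
theorem isAcyclicSheaf_of_flasque (F : AbSheaf X)
    (hF : ∀ {U V : Opens X} (i : V ⟶ U), Function.Surjective (F.obj.map i.op)) :
    IsAcyclicSheaf F := by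
  refine isAcyclicSheaf_of_resolutions (P := fun F : AbSheaf X =>
    TopCat.Sheaf.IsFlasque (C := AddCommGrpCat.{0}) F) (fun F hF => ?_) F
    ⟨fun {U V} i => (AddCommGrpCat.epi_iff_surjective _).2 (hF i.unop)⟩
  let S : ShortComplex (AbSheaf X) := ShortComplex.mk (Injective.ι F) (cokernel.π _)
    (cokernel.condition _)
  have hS : S.ShortExact :=
    { exact := ShortComplex.exact_of_g_is_cokernel _ (cokernelIsCokernel _)
      mono_f := by dsimp [S]; infer_instance
      epi_g := by dsimp [S]; infer_instance }
  have h2 : TopCat.Sheaf.IsFlasque (C := AddCommGrpCat.{0}) S.X₂ :=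
    ⟨fun {U V} i => (AddCommGrpCat.epi_iff_surjective _).2 (isFlasque_of_injective _ i.unop)⟩
  have h1 : TopCat.Sheaf.IsFlasque (C := AddCommGrpCat.{0}) S.X₁ := hF
  refine ⟨S, hS, rfl, fun q => inferInstanceAs (Subsingleton
    (CategoryTheory.Sheaf.H (Injective.under F) (q + 1))), ?_, ?_⟩
  · exact TopCat.Sheaf.IsFlasque.of_shortExact_of_isFlasque₁₂ (S := S) hS
  · exact (AddCommGrpCat.epi_iff_surjective _).1
      (TopCat.Sheaf.IsFlasque.epi_of_shortExact (S := S) hS)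

variable (X) (k : Type) [CommRing k]

/-- The sheaf of abelian groups underlying a sheaf of modules over a ring. -/
abbrev toAbSheaf : Sheaf (Opens.grothendieckTopology X) (ModuleCat.{0} k) ⥤ AbSheaf X :=
  sheafCompose _ (forget₂ (ModuleCat.{0} k) AddCommGrpCat.{0})

instance : (toAbSheaf X k).Additive where

variable {X k}

/-- Injectivity and exactness in the middle hold already on sections over each open set.
Surjectivity is local surjectivity on sections, a condition that does not involve the module
structure. -/
theorem toAbSheaf_shortExact {S : ShortComplex (Sheaf (Opens.grothendieckTopology X)
    (ModuleCat.{0} k))} (hS : S.ShortExact) : (S.map (toAbSheaf X k)).ShortExact := by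
  have := hS.mono_f
  have := hS.epi_g
  have hex : ∀ U : Opens X, (S.map (sheafToPresheaf _ _ ⋙ (evaluation _ _).obj (op U))).Exact ∧
      Mono (S.map (sheafToPresheaf _ _ ⋙ (evaluation _ _).obj (op U))).f := fun U =>
    ⟨hS.exact.map_of_mono_of_preservesKernel _ inferInstance inferInstance,
      Functor.map_mono (sheafToPresheaf _ _ ⋙ (evaluation _ _).obj (op U)) S.f⟩
  refine shortExact_of_locally (fun U => ?_) (fun U s hs x hx => ?_) (fun U s x hx => ?_)
  · exact (ModuleCat.mono_iff_injective _).1 (hex U).2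
  · obtain ⟨t, ht⟩ := (ShortComplex.moduleCat_exact_iff _).1 (hex U).1 s hs
    refine ⟨U, le_rfl, hx, t, ht.trans ?_⟩
    exact (ConcreteCategory.congr_hom (S.X₂.obj.map_id (op U)) s).symm
  · have h : Epi S.g := hS.epi_g
    rw [← CategoryTheory.Sheaf.isLocallySurjective_iff_epi' (ModuleCat.{0} k) S.g] at h
    obtain ⟨V, hV, ⟨t, ht⟩, hxV⟩ := (TopCat.Presheaf.isLocallySurjective_iff S.g.hom).1 h U s x hx
    exact ⟨V, hV, hxV, t, ht⟩

/-- Flasqueness concerns only the underlying sets, so it survives forgetting the module structure.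
-/
theorem isAcyclicSheaf_toAbSheaf_of_injective
    (I : Sheaf (Opens.grothendieckTopology X) (ModuleCat.{0} k)) [Injective I] :
    IsAcyclicSheaf ((toAbSheaf X k).obj I) :=
  isAcyclicSheaf_of_flasque _ fun i =>
    surjective_map_of_injective (ModuleCat.adj k) I i

/-- The sheaves of modules with acyclic underlying sheaf of abelian groups are adapted to the
functor of global sections. -/
theorem isAdaptedClass_acyclic :
    IsAdaptedClass (sheafToPresheaf (Opens.grothendieckTopology X) (ModuleCat.{0} k) ⋙
      (evaluation _ _).obj (op ⊤)) (fun F => IsAcyclicSheaf ((toAbSheaf X k).obj F)) where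
  of_iso e h := h.of_iso ((toAbSheaf X k).mapIso e)
  of_injective Y _ := isAcyclicSheaf_toAbSheaf_of_injective Y
  biprod {Y Z} hY hZ :=
    IsAcyclicSheaf.middle (toAbSheaf_shortExact (ShortComplex.Splitting.ofHasBinaryBiproduct
      Y Z).shortExact) hY hZ
  cokernel hS h₁ h₂ := IsAcyclicSheaf.cokernel (toAbSheaf_shortExact hS) h₁ h₂
  epi hS h₁ := (ModuleCat.epi_iff_surjective _).2
    (IsAcyclicSheaf.surjective (toAbSheaf_shortExact hS) h₁)

end
end WeylFourier
end

noncomputable section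
namespace WeylFourier
open CategoryTheory Limits Opposite TopologicalSpace AlgebraicGeometry StructureSheaf

/-! ### Injective modules over noetherian rings. -/

section
variable {R : Type} [CommRing R]

/-- Over a noetherian ring, a compatible family of fractions `mᵢ / Fᵢ` with values in an injective
module is induced by a single element. -/
theorem exists_pow_smul_eq_of_injective [IsNoetherianRing R] {J : Type} [AddCommGroup J]
    [Module R J] [Module.Injective R J] {ι : Type} [Finite ι] (F : ι → R) (m : ι → J)
    (h : ∀ i j, F j • m i = F i • m j) :
    ∃ (z : J) (L : ℕ), ∀ i, F i ^ (L + 1) • z = F i ^ L • m i := by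
  classical
  have := Fintype.ofFinite ι
  let I : Ideal R := Ideal.span (Set.range F)
  let M₀ : Submodule R J := Submodule.span R (Set.range m)
  have hM₀ : Module.Finite R M₀ :=
    Module.Finite.iff_fg.2 (Submodule.fg_span (Set.finite_range m))
  -- `N` is the part of `M₀` killed by `I`. By Artin–Rees, `I^(k+1) M₀ ∩ N = I (I^k M₀ ∩ N)` for
  -- large `k`, and this lies in `I N = 0`.
  let N : Submodule R M₀ := ⨅ j, LinearMap.ker (LinearMap.lsmul R M₀ (F j))
  have hIN : I • N = ⊥ := by
    rw [eq_bot_iff, Submodule.smul_le]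
    intro r hr z hz
    have hz' : ∀ j, F j • z = 0 := fun j => by
      simpa using (Submodule.mem_iInf _).1 hz j
    have hI : I ≤ (Submodule.span R {z}).annihilator := by
      refine Ideal.span_le.2 ?_
      rintro _ ⟨j, rfl⟩
      exact Submodule.mem_annihilator_span_singleton _ _ |>.2 (hz' j)
    exact (Submodule.mem_annihilator_span_singleton _ _).1 (hI hr)
  obtain ⟨k, hk⟩ := Ideal.exists_pow_inf_eq_pow_smul I N
  have hbot : I ^ (k + 1) • (⊤ : Submodule R M₀) ⊓ N = ⊥ := by
    rw [hk (k + 1) (Nat.le_succ k), Nat.add_sub_cancel_left, pow_one, eq_bot_iff, ← hIN]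
    exact Submodule.smul_mono le_rfl inf_le_right
  -- The aim is a linear map on the ideal generated by the `Fᵢ^(k+2)` that sends `Fᵢ^(k+2)` to
  -- `Fᵢ^(k+1) mᵢ`. It is well defined because a relation among the generators yields an element of
  -- `I^(k+1) M₀` that all `Fⱼ` kill. By injectivity the map extends to `R`, and `z` is the image of
  -- `1`.
  let p : (ι → R) →ₗ[R] R := Fintype.linearCombination R fun i => F i ^ (k + 1 + 1)
  let q : (ι → R) →ₗ[R] J := Fintype.linearCombination R fun i => F i ^ (k + 1) • m i
  have hpq : LinearMap.ker p ≤ LinearMap.ker q := by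
    intro a ha
    let m' : ι → M₀ := fun i => ⟨m i, Submodule.subset_span ⟨i, rfl⟩⟩
    let z : M₀ := ∑ i, a i • F i ^ (k + 1) • m' i
    have hz : (z : J) = q a := by
      simp [z, q, m', Fintype.linearCombination_apply]
    have h1 : z ∈ I ^ (k + 1) • (⊤ : Submodule R M₀) :=
      Submodule.sum_mem _ fun i _ => Submodule.smul_mem _ _ (Submodule.smul_mem_smul
        (Ideal.pow_mem_pow (Ideal.subset_span (Set.mem_range_self i)) _) trivial)
    have h2 : z ∈ N := by
      refine (Submodule.mem_iInf _).2 fun j => ?_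
      have h3 : F j • q a = p a • m j := by
        simp only [q, p, Fintype.linearCombination_apply, Finset.smul_sum, Finset.sum_smul]
        refine Finset.sum_congr rfl fun i _ => ?_
        rw [smul_comm (F j), smul_comm (F j), h i j, smul_smul, smul_smul, smul_eq_mul]
        congr 1
        ring
      have h4 : p a = 0 := ha
      rw [h4, zero_smul, ← hz] at h3
      exact Subtype.ext h3
    have h5 : z ∈ I ^ (k + 1) • (⊤ : Submodule R M₀) ⊓ N := ⟨h1, h2⟩
    rw [hbot, Submodule.mem_bot] at h5
    rw [LinearMap.mem_ker, ← hz, h5]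
    rfl
  obtain ⟨g, hg⟩ := Module.Injective.out ((LinearMap.ker p).liftQ p le_rfl)
    (LinearMap.ker_eq_bot.1 (Submodule.ker_liftQ_eq_bot _ _ _ le_rfl))
    ((LinearMap.ker p).liftQ q hpq)
  refine ⟨g 1, k + 1, fun i => ?_⟩
  have h1 := hg (Submodule.Quotient.mk (Pi.single i 1))
  have h2 : p (Pi.single i 1) = F i ^ (k + 1 + 1) := by
    simp [p, Fintype.linearCombination_apply_single]
  have h3 : q (Pi.single i 1) = F i ^ (k + 1) • m i := by
    simp [q, Fintype.linearCombination_apply_single]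
  rw [← map_smul, smul_eq_mul, mul_one, ← h2, ← h3]
  exact h1

variable {J : Type} [AddCommGroup J] [Module R J]

/-- An element that vanishes at all points of a basic open set is killed by a power. -/
theorem exists_pow_smul_eq_zero (r : R) (d : J)
    (h : ∀ y : PrimeSpectrum R, r ∉ y.asIdeal → ∃ t ∉ y.asIdeal, t • d = 0) :
    ∃ K : ℕ, r ^ K • d = 0 := by
  have h1 : r ∈ (Submodule.span R {d}).annihilator.radical := by
    rw [Ideal.radical_eq_sInf, Ideal.mem_sInf]
    rintro P ⟨hP, hprime⟩
    by_contra hr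
    obtain ⟨t, ht, htd⟩ := h ⟨P, hprime⟩ hr
    exact ht (hP ((Submodule.mem_annihilator_span_singleton _ _).2 htd))
  obtain ⟨K, hK⟩ := h1
  exact ⟨K, (Submodule.mem_annihilator_span_singleton _ _).1 hK⟩

/-- Two fractions that agree at all points of a basic open set. -/
theorem exists_pow_smul_eq (f₁ f₂ : R) (m₁ m₂ : J)
    (h : ∀ (y : PrimeSpectrum R) (h₁ : f₁ ∉ y.asIdeal) (h₂ : f₂ ∉ y.asIdeal),
      (LocalizedModule.mk m₁ ⟨f₁, h₁⟩ : LocalizedModule y.asIdeal.primeCompl J) =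
        LocalizedModule.mk m₂ ⟨f₂, h₂⟩) :
    ∃ K : ℕ, (f₁ * f₂) ^ K • f₂ • m₁ = (f₁ * f₂) ^ K • f₁ • m₂ := by
  obtain ⟨K, hK⟩ := exists_pow_smul_eq_zero (f₁ * f₂) (f₂ • m₁ - f₁ • m₂) fun y hy => by
    have h₁ : f₁ ∉ y.asIdeal := fun h' => hy (y.asIdeal.mul_mem_right _ h')
    have h₂ : f₂ ∉ y.asIdeal := fun h' => hy (y.asIdeal.mul_mem_left _ h')
    obtain ⟨⟨u, hu⟩, h'⟩ := LocalizedModule.mk_eq.1 (h y h₁ h₂)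
    refine ⟨u, hu, ?_⟩
    rw [smul_sub, sub_eq_zero]
    exact h'
  refine ⟨K, ?_⟩
  rwa [smul_sub, sub_eq_zero] at hK

/-- Over a noetherian ring, the sections of the sheaf associated with an injective module are
restrictions of elements of the module. -/
theorem exists_const_eq_of_injective [IsNoetherianRing R] [Module.Injective R J]
    (U : Opens (PrimeSpectrum.Top R)) (s : (structureSheafInType R J).obj.obj (op U)) :
    ∃ z : J, ∀ y : U, s.1 y = LocalizedModule.mk z 1 := by
  choose g hg hgU f hf using fun x : U => exists_const U s x.1 x.2
  have hc : IsCompact (show Set (PrimeSpectrum R) from U.1) := NoetherianSpace.isCompact _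
  obtain ⟨t, ht⟩ := hc.elim_finite_subcover (fun x : U => (PrimeSpectrum.basicOpen (g x) :
    Set (PrimeSpectrum R))) (fun x => (PrimeSpectrum.basicOpen (g x)).2)
    (fun x hx => Set.mem_iUnion.2 ⟨⟨x, hx⟩, hg ⟨x, hx⟩⟩)
  have hs : ∀ (x : U) (y : U) (hy : g x ∉ y.1.asIdeal),
      s.1 y = LocalizedModule.mk (f x) ⟨g x, hy⟩ := fun x y hy =>
    (congrFun (congrArg Subtype.val (hf x)) ⟨y.1, hy⟩).symm
  have hK : ∀ i j : t, ∃ K : ℕ, (g i.1 * g j.1) ^ K • g j.1 • f i.1 =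
      (g i.1 * g j.1) ^ K • g i.1 • f j.1 := fun i j =>
    exists_pow_smul_eq _ _ _ _ fun y h₁ h₂ => (hs i.1 ⟨y, hgU i.1 h₁⟩ h₁).symm.trans
      (hs j.1 ⟨y, hgU i.1 h₁⟩ h₂)
  choose K hK using hK
  -- A single exponent for all pairs. With it, the fractions `f / g` rewritten as `g^K₀ f /
  -- g^(K₀+1)` satisfy the cross-multiplied equations exactly in `J`, as
  -- `exists_pow_smul_eq_of_injective` requires.
  let K₀ : ℕ := ∑ i, ∑ j, K i j
  have hle : ∀ i j, K i j ≤ K₀ := fun i j =>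
    (Finset.single_le_sum (fun _ _ => Nat.zero_le _) (Finset.mem_univ j)).trans
      (Finset.single_le_sum (f := fun i => ∑ j, K i j) (fun _ _ => Nat.zero_le _)
        (Finset.mem_univ i))
  have hK₀ : ∀ i j : t, (g i.1 * g j.1) ^ K₀ • g j.1 • f i.1 =
      (g i.1 * g j.1) ^ K₀ • g i.1 • f j.1 := fun i j => by
    rw [← Nat.sub_add_cancel (hle i j), pow_add, mul_smul, hK, mul_smul]
  obtain ⟨z, L, hz⟩ := exists_pow_smul_eq_of_injective (fun i : t => g i.1 ^ (K₀ + 1))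
    (fun i : t => g i.1 ^ K₀ • f i.1) (fun i j => by
      have h1 := hK₀ i j
      simp only [smul_smul] at h1 ⊢
      convert h1 using 2 <;> ring)
  refine ⟨z, fun y => ?_⟩
  obtain ⟨x, hx, hy⟩ := Set.mem_iUnion₂.1 (ht y.2)
  rw [hs x y hy]
  have := PrimeSpectrum.isPrime y.1
  refine LocalizedModule.mk_eq.2 ⟨⟨g x ^ ((K₀ + 1) * L + K₀), y.1.asIdeal.primeCompl.pow_mem hy _⟩,
    ?_⟩
  have h1 := hz ⟨x, hx⟩
  simp only [Submonoid.smul_def, one_smul, smul_smul, ← pow_mul] at h1 ⊢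
  rw [pow_add, ← h1]
  congr 1
  ring

end

end WeylFourier
end

noncomputable section
namespace WeylFourier
open CategoryTheory Limits Opposite TopologicalSpace AlgebraicGeometry StructureSheaf

/-! ### The sheaf associated with a module on `Spec R`, and its acyclicity. -/

section
variable (R : Type) [CommRing R]

instance (x : PrimeSpectrum.Top R) : (PrimeSpectrum.asIdeal x).IsPrime := PrimeSpectrum.isPrime x

/-- The sheaf of abelian groups on `Spec R` associated with a module. -/
def moduleAbSheaf (M : Type) [AddCommGroup M] [Module R M] : AbSheaf (PrimeSpectrum.Top R) :=
  ⟨structurePresheafInModuleCat R M ⋙ forget₂ (ModuleCat R) AddCommGrpCat,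
    (TopCat.Presheaf.isSheaf_iff_isSheaf_comp (forget AddCommGrpCat) _).2
      (structureSheafInType R M).2⟩

variable {R} {M N P : Type} [AddCommGroup M] [Module R M] [AddCommGroup N] [Module R N]
  [AddCommGroup P] [Module R P]

/-- The action of a linear map on sections. -/
def mapSections (f : M →ₗ[R] N) (U : Opens (PrimeSpectrum.Top R)) :
    (structureSheafInType R M).obj.obj (op U) →+ (structureSheafInType R N).obj.obj (op U) where
  toFun s := ⟨fun x => LocalizedModule.map (PrimeSpectrum.asIdeal x.1).primeCompl f (s.1 x),
    fun x => by
      obtain ⟨V, hxV, i, a, r, h⟩ := s.2 x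
      refine ⟨V, hxV, i, f a, r, fun y => ⟨(h y).1, ?_⟩⟩
      have h1 := congrArg (LocalizedModule.map (PrimeSpectrum.asIdeal y.1).primeCompl f) (h y).2
      exact h1.trans (LocalizedModule.map_mk ..)⟩
  map_zero' := Subtype.ext (funext fun x => map_zero _)
  map_add' s t := Subtype.ext (funext fun x => map_add _ _ _)

/-- The morphism of sheaves of abelian groups associated with a linear map. -/
def moduleAbSheafMap (f : M →ₗ[R] N) : moduleAbSheaf R M ⟶ moduleAbSheaf R N where
  hom :=
    { app := fun U => AddCommGrpCat.ofHom (mapSections f U.unop)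
      naturality := fun _ _ _ => rfl }

theorem localizedModule_map_comp_eq_zero (S : Submonoid R) {f : M →ₗ[R] N} {g : N →ₗ[R] P}
    (h : g.comp f = 0) (z : LocalizedModule S M) :
    LocalizedModule.map S g (LocalizedModule.map S f z) = 0 := by
  induction z using LocalizedModule.induction_on with
  | h m s =>
    rw [LocalizedModule.map_mk, LocalizedModule.map_mk, ← LinearMap.comp_apply, h,
      LinearMap.zero_apply, LocalizedModule.zero_mk]

/-- The complex of sheaves associated with a complex of modules. -/
def moduleAbSheafComplex (f : M →ₗ[R] N) (g : N →ₗ[R] P) (h : g.comp f = 0) :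
    ShortComplex (AbSheaf (PrimeSpectrum.Top R)) :=
  ShortComplex.mk (moduleAbSheafMap f) (moduleAbSheafMap g) (by
    refine CategoryTheory.Sheaf.hom_ext (NatTrans.ext (funext fun U => ?_))
    refine AddCommGrpCat.hom_ext (AddMonoidHom.ext fun s => ?_)
    exact Subtype.ext (funext fun x =>
      localizedModule_map_comp_eq_zero (PrimeSpectrum.asIdeal x.1).primeCompl h (s.1 x)))

/-- Sections are locally fractions, so the statement reduces to exactness of localization: kernels
and preimages are found in the numerators after shrinking the open set. -/
theorem moduleAbSheafComplex_shortExact (f : M →ₗ[R] N) (g : N →ₗ[R] P) (h : g.comp f = 0)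
    (hf : Function.Injective f) (hex : Function.Exact f g) (hg : Function.Surjective g) :
    (moduleAbSheafComplex f g h).ShortExact := by
  refine shortExact_of_locally (fun U s t hst => ?_) (fun U s hs x hx => ?_) (fun U s x hx => ?_)
  · refine Subtype.ext (funext fun x => ?_)
    exact LocalizedModule.map_injective (PrimeSpectrum.asIdeal x.1).primeCompl f hf
      (congrFun (congrArg Subtype.val hst) x)
  · obtain ⟨r, hxr, hrU, m, hm⟩ := exists_const U (show (structureSheafInType R N).obj.obj (op U)
      from s) x hx
    have hr : ∀ (y : PrimeSpectrum R) (hy : r ∉ y.asIdeal),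
        s.1 ⟨y, hrU hy⟩ = LocalizedModule.mk m ⟨r, hy⟩ := fun y hy =>
      (congrFun (congrArg Subtype.val hm) ⟨y, hy⟩).symm
    have h1 : (LocalizedModule.mk (g m) ⟨r, hxr⟩ :
        LocalizedModule (PrimeSpectrum.asIdeal x).primeCompl P) = 0 := by
      have h2 := congrFun (congrArg Subtype.val hs) ⟨x, hx⟩
      have h3 := congrArg (LocalizedModule.map (PrimeSpectrum.asIdeal x).primeCompl g) (hr x hxr)
      exact ((LocalizedModule.map_mk ..).symm.trans h3.symm).trans h2
    rw [← LocalizedModule.zero_mk ⟨r, hxr⟩, LocalizedModule.mk_eq] at h1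
    obtain ⟨⟨t, ht⟩, h2⟩ := h1
    have h3 : g ((t * r) • m) = 0 := by
      rw [map_smul, mul_smul]
      simpa [Submonoid.smul_def] using h2
    obtain ⟨a, ha⟩ := (hex _).1 h3
    have hV : PrimeSpectrum.basicOpen (t * r * r) ≤ U := fun y hy =>
      hrU (fun h' => hy (Ideal.mul_mem_left _ _ h'))
    -- As `f a = t r m`, the fraction `a / (t r r)` is mapped to `m / r`.
    refine ⟨PrimeSpectrum.basicOpen (t * r * r), hV,
      (PrimeSpectrum.asIdeal x).primeCompl.mul_mem
        ((PrimeSpectrum.asIdeal x).primeCompl.mul_mem ht hxr) hxr,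
      const a (t * r * r) _ le_rfl, ?_⟩
    refine Subtype.ext (funext fun y => ?_)
    have hy : r ∉ (PrimeSpectrum.asIdeal y.1) := fun h' => y.2 (Ideal.mul_mem_left _ _ h')
    refine Eq.trans ?_ (hr y.1 hy).symm
    refine Eq.trans (LocalizedModule.map_mk ..) ?_
    refine LocalizedModule.mk_eq.2 ⟨1, ?_⟩
    rw [ha]
    simp only [Submonoid.smul_def, one_smul, smul_smul]
    congr 1
    ring
  · obtain ⟨r, hxr, hrU, m, hm⟩ := exists_const U (show (structureSheafInType R P).obj.obj (op U)
      from s) x hx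
    obtain ⟨a, rfl⟩ := hg m
    refine ⟨PrimeSpectrum.basicOpen r, hrU, hxr, const a r _ le_rfl, ?_⟩
    refine Eq.trans ?_ hm
    exact Subtype.ext (funext fun y => LocalizedModule.map_mk ..)

/-- The sheaf associated with an injective module over a noetherian ring is acyclic. -/
theorem isAcyclicSheaf_of_injective_module [IsNoetherianRing R] [Module.Injective R M] :
    IsAcyclicSheaf (moduleAbSheaf R M) := by
  refine isAcyclicSheaf_of_flasque _ fun {U V} i s => ?_
  obtain ⟨z, hz⟩ := exists_const_eq_of_injective V
    (show (structureSheafInType R M).obj.obj (op V) from s)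
  refine ⟨const z (1 : R) U (by rw [PrimeSpectrum.basicOpen_one]; exact le_top), ?_⟩
  exact Subtype.ext (funext fun y => (hz y).symm)

/-- The sheaf associated with a module over a noetherian ring is acyclic. -/
theorem isAcyclicSheaf_moduleAbSheaf [IsNoetherianRing R] :
    IsAcyclicSheaf (moduleAbSheaf R M) := by
  refine isAcyclicSheaf_of_resolutions
    (P := fun F => ∃ M : ModuleCat.{0} R, F = moduleAbSheaf R M) ?_ _ ⟨ModuleCat.of R M, rfl⟩
  rintro _ ⟨M, rfl⟩
  let f := Injective.ι M
  let g := cokernel.π f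
  have hS : (ShortComplex.mk f g (cokernel.condition _)).ShortExact :=
    { exact := ShortComplex.exact_of_g_is_cokernel _ (cokernelIsCokernel _)
      mono_f := by dsimp [f]; infer_instance
      epi_g := by dsimp [g]; infer_instance }
  have hg : Function.Surjective g.hom := (ModuleCat.epi_iff_surjective g).1 inferInstance
  have h0 : g.hom.comp f.hom = 0 := congrArg ModuleCat.Hom.hom (cokernel.condition f)
  have hI : Injective (ModuleCat.of R (Injective.under M : ModuleCat.{0} R)) :=
    inferInstanceAs (Injective (Injective.under M))
  have : Module.Injective R (Injective.under M : ModuleCat R) :=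
    Module.injective_module_of_injective_object R _
  refine ⟨moduleAbSheafComplex f.hom g.hom h0,
    moduleAbSheafComplex_shortExact _ _ h0 ((ModuleCat.mono_iff_injective f).1 inferInstance)
      ((ShortComplex.ShortExact.moduleCat_exact_iff_function_exact _).1 hS.exact) hg, rfl,
    isAcyclicSheaf_of_injective_module, ⟨_, rfl⟩, fun s => ?_⟩
  -- Global sections are the elements of the module itself, so they lift because `g` is surjective.
  -- This gives the degree one input for dimension shifting.
  obtain ⟨q, hq⟩ := toOpenₗ_top_bijective (M := (cokernel f : ModuleCat R)) |>.2 s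
  obtain ⟨m, rfl⟩ := hg q
  refine ⟨const m (1 : R) ⊤ (by rw [PrimeSpectrum.basicOpen_one]; exact le_top), ?_⟩
  refine Eq.trans ?_ hq
  exact Subtype.ext (funext fun y => LocalizedModule.map_mk ..)

end
end WeylFourier
end

noncomputable section
namespace WeylFourier
open CategoryTheory Limits Opposite TopologicalSpace AlgebraicGeometry

/-! ### Acyclicity of the terms of the de Rham complex. -/

section

theorem isZero_map_biproduct {C D : Type*} [Category* C] [Category* D] [Preadditive C]
    [Preadditive D] [HasFiniteBiproducts C] (Φ : C ⥤ D) [Φ.Additive] {J : Type} [Finite J]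
    (f : J → C) (h : ∀ j, IsZero (Φ.obj (f j))) : IsZero (Φ.obj (⨁ f)) := by
  have := Fintype.ofFinite J
  rw [IsZero.iff_id_eq_zero, ← Φ.map_id, ← biproduct.total, Φ.map_sum]
  refine Finset.sum_eq_zero fun j _ => ?_
  rw [Φ.map_comp, (h j).eq_of_tgt (Φ.map (biproduct.π f j)) 0, zero_comp]

/-- Cohomology is additive, so it vanishes on a finite direct sum when it vanishes on the summands.
This covers the terms `Ωᵖ ⊗ 𝓜`. -/
theorem isAcyclicSheaf_biproduct {X : TopCat.{0}} {k : Type} [CommRing k]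
    [HasFiniteBiproducts (Sheaf (Opens.grothendieckTopology X) (ModuleCat.{0} k))]
    {J : Type} [Finite J] (f : J → Sheaf (Opens.grothendieckTopology X) (ModuleCat.{0} k))
    (h : ∀ j, IsAcyclicSheaf ((toAbSheaf X k).obj (f j))) :
    IsAcyclicSheaf ((toAbSheaf X k).obj (⨁ f)) := by
  intro q
  have h1 : IsZero ((toAbSheaf X k ⋙ CategoryTheory.Sheaf.functorH _ (q + 1)).obj (⨁ f)) :=
    isZero_map_biproduct _ f fun j => by
      have := h j q
      exact AddCommGrpCat.isZero_of_subsingleton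
        (AddCommGrpCat.of (CategoryTheory.Sheaf.H ((toAbSheaf X k).obj (f j)) (q + 1)))
  exact AddCommGrpCat.subsingleton_of_isZero h1

variable {n : ℕ}

/-- The sheaf of abelian groups underlying a `𝒟`-module and that underlying its `𝒪`-module. -/
def DMod.toAbSheafIso (M : DMod n) :
    (toAbSheaf (X n) ℂ).obj M.toSh ≅ (SheafOfModules.toSheaf _).obj M.toO :=
  (fullyFaithfulSheafToPresheaf _ _).preimageIso
    (NatIso.ofComponents (fun _ => Iso.refl _) fun _ => rfl)

/-- The sheaf of abelian groups underlying the quasi-coherent sheaf associated with a module. -/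
def tildeAbSheafIso {R : CommRingCat.{0}} (N : ModuleCat.{0} R) :
    (SheafOfModules.toSheaf _).obj (tilde N) ≅ moduleAbSheaf R N :=
  Iso.refl _

/-- Acyclicity concerns only the underlying sheaf of abelian groups. As an `𝒪`-module, a
quasi-coherent sheaf on affine space is the sheaf associated with its global sections, a module over
a noetherian polynomial ring. -/
theorem DMod.isAcyclicSheaf (M : DMod n)
    (hM : SheafOfModules.IsQuasicoherent (R := (X n).ringCatSheaf) M.toO) :
    IsAcyclicSheaf ((toAbSheaf (X n) ℂ).obj M.toSh) := by
  let M' : (Spec (CommRingCat.of (MvPolynomial (Fin n) ℂ))).Modules := M.toO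
  have : M'.IsQuasicoherent := hM
  have hi := Scheme.Modules.isIso_fromTildeΓ_of_isQuasicoherent
    (R := CommRingCat.of (MvPolynomial (Fin n) ℂ)) M'
  let e := (SheafOfModules.toSheaf _).mapIso (@asIso _ _ _ _ _ hi)
  have h : IsAcyclicSheaf (moduleAbSheaf (MvPolynomial (Fin n) ℂ)
    ((modulesSpecToSheaf.obj M').presheaf.obj (op ⊤))) := isAcyclicSheaf_moduleAbSheaf
  exact h.of_iso ((tildeAbSheafIso _).symm ≪≫ e ≪≫ M.toAbSheafIso.symm)

instance : PreservesFiniteLimits (globalSectionsFunctor n) :=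
  comp_preservesFiniteLimits (sheafToPresheaf _ _) ((evaluation _ _).obj (op ⊤))

end
end WeylFourier

end

theorem proposition6p1 (n : ℕ) (M : WeylFourier.DMod n)
    (hM : WeylFourier.DMod.IsHolonomic M) (i : ℤ) :
    Nonempty (WeylFourier.DMod.deRhamCohomology M i ≅
      WeylFourier.restrictionToOrigin
        (WeylFourier.Weyl.fourierTransform (WeylFourier.DMod.globalSections M)) i) := by
  open WeylFourier CategoryTheory in
  obtain ⟨e₁⟩ := (isAdaptedClass_acyclic (X := (X n)) (k := ℂ)).nonempty_iso_homology
    (globalSectionsFunctor n) ⟨M.deRham, M.deRham_plus⟩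
    (fun p => isAcyclicSheaf_biproduct (fun _ : WedgeIndex n p => M.toSh)
      fun _ => M.isAcyclicSheaf hM.quasicoherent) i
  obtain ⟨e₂⟩ := nonempty_iso_restrictionToOrigin (Weyl.fourierTransform M.globalSections) i
  exact ⟨e₁ ≪≫ (HomologicalComplex.homologyFunctor _ _ i).mapIso (globalSectionsDeRhamIso M) ≪≫ e₂⟩
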